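/- \textbf{Setting.} Let $d\ge 1$, $r\ge 1$ be integers, $\|\cdot\|$ the Euclidean norm, and let $\Omega\subset\mathbb R^{d+1}$ be the closure of a nonempty open, bounded, connected set, with $\Gamma=\partial\Omega$, such that $\Omega$ is a $C^2$-domain: there are $\delta,M>0$ and finitely many connected open sets $U_1,\dots,U_J$ covering $\Gamma$ such that (i) every $x\in\Omega$ with $\operatorname{dist}(x,\Gamma)<\delta$ lies in some $U_j$ with $\operatorname{dist}(x,\partial U_j)>\delta$; (ii) in a suitable Cartesian coordinate system $(\xi_1,\dots,\xi_{d+1})$, depending on $j$, $\Omega\cap U_j=\{\xi\in U_j:\xi_{d+1}\le F_j(\xi_1,\dots,\xi_d)\}$ with $F_j\in C^2(\mathbb R^d)$ and $\|\partial_i\partial_kF_j\|_\infty\le M$ for all $i,k$. Write $L^p(\Omega)$ for the Lebesgue space if $0<p<\infty$ and $L^\infty(\Omega)=C(\Omega)$; for $p=\infty$ the $L^p$-norm is the essential supremum. For $f:\Omega\to\mathbb R$ put $\triangle^r_h(f,\Omega,\eta)=\sum_{j=0}^r(-1)^{r+j}\binom rj f(\eta+jh)$ if $[\eta,\eta+rh]\subset\Omega$,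 and $0$ otherwise. \textbf{Domains of special type.} An upward $x_{d+1}$-domain with base size $b>0$ and parameter $L\ge1$ is a set $G=\xi+\{(x,y):x\in(-b,b)^d,\ g(x)-Lb<y\le g(x)\}$ with $\xi\in\mathbb R^{d+1}$, $g\in C^2(\mathbb R^d)$; for it put $\partial'G(\lambda)=\xi+\{(x,g(x)):x\in(-\lambda b,\lambda b)^d\}$, $\partial'G=\partial'G(1)$, and $G^*=\xi+\{(x,y):x\in(-2b,2b)^d,\ \min_{[-2b,2b]^d}g-4Lb<y\le g(x)\}$, with $\partial'G^*=\partial'G(2)$. Upward and downward $x_j$-domains, $1\le j\le d+1$, and their associated sets arise from these by exchanging the coordinates $x_j,x_{d+1}$ and, in the downward case, then reflecting in the plane $x_j=0$. Such a $G\subset\Omega$ is attached to $\Gamma$ if $\overline{G^*}\cap\Gamma=\overline{\partial'G^*}$ and $G^*=Q\cap\Omega$ for some open axis-parallel box $Q$. Fix any finite family $G_1,\dots,G_m\subset\Omega$ of (presented) domains of special type attached to $\Gamma$ which cover $\Gamma$ and satisfy $L\ge 4\sqrt d\max_{[-2b,2b]^d}\|\nabla g\|+1$. \textbf{The modulus $\omega_\Omega^r$.}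 Let $A_0>1$ and $0<t\le 1$. For an upward $x_{d+1}$-domain with $\xi=0$ let $G^t=\{\zeta\in G:\operatorname{dist}(\zeta,\partial'G)\ge A_0t^2\}$, $\xi_j(u)=e_j+\partial_jg(u)e_{d+1}$, $I_x(tb)=\{u\in(-b,b)^d:\|u-x\|\le tb\}$ and $$\widetilde\omega_G^r(f,t;A_0)_p=\sup_{0<s\le t,\ 1\le j\le d}\Bigl(\int_{G^t}\Bigl[\frac1{(bt)^d}\int_{I_x(tb)}|\triangle^r_{s\xi_j(u)}(f,\Omega,(x,y))|^p\,du\Bigr]dx\,dy\Bigr)^{1/p}$$ (with the $L^\infty$-norm if $p=\infty$); in general $\widetilde\omega_G^r(f,t;A_0)_p$ is defined by transporting $G$, $\Omega$ and $f$ by the above reflections and a translation to this normal form. With $\varphi_\Omega(e,\xi)=\max\{\sqrt{l_1l_2}:l_1,l_2\ge0,\ [\xi-l_1e,\xi+l_2e]\subset\Omega\}$ and the standard basis vectors $e_j$, set $$\omega_\Omega^r(f,t;A_0)_p=\max_{1\le j\le d+1}\ \sup_{|h|\le t}\bigl\|\triangle^r_{h\varphi_\Omega(e_j,\cdot)e_j}(f,\Omega,\cdot)\bigr\|_{L^p(\Omega)}+\sum_{i=1}^m\widetilde\omega_{G_i}^r(f,t;A_0)_p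 .$$ \textbf{Ivanov's modulus.} With $\rho_\Omega(\xi,\eta)=\|\xi-\eta\|+|\sqrt{\operatorname{dist}(\xi,\Gamma)}-\sqrt{\operatorname{dist}(\eta,\Gamma)}|$ and $U(\xi,\delta)=\{\eta\in\Omega:\rho_\Omega(\xi,\eta)\le\delta\}$, put $\tau_r(f,\delta)_{p,q}=\|w_r(f,\cdot,\delta)_q\|_{L^p(\Omega)}$, where $$w_r(f,\xi,\delta)_q=\Bigl(\frac1{|U(\xi,\delta)|}\int_{U(\xi,\delta)}|\triangle^r_{(\eta-\xi)/r}(f,\Omega,\xi)|^q\,d\eta\Bigr)^{1/q}\ (q<\infty),\qquad w_r(f,\xi,\delta)_\infty=\sup_{\eta\in U(\xi,\delta)}|\triangle^r_{(\eta-\xi)/r}(f,\Omega,\xi)|.$$ \textbf{Theorem.} For every $A_0>1$ there is a constant $c_0>1$, independent of $p,q$, such that for all $0<q\le p\le\infty$ there is a constant $C>0$ with $$\omega_\Omega^r(f,t;A_0)_p\le C\,\tau_r(f,c_0t)_{p,q}\qquad\text{for all } f\in L^p(\Omega),\ 0<t\le1 .$$ -/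

import Mathlib

open MeasureTheory Set
open scoped ENNReal

namespace IvanovModuli

/-- `ℝⁿ` with its Euclidean norm and Lebesgue measure. -/
abbrev Euc (n : ℕ) := EuclideanSpace ℝ (Fin n)

/-- The `r`-th forward difference `∑ⱼ (-1)^(r+j) (r choose j) f (η + j h)`. -/
def finDiff {V : Type*} [AddCommGroup V] [Module ℝ V] (r : ℕ) (h : V) (f : V → ℝ) (η : V) : ℝ :=
  ∑ j ∈ Finset.range (r + 1), (-1 : ℝ) ^ (r + j) * (r.choose j : ℝ) * f (η + (j : ℝ) • h)

open Classical in
/-- The finite difference relative to `Ω`: it is `0` unless the segment `[η, η + r h]` lies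
in `Ω`. Only the values of `f` on `Ω` matter. -/
noncomputable def finDiffOn {V : Type*} [AddCommGroup V] [Module ℝ V] (r : ℕ) (h : V)
    (f : V → ℝ) (Ω : Set V) (η : V) : ℝ :=
  if segment ℝ η (η + (r : ℝ) • h) ⊆ Ω then finDiff r h f η else 0

/-- `f ∈ L^p(Ω)`, with the convention `L^∞(Ω) = C(Ω)`. -/
def MemLpOn {n : ℕ} (f : Euc n → ℝ) (p : ℝ≥0∞) (Ω : Set (Euc n)) : Prop :=
  if p = ∞ then ContinuousOn f Ω else MemLp f p (volume.restrict Ω)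

/-- The first `d` coordinates `x` of a point `(x, y) ∈ ℝ^(d+1)`; the last one is
`z (Fin.last d)`. -/
def horiz {d : ℕ} (z : Euc (d + 1)) : Euc d :=
  WithLp.toLp 2 fun i => z i.castSucc

/-! ### `C²`-domains -/

/-- `Ω` has `C²` boundary `Γ = ∂Ω`: finitely many connected open sets `U j` cover `Γ`, they do so
uniformly near `Γ`, and in each of them `Ω` is the subgraph, in suitable Cartesian coordinates, of
a `C²` function with second partial derivatives bounded by `M`. -/
def HasC2Boundary {d : ℕ} (Ω : Set (Euc (d + 1))) : Prop :=
  ∃ (δ M : ℝ) (J : ℕ) (U : Fin J → Set (Euc (d + 1))), 0 < δ ∧ 0 < M ∧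
    (∀ j, IsOpen (U j) ∧ IsConnected (U j)) ∧
    frontier Ω ⊆ ⋃ j, U j ∧
    (∀ x ∈ Ω, Metric.infDist x (frontier Ω) < δ →
      ∃ j, x ∈ U j ∧ δ < Metric.infDist x (frontier (U j))) ∧
    (∀ j, ∃ (φ : Euc (d + 1) ≃ᵃⁱ[ℝ] Euc (d + 1)) (F : Euc d → ℝ), ContDiff ℝ 2 F ∧
      (∀ (x : Euc d) (i k : Fin d),
        |iteratedFDeriv ℝ 2 F x ![EuclideanSpace.single i 1, EuclideanSpace.single k 1]| ≤ M) ∧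
      Ω ∩ U j = {z | z ∈ U j ∧ (φ z) (Fin.last d) ≤ F (horiz (φ z))})

/-- `Ω` is the closure of a bounded open connected nonempty set, and is a `C²`-domain. -/
def IsCompactC2Domain {d : ℕ} (Ω : Set (Euc (d + 1))) : Prop :=
  (∃ D : Set (Euc (d + 1)), IsOpen D ∧ IsConnected D ∧ Bornology.IsBounded D ∧ Ω = closure D) ∧
    HasC2Boundary Ω

/-! ### Domains of special type -/

/-- The open cube `(-s, s)^d`. -/
def openCube (d : ℕ) (s : ℝ) : Set (Euc d) := {x | ∀ i, x i ∈ Ioo (-s) s}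

/-- The closed cube `[-s, s]^d`. -/
def closedCube (d : ℕ) (s : ℝ) : Set (Euc d) := {x | ∀ i, x i ∈ Icc (-s) s}

/-- The reflection exchanging the `j`-th and the last coordinate. -/
def swapLast {d : ℕ} (j : Fin (d + 1)) (z : Euc (d + 1)) : Euc (d + 1) :=
  WithLp.toLp 2 fun i => z (Equiv.swap j (Fin.last d) i)

/-- The reflection in the coordinate plane `x_j = 0`. -/
noncomputable def negCoord {d : ℕ} (j : Fin (d + 1)) (z : Euc (d + 1)) : Euc (d + 1) :=
  WithLp.toLp 2 fun i => if i = j then -z i else z i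

/-- The data presenting a domain of special type: an upward (`down = false`) or downward
(`down = true`) `x_dir`-domain with base size `b` and parameter `L`. -/
structure SpecialDomain (d : ℕ) where
  dir : Fin (d + 1)
  down : Bool
  shift : Euc (d + 1)
  g : Euc d → ℝ
  b : ℝ
  L : ℝ
  g_contDiff : ContDiff ℝ 2 g
  b_pos : 0 < b
  one_le_L : 1 ≤ L

namespace SpecialDomain

variable {d : ℕ}

/-- The rigid motion `T` (reflections, then a translation) that takes the domain to its normal
form, an upward `x_{d+1}`-domain with translation vector `0`. -/
noncomputable def toNormal (G : SpecialDomain d) (z : Euc (d + 1)) : Euc (d + 1) :=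
  swapLast G.dir (if G.down then negCoord G.dir z else z) - G.shift

/-- The inverse `T⁻¹` of `toNormal`. -/
noncomputable def ofNormal (G : SpecialDomain d) (z : Euc (d + 1)) : Euc (d + 1) :=
  if G.down then negCoord G.dir (swapLast G.dir (z + G.shift)) else swapLast G.dir (z + G.shift)

lemma swapLast_swapLast (j : Fin (d + 1)) (z : Euc (d + 1)) : swapLast j (swapLast j z) = z := by
  ext i; simp [swapLast]

lemma negCoord_negCoord (j : Fin (d + 1)) (z : Euc (d + 1)) : negCoord j (negCoord j z) = z := by
  ext i; by_cases h : i = j <;> simp [negCoord, h]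

lemma toNormal_ofNormal (G : SpecialDomain d) (z : Euc (d + 1)) :
    G.toNormal (G.ofNormal z) = z := by
  cases h : G.down <;> simp [toNormal, ofNormal, h, swapLast_swapLast, negCoord_negCoord]

lemma ofNormal_toNormal (G : SpecialDomain d) (z : Euc (d + 1)) :
    G.ofNormal (G.toNormal z) = z := by
  cases h : G.down <;> simp [toNormal, ofNormal, h, swapLast_swapLast, negCoord_negCoord]

/-- The normal form of `G(lam)`. -/
def normalSet (G : SpecialDomain d) (lam : ℝ) : Set (Euc (d + 1)) :=
  {z | horiz z ∈ openCube d (lam * G.b) ∧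
    G.g (horiz z) - lam * G.L * G.b < z (Fin.last d) ∧ z (Fin.last d) ≤ G.g (horiz z)}

/-- The normal form of the essential boundary `∂'G(lam)`. -/
def normalEssBdry (G : SpecialDomain d) (lam : ℝ) : Set (Euc (d + 1)) :=
  {z | horiz z ∈ openCube d (lam * G.b) ∧ z (Fin.last d) = G.g (horiz z)}

/-- The normal form of `G^*`; the infimum is a minimum. -/
def normalStar (G : SpecialDomain d) : Set (Euc (d + 1)) :=
  {z | horiz z ∈ openCube d (2 * G.b) ∧
    sInf (G.g '' closedCube d (2 * G.b)) - 4 * G.L * G.b < z (Fin.last d) ∧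
    z (Fin.last d) ≤ G.g (horiz z)}

/-- The domain `G = G(1)` itself. -/
def carrier (G : SpecialDomain d) : Set (Euc (d + 1)) := G.ofNormal '' G.normalSet 1

/-- The set `G^*`. -/
def star (G : SpecialDomain d) : Set (Euc (d + 1)) := G.ofNormal '' G.normalStar

/-- The essential boundary `∂'G^* = ∂'G(2)` of `G^*`. -/
def essBdryStar (G : SpecialDomain d) : Set (Euc (d + 1)) := G.ofNormal '' G.normalEssBdry 2

/-- The standing condition `L ≥ 4 √d max_{[-2b,2b]^d} ‖∇g‖ + 1`. -/
def LargeParameter (G : SpecialDomain d) : Prop :=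
  ∀ x ∈ closedCube d (2 * G.b), 4 * Real.sqrt d * ‖gradient G.g x‖ + 1 ≤ G.L

/-- `G ⊆ Ω` is attached to `Γ = ∂Ω`. -/
def IsAttached (G : SpecialDomain d) (Ω : Set (Euc (d + 1))) : Prop :=
  G.carrier ⊆ Ω ∧
    closure G.star ∩ frontier Ω = closure G.essBdryStar ∧
    ∃ lo hi : Fin (d + 1) → ℝ, (∀ i, lo i < hi i) ∧
      G.star = {z | ∀ i, z i ∈ Ioo (lo i) (hi i)} ∩ Ω

/-- The tangent vector `e_j + ∂_j g(u) e_{d+1}` (in the normal form). -/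
noncomputable def tangent (G : SpecialDomain d) (j : Fin d) (u : Euc d) : Euc (d + 1) :=
  EuclideanSpace.single j.castSucc 1 +
    (fderiv ℝ G.g u (EuclideanSpace.single j 1)) • EuclideanSpace.single (Fin.last d) 1

/-- The normal form of `G^t = {ξ ∈ G : dist(ξ, ∂'G) ≥ A₀ t²}`. -/
def normalInner (G : SpecialDomain d) (A₀ t : ℝ) : Set (Euc (d + 1)) :=
  {z | z ∈ G.normalSet 1 ∧ A₀ * t ^ 2 ≤ Metric.infDist z (G.normalEssBdry 1)}

/-- `I_x(s) = {u ∈ (-b, b)^d : ‖u - x‖ ≤ s}`. -/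
def baseBall (G : SpecialDomain d) (x : Euc d) (s : ℝ) : Set (Euc d) :=
  {u | u ∈ openCube d G.b ∧ ‖u - x‖ ≤ s}

/-- The tangential modulus `ω̃_G^r(f, t; A₀)_p` for `0 < t ≤ 1`, computed in the normal form,
with `Ω` and `f` replaced by `T(Ω)` and `f ∘ T⁻¹`. For `p < ∞` the iterated norm is
`(∫_{G^t} (bt)^{-d} ∫_{I_x(bt)} |Δ|^p du dx dy)^{1/p}`; for `p = ∞` it is the essential
supremum. -/
noncomputable def tanModulusAux (G : SpecialDomain d) (r : ℕ) (Ω : Set (Euc (d + 1)))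
    (f : Euc (d + 1) → ℝ) (t A₀ : ℝ) (p : ℝ≥0∞) : ℝ≥0∞ :=
  ⨆ s ∈ Ioc (0 : ℝ) t, ⨆ j : Fin d,
    eLpNorm (fun z : Euc (d + 1) =>
        eLpNorm (fun u : Euc d =>
            finDiffOn r (s • G.tangent j u) (f ∘ G.ofNormal) (G.toNormal '' Ω) z) p
          ((ENNReal.ofReal ((G.b * t) ^ d))⁻¹ •
            (volume.restrict (G.baseBall (horiz z) (t * G.b)))))
      p (volume.restrict (G.normalInner A₀ t))

/-- The tangential modulus for all `t`, constant for `t ≥ 1`. -/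
noncomputable def tanModulus (G : SpecialDomain d) (r : ℕ) (Ω : Set (Euc (d + 1)))
    (f : Euc (d + 1) → ℝ) (t A₀ : ℝ) (p : ℝ≥0∞) : ℝ≥0∞ :=
  G.tanModulusAux r Ω f (min t 1) A₀ p

end SpecialDomain

/-- `G 0, …, G (m-1)` is a finite cover of `∂Ω` by domains of special type contained in `Ω` and
attached to `∂Ω`, with parameters subject to the standing condition. -/
def IsBoundaryCover {d m : ℕ} (G : Fin m → SpecialDomain d) (Ω : Set (Euc (d + 1))) : Prop :=
  (∀ i, (G i).IsAttached Ω ∧ (G i).LargeParameter) ∧ frontier Ω ⊆ ⋃ i, (G i).carrier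

/-! ### The modulus `ω_Ω^r(f, t; A₀)_p` -/

/-- `φ_Ω(e, ξ) = max {√(l₁ l₂) : l₁, l₂ ≥ 0, [ξ - l₁ e, ξ + l₂ e] ⊆ Ω}`. -/
noncomputable def phi {n : ℕ} (Ω : Set (Euc n)) (e ξ : Euc n) : ℝ :=
  sSup {s | ∃ l₁ l₂ : ℝ, 0 ≤ l₁ ∧ 0 ≤ l₂ ∧
    segment ℝ (ξ - l₁ • e) (ξ + l₂ • e) ⊆ Ω ∧ s = Real.sqrt (l₁ * l₂)}

/-- The Ditzian–Totik modulus of `f` on `Ω` in the direction `e`. -/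
noncomputable def dtModulus {n : ℕ} (r : ℕ) (Ω : Set (Euc n)) (f : Euc n → ℝ) (t : ℝ)
    (e : Euc n) (p : ℝ≥0∞) : ℝ≥0∞ :=
  ⨆ h ∈ {h : ℝ | |h| ≤ min t 1},
    eLpNorm (fun ξ => finDiffOn r ((h * phi Ω e ξ) • e) f Ω ξ) p (volume.restrict Ω)

/-- The modulus `ω_Ω^r(f, t; A₀)_p` built on the boundary cover `G`. -/
noncomputable def omega {d m : ℕ} (G : Fin m → SpecialDomain d) (r : ℕ)
    (Ω : Set (Euc (d + 1))) (f : Euc (d + 1) → ℝ) (t A₀ : ℝ) (p : ℝ≥0∞) : ℝ≥0∞ :=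
  (⨆ j : Fin (d + 1), dtModulus r Ω f t (EuclideanSpace.single j 1) p) +
    ∑ i, (G i).tanModulus r Ω f t A₀ p

/-! ### Ivanov's average modulus `τ_r(f, δ)_{p,q}` -/

/-- The metric `ρ_Ω(ξ, η) = ‖ξ - η‖ + |√dist(ξ, Γ) - √dist(η, Γ)|`, `Γ = ∂Ω`. -/
noncomputable def rho {n : ℕ} (Ω : Set (Euc n)) (ξ η : Euc n) : ℝ :=
  ‖ξ - η‖ + |Real.sqrt (Metric.infDist ξ (frontier Ω)) - Real.sqrt (Metric.infDist η (frontier Ω))|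

/-- `U(ξ, δ) = {η ∈ Ω : ρ_Ω(ξ, η) ≤ δ}`. -/
def rhoBall {n : ℕ} (Ω : Set (Euc n)) (ξ : Euc n) (δ : ℝ) : Set (Euc n) :=
  {η | η ∈ Ω ∧ rho Ω ξ η ≤ δ}

/-- The local modulus `w_r(f, ξ, δ)_q`. -/
noncomputable def localModulus {n : ℕ} (r : ℕ) (Ω : Set (Euc n)) (f : Euc n → ℝ) (ξ : Euc n)
    (δ : ℝ) (q : ℝ≥0∞) : ℝ≥0∞ :=
  if q = ∞ then
    ⨆ η ∈ rhoBall Ω ξ δ, ‖finDiffOn r ((r : ℝ)⁻¹ • (η - ξ)) f Ω ξ‖ₑ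
  else
    ((volume (rhoBall Ω ξ δ))⁻¹ *
      ∫⁻ η in rhoBall Ω ξ δ, ‖finDiffOn r ((r : ℝ)⁻¹ • (η - ξ)) f Ω ξ‖ₑ ^ q.toReal) ^
        (1 / q.toReal)

/-- Ivanov's average `(p, q)`-modulus `τ_r(f, δ)_{p,q} = ‖w_r(f, ·, δ)_q‖_{L^p(Ω)}`. -/
noncomputable def tau {n : ℕ} (r : ℕ) (Ω : Set (Euc n)) (f : Euc n → ℝ) (δ : ℝ)
    (p q : ℝ≥0∞) : ℝ≥0∞ :=
  eLpNorm (fun ξ => localModulus r Ω f ξ δ q) p (volume.restrict Ω)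

end IvanovModuli

/-! Both parts of `omega` are norms of single differences Δ^r_v f(ξ), whereas τ averages over all
steps of an Ivanov ball. The bridge is the identity `finDiff_exchange`: expanding the sum over i, j
of ± C(r,i) C(r,j) f(ξ + iv + ijs) in its two orders gives differences with steps v + js at ξ on one
side and differences with steps is at ξ + iv on the other. The term j = 0 is Δ^r_v f(ξ) up to sign,
the term i = 0 vanishes, and every remaining term depends on the free step s. Averaging over s and
substituting the end point of the segment for s bounds |Δ^r_v f(ξ)| by a sum of local moduli at the
nodes ξ + iv (`exists_enorm_finDiff_le`).

The set of steps s must keep all segments in Ω, stay in Ivanov balls of radius O(t), and have volume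
comparable to these balls. Near Γ write Ω = {ψ ≥ 0} and let ρ be the distance of ξ to Γ. An Ivanov
ball of radius t is roughly a slab of width t tangentially and A = t(√ρ + t) along dψ, and the set A
≤ dψ(ξ)s ≤ 2A with tangential width θt works: its inward push of at least A beats the curvature
error when θ and t are small (`exists_averagingSet_near`). Away from Γ a Euclidean ball suffices.
The nodes stay in the ball provided that |v| ≤ Kt and |dψ(ξ)v| ≤ Kt(√ρ + t). Steps of the
Ditzian–Totik modulus satisfy this because φ_Ω(e,ξ)|dψ(ξ)e| = O(√ρ)
(`IsGraphChartAt.phi_mul_abs_fderiv_le`), tangential steps because the gradient of g is Lipschitz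
(`exists_tangent_bounds`). For t bounded below, Δ^r_v is split into differences with short steps,
and the Ivanov balls are all of Ω (`exists_enorm_finDiff_le_sum_localModulus`).

Finally the pointwise bound is integrated. The node maps must not compress measure by more than a
constant factor: on lines, x + τhφ(x) is injective with derivative at least 1/2
(`lintegral_comp_chebyshev_le`), and for the tangential modulus the node maps are translations once
u is fixed (`lintegral_comp_tangent_le`). The number c₀ is fixed before q appears; only the factor C
depends on p and q. -/

namespace IvanovModuli

/-! ### Algebraic identities for r-th differences -/

section Differences

variable {V : Type*} [AddCommGroup V] [Module ℝ V]

/-- Both sides are the double sum of ± C(r,i) C(r,j) f(ξ + iv + ijs), summed in different orders. -/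
lemma finDiff_exchange (r : ℕ) (v s : V) (f : V → ℝ) (ξ : V) :
    ∑ j ∈ Finset.range (r + 1), (-1 : ℝ) ^ (r + j) * (r.choose j : ℝ) *
        finDiff r (v + (j : ℝ) • s) f ξ =
      ∑ i ∈ Finset.range (r + 1), (-1 : ℝ) ^ (r + i) * (r.choose i : ℝ) *
        finDiff r ((i : ℝ) • s) f (ξ + (i : ℝ) • v) := by
  simp only [finDiff, Finset.mul_sum]
  rw [Finset.sum_comm]
  refine Finset.sum_congr rfl fun i _ => Finset.sum_congr rfl fun j _ => ?_
  have : ξ + (i : ℝ) • (v + (j : ℝ) • s) = ξ + (i : ℝ) • v + (j : ℝ) • (i : ℝ) • s := by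
    module
  rw [this]; ring

/-- The alternating binomial sum is (1 - 1)^r, which is 0 only for r ≥ 1. This removes the term i =
0 of the exchange identity, which would have no averaging in it. -/
lemma finDiff_zero_step {r : ℕ} (hr : 1 ≤ r) (f : V → ℝ) (ξ : V) : finDiff r 0 f ξ = 0 := by
  have h := (add_pow (1 : ℝ) (-1) r).symm
  have h2 : ∑ j ∈ Finset.range (r + 1), (-1 : ℝ) ^ (r + j) * (r.choose j : ℝ) = 0 := by
    rw [add_neg_cancel, zero_pow (by omega)] at h
    rw [← h]
    refine Finset.sum_congr rfl fun j hj => ?_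
    have : j ≤ r := by simpa [Nat.lt_succ_iff] using hj
    obtain ⟨k, rfl⟩ := Nat.exists_eq_add_of_le this
    simp only [one_pow, one_mul, Nat.add_sub_cancel_left]
    congr 1
    rw [show j + k + j = 2 * j + k by ring, pow_add, pow_mul]; simp
  simp only [finDiff, smul_zero, add_zero, ← Finset.sum_mul, h2, zero_mul]

/-- The exchange identity solved for its term j = 0; the factor 2^r bounds the binomial
coefficients. -/
lemma norm_finDiff_le_sum {r : ℕ} (hr : 1 ≤ r) (v s : V) (f : V → ℝ) (ξ : V) :
    ‖finDiff r v f ξ‖ ≤ 2 ^ r * (∑ j ∈ Finset.range r, ‖finDiff r (v + ((j + 1 : ℕ) : ℝ) • s) f ξ‖ +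
      ∑ i ∈ Finset.range r,
        ‖finDiff r (((i + 1 : ℕ) : ℝ) • s) f (ξ + ((i + 1 : ℕ) : ℝ) • v)‖) := by
  have h := finDiff_exchange r v s f ξ
  rw [Finset.sum_range_succ', Finset.sum_range_succ'] at h
  simp only [Nat.cast_zero, zero_smul, add_zero, finDiff_zero_step hr, mul_zero,
    Nat.choose_zero_right, Nat.cast_one, mul_one] at h
  have hb : ∀ (g : ℕ → ℝ), ‖∑ j ∈ Finset.range r,
      (-1 : ℝ) ^ (r + (j + 1)) * (r.choose (j + 1) : ℝ) * g j‖ ≤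
      2 ^ r * ∑ j ∈ Finset.range r, ‖g j‖ := by
    intro g
    rw [Finset.mul_sum]
    refine (norm_sum_le _ _).trans (Finset.sum_le_sum fun j _ => ?_)
    rw [norm_mul, norm_mul, norm_pow, norm_neg, norm_one, one_pow, one_mul]
    gcongr
    rw [Real.norm_natCast]
    exact_mod_cast Nat.choose_le_two_pow r (j + 1)
  have h1 : ‖finDiff r v f ξ‖ = ‖(-1 : ℝ) ^ r * finDiff r v f ξ‖ := by simp
  rw [h1, eq_sub_of_add_eq' h, mul_add, add_comm]
  exact (norm_sub_le _ _).trans (add_le_add (hb _) (hb _))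

/-- With T the translation by v, the difference with step Nv is (T^N - 1)^r = Q(T)(T - 1)^r for Q =
(1 + X + ... + X^(N-1))^r; the numbers c k are the coefficients of Q, whose degree is at most r(N -
1). -/
lemma exists_finDiff_split (r N : ℕ) (hN : 1 ≤ N) : ∃ c : ℕ → ℝ, ∀ (v : V) (f : V → ℝ) (ξ : V),
    finDiff r ((N : ℝ) • v) f ξ =
      ∑ k ∈ Finset.range (r * (N - 1) + 1), c k * finDiff r v f (ξ + (k : ℝ) • v) := by
  classical
  set Q : Polynomial ℝ := (∑ i ∈ Finset.range N, Polynomial.X ^ i) ^ r with hQ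
  have hdeg : Q.natDegree ≤ r * (N - 1) := by
    refine Polynomial.natDegree_pow_le.trans (Nat.mul_le_mul_left _ ?_)
    refine Polynomial.natDegree_sum_le_of_forall_le _ _ fun i hi => ?_
    rw [Polynomial.natDegree_X_pow]
    have := Finset.mem_range.mp hi
    omega
  refine ⟨Q.coeff, fun v f ξ => ?_⟩
  set T : Module.End ℝ (V → ℝ) := LinearMap.funLeft ℝ ℝ (fun x => x + v) with hT
  have hTp : ∀ (k : ℕ) (g : V → ℝ) (x : V), (T ^ k) g x = g (x + (k : ℝ) • v) := by
    intro k
    induction k with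
    | zero => intro g x; simp
    | succ k ih =>
      intro g x
      rw [pow_succ, Module.End.mul_apply, ih]
      simp only [hT, LinearMap.funLeft_apply]
      congr 1; push_cast; module
  have hgen : ∀ (M : ℕ) (g : V → ℝ) (x : V),
      ((T ^ M - 1) ^ r) g x = finDiff r ((M : ℝ) • v) g x := by
    intro M g x
    have hc : Commute (T ^ M) (-1) := Commute.neg_one_right (T ^ M)
    rw [sub_eq_add_neg, hc.add_pow, finDiff]
    simp only [LinearMap.sum_apply, Finset.sum_apply]
    refine Finset.sum_congr rfl fun j hj => ?_
    have hjr : j ≤ r := by simpa [Nat.lt_succ_iff] using hj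
    obtain ⟨k, rfl⟩ := Nat.exists_eq_add_of_le hjr
    have e1 : (T ^ M) ^ j * (-1) ^ (j + k - j) * ((j + k).choose j : Module.End ℝ (V → ℝ)) =
        ((-1 : ℝ) ^ k * ((j + k).choose j : ℝ)) • (T ^ (M * j)) := by
      rw [Nat.add_sub_cancel_left, ← pow_mul, mul_assoc]
      have : ((-1 : Module.End ℝ (V → ℝ)) ^ k * ((j + k).choose j : Module.End ℝ (V → ℝ))) =
          algebraMap ℝ (Module.End ℝ (V → ℝ)) ((-1 : ℝ) ^ k * ((j + k).choose j : ℝ)) := by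
        simp
      rw [this, Algebra.smul_def, Algebra.commutes]
    rw [e1, LinearMap.smul_apply, Pi.smul_apply, hTp, smul_eq_mul]
    have e2 : (-1 : ℝ) ^ (j + k + j) = (-1) ^ k := by
      rw [show j + k + j = 2 * j + k by ring, pow_add, pow_mul]; simp
    rw [e2]
    congr 2
    push_cast; module
  have h1 := hgen 1
  simp only [pow_one, Nat.cast_one, one_smul] at h1
  rw [← hgen N f ξ]
  have hfac : (T ^ N - 1) ^ r = (Polynomial.aeval T Q) * (T - 1) ^ r := by
    rw [hQ, map_pow, map_sum]
    simp only [map_pow, Polynomial.aeval_X]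
    rw [← geom_sum_mul, Commute.mul_pow]
    refine Commute.sub_right ?_ (Commute.one_right _)
    exact Commute.sum_left _ _ _ fun i _ => (Commute.refl T).pow_left i
  rw [hfac, Module.End.mul_apply, Polynomial.aeval_eq_sum_range' (Nat.lt_succ_of_le hdeg)]
  simp only [LinearMap.sum_apply, Finset.sum_apply, LinearMap.smul_apply, Pi.smul_apply,
    smul_eq_mul, hTp, h1]

end Differences

end IvanovModuli

namespace IvanovModuli

/-! ### The substitution x + τhφ(x) on a line -/

section LineChangeOfVariables

/-- `φ y = √((y - a) (b - y))` on each component `[a, b]` of `K`. -/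
def IsChebyshevWeight (K : Set ℝ) (φ : ℝ → ℝ) : Prop :=
  ∀ x ∈ K, ∃ a b, a ≤ x ∧ x ≤ b ∧ Icc a b ⊆ K ∧
    (∀ a' b', a' ≤ x → x ≤ b' → Icc a' b' ⊆ K → a ≤ a' ∧ b' ≤ b) ∧
    ∀ y ∈ Icc a b, φ y = Real.sqrt ((y - a) * (b - y))

/-- If x ≠ x' had the same image, subtracting p² and p'² would give p + p' = τh(x + x' - a - b). For
h > 0 the end point condition rhp ≤ b - x, multiplied by x - a, yields rh(x - a) ≤ p, and likewise
for x'; adding these makes p + p' too large. For h < 0 the roles of a and b are exchanged. -/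
lemma chebyshev_injective_aux {a b x x' p p' r h τ : ℝ} (hx : x ∈ Ioo a b) (hx' : x' ∈ Ioo a b)
    (hp : 0 < p) (hp' : 0 < p') (hp2 : p ^ 2 = (x - a) * (b - x))
    (hp2' : p' ^ 2 = (x' - a) * (b - x')) (hτ : 0 ≤ τ) (hτr : τ ≤ r)
    (h1 : x + r * h * p ∈ Icc a b) (h1' : x' + r * h * p' ∈ Icc a b)
    (he : x + τ * h * p = x' + τ * h * p') : x = x' := by
  by_contra hne
  have hpp : p - p' ≠ 0 := by
    intro h0
    apply hne
    have : p = p' := by linarith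
    subst this; linarith
  have e1 : (p - p') * (p + p') = (p - p') * (τ * h * (x + x' - a - b)) := by
    have : x - x' = τ * h * (p' - p) := by linarith
    calc (p - p') * (p + p') = p ^ 2 - p' ^ 2 := by ring
      _ = (x - x') * (a + b - x - x') := by rw [hp2, hp2']; ring
      _ = _ := by rw [this]; ring
  have e2 := mul_left_cancel₀ hpp e1
  obtain ⟨hxa, hxb⟩ := hx
  obtain ⟨hxa', hxb'⟩ := hx'
  have hsum : 0 < p + p' := by linarith
  rcases lt_trichotomy h 0 with hh | hh | hh
  · have k1 : r * (-h) * (b - x) ≤ p := by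
      have : r * (-h) * p ≤ x - a := by linarith [h1.1]
      have : p * (r * (-h) * (b - x)) ≤ p * p := by nlinarith
      exact le_of_mul_le_mul_left this hp
    have k2 : r * (-h) * (b - x') ≤ p' := by
      have : r * (-h) * p' ≤ x' - a := by linarith [h1'.1]
      have : p' * (r * (-h) * (b - x')) ≤ p' * p' := by nlinarith
      exact le_of_mul_le_mul_left this hp'
    have hh' : 0 < -h := by linarith
    have hτ0 : 0 < τ := by
      rcases hτ.lt_or_eq with h0 | h0
      · exact h0
      · rw [← h0] at e2; simp at e2; linarith
    have k3 : τ * (-h) * (2 * b - x - x') ≤ r * (-h) * (2 * b - x - x') := by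
      have : 0 < 2 * b - x - x' := by linarith
      gcongr
    have k4 : 0 < τ * (-h) * (b - a) := by
      have : 0 < b - a := by linarith
      positivity
    nlinarith
  · rw [hh] at e2; simp at e2; linarith
  · have k1 : r * h * (x - a) ≤ p := by
      have : r * h * p ≤ b - x := by linarith [h1.2]
      have : p * (r * h * (x - a)) ≤ p * p := by nlinarith
      exact le_of_mul_le_mul_left this hp
    have k2 : r * h * (x' - a) ≤ p' := by
      have : r * h * p' ≤ b - x' := by linarith [h1'.2]
      have : p' * (r * h * (x' - a)) ≤ p' * p' := by nlinarith
      exact le_of_mul_le_mul_left this hp'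
    have hτ0 : 0 < τ := by
      rcases hτ.lt_or_eq with h0 | h0
      · exact h0
      · rw [← h0] at e2; simp at e2; linarith
    have k3 : τ * h * (x + x' - 2 * a) ≤ r * h * (x + x' - 2 * a) := by
      have : 0 < x + x' - 2 * a := by linarith
      gcongr
    have k4 : 0 < τ * h * (b - a) := by
      have : 0 < b - a := by linarith
      positivity
    nlinarith

/-- The right side is the derivative of x + τhφ(x). For h ≥ 0 its only negative contribution comes
from -τh(x - a), and the end point condition bounds τh(x - a) by p; the case h ≤ 0 is symmetric. -/
lemma chebyshev_deriv_aux {a b x p r h τ : ℝ} (hx : x ∈ Ioo a b) (hp : 0 < p)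
    (hp2 : p ^ 2 = (x - a) * (b - x)) (hτ : 0 ≤ τ) (hτr : τ ≤ r)
    (h1 : x + r * h * p ∈ Icc a b) :
    1 / 2 ≤ 1 + τ * h * ((a + b - 2 * x) / (2 * p)) := by
  obtain ⟨hxa, hxb⟩ := hx
  have key : -p ≤ τ * h * (a + b - 2 * x) := by
    rcases le_total h 0 with hh | hh
    · have k1 : r * (-h) * (b - x) ≤ p := by
        have : r * (-h) * p ≤ x - a := by linarith [h1.1]
        have : p * (r * (-h) * (b - x)) ≤ p * p := by nlinarith
        exact le_of_mul_le_mul_left this hp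
      have k3 : τ * (-h) * (b - x) ≤ r * (-h) * (b - x) := by
        have : 0 < b - x := by linarith
        have : 0 ≤ -h := by linarith
        gcongr
      have k4 : 0 ≤ τ * (-h) * (x - a) := by
        have : 0 ≤ x - a := by linarith
        have : 0 ≤ -h := by linarith
        positivity
      nlinarith
    · have k1 : r * h * (x - a) ≤ p := by
        have : r * h * p ≤ b - x := by linarith [h1.2]
        have : p * (r * h * (x - a)) ≤ p * p := by nlinarith
        exact le_of_mul_le_mul_left this hp
      have k3 : τ * h * (x - a) ≤ r * h * (x - a) := by
        have : 0 < x - a := by linarith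
        gcongr
      have k4 : 0 ≤ τ * h * (b - x) := by
        have : 0 ≤ b - x := by linarith
        positivity
      nlinarith
  have : τ * h * ((a + b - 2 * x) / (2 * p)) = (τ * h * (a + b - 2 * x)) / (2 * p) := by ring
  rw [this]
  have : -(1 / 2) ≤ (τ * h * (a + b - 2 * x)) / (2 * p) := by
    rw [le_div_iff₀ (by positivity)]; linarith
  linarith

/-- The factor 3 is 2 + 1: where φ ≠ 0 the map is injective with derivative at least 1/2, and where
φ = 0 it is the identity. -/
lemma lintegral_comp_chebyshev_le {K : Set ℝ} {φ : ℝ → ℝ} (hφ : IsChebyshevWeight K φ)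
    (hφm : Measurable φ) {r h τ : ℝ} (hτ : 0 ≤ τ) (hτr : τ ≤ r)
    (hm : MeasurableSet {x | uIcc x (x + r * h * φ x) ⊆ K}) (F : ℝ → ℝ≥0∞) :
    ∫⁻ x in {x | uIcc x (x + r * h * φ x) ⊆ K}, F (x + τ * h * φ x) ≤
      3 * ∫⁻ x in K, F x := by
  set Gd := {x | uIcc x (x + r * h * φ x) ⊆ K} with hGd
  set Φ : ℝ → ℝ := fun x => x + τ * h * φ x with hΦ
  have hz : MeasurableSet {x | φ x = 0} := hφm (measurableSet_singleton 0)
  have hGK : Gd ⊆ K := fun x hx => hx left_mem_uIcc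
  have hs1 : MeasurableSet (Gd \ {x | φ x = 0}) := hm.diff hz
  have prop : ∀ x ∈ Gd \ {x | φ x = 0}, ∃ a b, x ∈ Ioo a b ∧ 0 < φ x ∧
      φ x ^ 2 = (x - a) * (b - x) ∧ x + r * h * φ x ∈ Icc a b ∧ Icc a b ⊆ K ∧
      (∀ a' b', a' ≤ x → x ≤ b' → Icc a' b' ⊆ K → a ≤ a' ∧ b' ≤ b) ∧
      ∀ y ∈ Icc a b, φ y = Real.sqrt ((y - a) * (b - y)) := by
    rintro x ⟨hx, hx0⟩
    obtain ⟨a, b, hax, hxb, hab, hmax, hval⟩ := hφ x (hGK hx)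
    have hv := hval x ⟨hax, hxb⟩
    have hx0 : φ x ≠ 0 := hx0
    have hpos : 0 < φ x := lt_of_le_of_ne (hv ▸ Real.sqrt_nonneg _) hx0.symm
    have hnn : 0 ≤ (x - a) * (b - x) := mul_nonneg (by linarith) (by linarith)
    have hsq : φ x ^ 2 = (x - a) * (b - x) := by rw [hv, Real.sq_sqrt hnn]
    have hmx := hmax _ _ (min_le_left x (x + r * h * φ x)) (le_max_left x (x + r * h * φ x)) hx
    refine ⟨a, b, ⟨lt_of_le_of_ne hax ?_, lt_of_le_of_ne hxb ?_⟩, hpos, hsq,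
      ⟨hmx.1.trans (min_le_right _ _), (le_max_right _ _).trans hmx.2⟩, hab, hmax, hval⟩
    · rintro rfl; rw [sub_self, zero_mul] at hsq; exact hx0 (by simpa using hsq)
    · rintro rfl; rw [sub_self, mul_zero] at hsq; exact hx0 (by simpa using hsq)
  have hmem : ∀ {a b x : ℝ}, x ∈ Ioo a b → x + r * h * φ x ∈ Icc a b → Φ x ∈ Icc a b := by
    intro a b x hx h1
    rcases hτ.lt_or_eq with h0 | h0
    · have hr : 0 < r := by linarith
      have e : Φ x = (1 - τ / r) • x + (τ / r) • (x + r * h * φ x) := by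
        simp only [hΦ, smul_eq_mul]; field_simp; ring
      rw [e]
      exact (convex_Icc a b) (Ioo_subset_Icc_self hx) h1
        (sub_nonneg.mpr ((div_le_one hr).mpr hτr)) (by positivity) (by ring)
    · simp only [hΦ, ← h0]; simpa using Ioo_subset_Icc_self hx
  have hder : ∀ x ∈ Gd \ {x | φ x = 0}, ∃ D, HasDerivAt Φ D x ∧ 1 / 2 ≤ D := by
    intro x hx
    obtain ⟨a, b, hxab, hpos, hsq, h1, -, -, hval⟩ := prop x hx
    refine ⟨_, ?_, chebyshev_deriv_aux hxab hpos hsq hτ hτr h1⟩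
    have hd : HasDerivAt (fun y => Real.sqrt ((y - a) * (b - y)))
        ((a + b - 2 * x) / (2 * φ x)) x := by
      have h2 : HasDerivAt (fun y : ℝ => (y - a) * (b - y)) (a + b - 2 * x) x := by
        have := ((hasDerivAt_id x).sub_const a).mul ((hasDerivAt_id x).const_sub b)
        refine this.congr_deriv ?_
        simp; ring
      have hne : (x - a) * (b - x) ≠ 0 := by rw [← hsq]; positivity
      have := h2.sqrt hne
      rwa [← hval x (Ioo_subset_Icc_self hxab)] at this
    have hev : φ =ᶠ[nhds x] fun y => Real.sqrt ((y - a) * (b - y)) := by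
      filter_upwards [Ioo_mem_nhds hxab.1 hxab.2] with y hy using hval y (Ioo_subset_Icc_self hy)
    exact (hasDerivAt_id x).add ((hd.congr_of_eventuallyEq hev).const_mul (τ * h))
  have hinj : InjOn Φ (Gd \ {x | φ x = 0}) := by
    intro x hx x' hx' he
    obtain ⟨a, b, hxab, hpos, hsq, h1, hab, hmax, hval⟩ := prop x hx
    obtain ⟨a', b', hxab', hpos', hsq', h1', hab', hmax', hval'⟩ := prop x' hx'
    have m1 := hmem hxab h1
    have m2 := hmem hxab' h1'
    rw [← he] at m2
    -- Both components contain the common value of Φ, so their union is an interval in K, and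
    -- maximality forces them to coincide.
    have hun : Icc (min a a') (max b b') ⊆ K := by
      rw [← Icc_union_Icc' (m2.1.trans m1.2) (m1.1.trans m2.2)]
      exact union_subset hab hab'
    have q1 := hmax _ _ ((min_le_left a a').trans hxab.1.le) (hxab.2.le.trans (le_max_left b b')) hun
    have q2 := hmax' _ _ ((min_le_right a a').trans hxab'.1.le)
      (hxab'.2.le.trans (le_max_right b b')) hun
    have ea : a = a' := le_antisymm (q1.1.trans (min_le_right _ _)) (q2.1.trans (min_le_left _ _))
    have eb : b = b' := le_antisymm ((le_max_left _ _).trans q2.2) ((le_max_right _ _).trans q1.2)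
    subst ea eb
    exact chebyshev_injective_aux hxab hxab' hpos hpos' hsq hsq' hτ hτr h1 h1' he
  choose! D hD hD2 using hder
  have e1 : ∫⁻ x in Gd \ {x | φ x = 0}, F (Φ x) ≤ 2 * ∫⁻ x in K, F x := by
    calc ∫⁻ x in Gd \ {x | φ x = 0}, F (Φ x)
        ≤ ∫⁻ x in Gd \ {x | φ x = 0}, 2 * (ENNReal.ofReal |D x| * F (Φ x)) := by
          refine setLIntegral_mono' hs1 fun x hx => ?_
          rw [← mul_assoc]
          refine le_mul_of_one_le_left zero_le ?_
          have : (2 : ℝ≥0∞) = ENNReal.ofReal 2 := by simp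
          rw [this, ← ENNReal.ofReal_mul (by norm_num), ← ENNReal.ofReal_one]
          refine ENNReal.ofReal_le_ofReal ?_
          have := hD2 x hx
          have := le_abs_self (D x)
          linarith
      _ = 2 * ∫⁻ x in Φ '' (Gd \ {x | φ x = 0}), F x := by
          rw [lintegral_const_mul' _ _ (by simp), lintegral_image_eq_lintegral_abs_deriv_mul hs1
            (fun x hx => (hD x hx).hasDerivWithinAt) hinj]
      _ ≤ _ := by
          gcongr
          rintro _ ⟨x, hx, rfl⟩
          obtain ⟨a, b, hxab, -, -, h1, hab, -, -⟩ := prop x hx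
          exact hab (hmem hxab h1)
  have e2 : ∫⁻ x in Gd ∩ {x | φ x = 0}, F (Φ x) ≤ ∫⁻ x in K, F x := by
    calc ∫⁻ x in Gd ∩ {x | φ x = 0}, F (Φ x) = ∫⁻ x in Gd ∩ {x | φ x = 0}, F x := by
          refine setLIntegral_congr_fun (hm.inter hz) fun x hx => ?_
          have : φ x = 0 := hx.2
          simp [hΦ, this]
      _ ≤ _ := lintegral_mono_set (inter_subset_left.trans hGK)
  rw [← lintegral_inter_add_sdiff _ Gd hz]
  calc _ ≤ (∫⁻ x in K, F x) + 2 * ∫⁻ x in K, F x := add_le_add e2 e1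
    _ = _ := by ring

/-- The connected component of x. Closedness of K puts the infimum and supremum of the admissible
end points into K. -/
lemma exists_maximal_Icc {K : Set ℝ} (hK : IsCompact K) {x : ℝ} (hx : x ∈ K) :
    ∃ a b, a ≤ x ∧ x ≤ b ∧ Icc a b ⊆ K ∧
      ∀ a' b', a' ≤ x → x ≤ b' → Icc a' b' ⊆ K → a ≤ a' ∧ b' ≤ b := by
  have hbd := hK.isBounded
  obtain ⟨R, hR⟩ := hbd.subset_closedBall 0
  rw [Real.closedBall_eq_Icc] at hR
  set A := {s | s ≤ x ∧ Icc s x ⊆ K} with hA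
  set B := {s | x ≤ s ∧ Icc x s ⊆ K} with hB
  have hxA : x ∈ A := ⟨le_rfl, by simpa using hx⟩
  have hxB : x ∈ B := ⟨le_rfl, by simpa using hx⟩
  have hAb : BddBelow A := ⟨0 - R, fun s hs => (hR (hs.2 (left_mem_Icc.mpr hs.1))).1⟩
  have hBb : BddAbove B := ⟨0 + R, fun s hs => (hR (hs.2 (right_mem_Icc.mpr hs.1))).2⟩
  have hAK : sInf A ∈ K := by
    have : sInf A ∈ closure A := csInf_mem_closure ⟨x, hxA⟩ hAb
    exact hK.isClosed.closure_subset_iff.mpr (fun s hs => hs.2 (left_mem_Icc.mpr hs.1)) this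
  have hBK : sSup B ∈ K := by
    have : sSup B ∈ closure B := csSup_mem_closure ⟨x, hxB⟩ hBb
    exact hK.isClosed.closure_subset_iff.mpr (fun s hs => hs.2 (right_mem_Icc.mpr hs.1)) this
  refine ⟨sInf A, sSup B, csInf_le hAb hxA, le_csSup hBb hxB, ?_, ?_⟩
  · rintro y ⟨hy1, hy2⟩
    rcases le_total y x with hyx | hyx
    · rcases hy1.lt_or_eq with h | h
      · obtain ⟨s, hs, hsy⟩ := exists_lt_of_csInf_lt ⟨x, hxA⟩ h
        exact hs.2 ⟨hsy.le, hyx⟩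
      · rwa [← h]
    · rcases hy2.lt_or_eq with h | h
      · obtain ⟨s, hs, hsy⟩ := exists_lt_of_lt_csSup ⟨x, hxB⟩ h
        exact hs.2 ⟨hyx, hsy.le⟩
      · rwa [h]
  · intro a' b' ha hb hab
    exact ⟨csInf_le hAb ⟨ha, fun y hy => hab ⟨hy.1, hy.2.trans hb⟩⟩,
      le_csSup hBb ⟨hb, fun y hy => hab ⟨ha.trans hy.1, hy.2⟩⟩⟩

end LineChangeOfVariables

end IvanovModuli

namespace IvanovModuli

/-! ### Segments in Ω, the weight φ_Ω and integration along coordinate lines -/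

section Segments

variable {E : Type*} [NormedAddCommGroup E] [NormedSpace ℝ E]

lemma segment_add_subset_iff {Ω : Set E} {x w : E} :
    segment ℝ x (x + w) ⊆ Ω ↔ ∀ θ ∈ Icc (0 : ℝ) 1, x + θ • w ∈ Ω := by
  rw [segment_eq_image', image_subset_iff]
  simp only [add_sub_cancel_left]
  rfl

lemma isClosed_segment_subset {Ω : Set E} (hΩ : IsClosed Ω) :
    IsClosed {p : E × E | segment ℝ p.1 p.2 ⊆ Ω} := by
  have : {p : E × E | segment ℝ p.1 p.2 ⊆ Ω} =
      ⋂ θ ∈ Icc (0 : ℝ) 1, {p : E × E | p.1 + θ • (p.2 - p.1) ∈ Ω} := by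
    ext p
    simp only [segment_eq_image', mem_ofPred_eq, image_subset_iff, mem_iInter]
    rfl
  rw [this]
  exact isClosed_biInter fun θ _ => hΩ.preimage (by fun_prop)

lemma segment_line_subset_iff {Ω : Set E} {ξ e : E} {a b : ℝ} :
    segment ℝ (ξ + a • e) (ξ + b • e) ⊆ Ω ↔ uIcc a b ⊆ {s | ξ + s • e ∈ Ω} := by
  have h : ∀ s : ℝ, AffineMap.lineMap ξ (ξ + e) s = ξ + s • e := fun s => by
    simp [AffineMap.lineMap_apply, add_comm]
  rw [← h, ← h, ← image_segment, segment_eq_uIcc, image_subset_iff]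
  simp only [preimage, h]

end Segments

section Phi

variable {n : ℕ} {Ω : Set (Euc n)} {e : Euc n}

lemma phi_le_iff_aux {R : ℝ} (hR : Ω ⊆ Metric.closedBall 0 R) (he : ‖e‖ = 1) {ξ : Euc n}
    {l₁ l₂ : ℝ} (h₁ : 0 ≤ l₁) (h₂ : 0 ≤ l₂) (h : segment ℝ (ξ - l₁ • e) (ξ + l₂ • e) ⊆ Ω) :
    ξ ∈ Ω ∧ l₁ ≤ 2 * R ∧ l₂ ≤ 2 * R := by
  have h' : segment ℝ (ξ + (-l₁) • e) (ξ + l₂ • e) ⊆ Ω := by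
    rwa [neg_smul, ← sub_eq_add_neg]
  rw [segment_line_subset_iff, uIcc_of_le (by linarith)] at h'
  have hξ : ξ ∈ Ω := by simpa using h' (show (0 : ℝ) ∈ Icc (-l₁) l₂ from ⟨by linarith, h₂⟩)
  have ha : ξ + (-l₁) • e ∈ Ω := h' (left_mem_Icc.mpr (by linarith))
  have hb : ξ + l₂ • e ∈ Ω := h' (right_mem_Icc.mpr (by linarith))
  have k0 := mem_closedBall_zero_iff.mp (hR hξ)
  have k1 := mem_closedBall_zero_iff.mp (hR ha)
  have k2 := mem_closedBall_zero_iff.mp (hR hb)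
  refine ⟨hξ, ?_, ?_⟩
  · have : ‖(-l₁) • e‖ ≤ ‖ξ + (-l₁) • e‖ + ‖ξ‖ := by
      simpa using norm_sub_le (ξ + (-l₁) • e) ξ
    rw [norm_smul, he, Real.norm_eq_abs, abs_neg, abs_of_nonneg h₁] at this
    linarith
  · have : ‖l₂ • e‖ ≤ ‖ξ + l₂ • e‖ + ‖ξ‖ := by
      simpa using norm_sub_le (ξ + l₂ • e) ξ
    rw [norm_smul, he, Real.norm_eq_abs, abs_of_nonneg h₂] at this
    linarith

lemma phi_nonneg (Ω : Set (Euc n)) (e ξ : Euc n) : 0 ≤ phi Ω e ξ := by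
  apply Real.sSup_nonneg
  rintro s ⟨l₁, l₂, -, -, -, rfl⟩
  exact Real.sqrt_nonneg _

lemma phi_bddAbove {R : ℝ} (hR : Ω ⊆ Metric.closedBall 0 R) (he : ‖e‖ = 1) (ξ : Euc n) :
    2 * R ∈ upperBounds {s | ∃ l₁ l₂ : ℝ, 0 ≤ l₁ ∧ 0 ≤ l₂ ∧
      segment ℝ (ξ - l₁ • e) (ξ + l₂ • e) ⊆ Ω ∧ s = Real.sqrt (l₁ * l₂)} := by
  rintro s ⟨l₁, l₂, h₁, h₂, h, rfl⟩
  obtain ⟨-, k1, k2⟩ := phi_le_iff_aux hR he h₁ h₂ h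
  have : 0 ≤ 2 * R := h₁.trans k1
  rw [← Real.sqrt_sq this]
  refine Real.sqrt_le_sqrt ?_
  rw [sq]; gcongr

lemma phi_le {R : ℝ} (hR0 : 0 ≤ R) (hR : Ω ⊆ Metric.closedBall 0 R) (he : ‖e‖ = 1) (ξ : Euc n) :
    phi Ω e ξ ≤ 2 * R := by
  rcases Set.eq_empty_or_nonempty {s | ∃ l₁ l₂ : ℝ, 0 ≤ l₁ ∧ 0 ≤ l₂ ∧
      segment ℝ (ξ - l₁ • e) (ξ + l₂ • e) ⊆ Ω ∧ s = Real.sqrt (l₁ * l₂)} with h | h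
  · rw [phi, h, Real.sSup_empty]; positivity
  · exact csSup_le h (phi_bddAbove hR he ξ)

/-- For c > 0 the set {φ_Ω ≥ c} is closed: it is the projection of a closed set of triples (l₁, l₂,
ξ) along a compact square of lengths, since the supremum is attained. The levels c ≤ 0 are separate
because a supremum over the empty set is 0. -/
lemma measurable_phi (hΩ : IsCompact Ω) (he : ‖e‖ = 1) : Measurable (phi Ω e) := by
  obtain ⟨R, hR⟩ := hΩ.isBounded.subset_closedBall 0
  refine measurable_of_Ici fun c => ?_
  rcases le_or_gt c 0 with hc | hc
  · have : phi Ω e ⁻¹' Ici c = univ := by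
      ext ξ; simpa using hc.trans (phi_nonneg Ω e ξ)
    rw [this]; exact MeasurableSet.univ
  · have hcl : IsClosed {p : (Icc (0 : ℝ) (2 * R) × Icc (0 : ℝ) (2 * R)) × Euc n |
        segment ℝ (p.2 - (p.1.1 : ℝ) • e) (p.2 + (p.1.2 : ℝ) • e) ⊆ Ω ∧
          c ≤ Real.sqrt ((p.1.1 : ℝ) * (p.1.2 : ℝ))} := by
      refine IsClosed.inter ?_ ?_
      · exact (isClosed_segment_subset hΩ.isClosed).preimage
          (f := fun p : (Icc (0 : ℝ) (2 * R) × Icc (0 : ℝ) (2 * R)) × Euc n =>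
            (p.2 - (p.1.1 : ℝ) • e, p.2 + (p.1.2 : ℝ) • e)) (by fun_prop)
      · exact isClosed_le continuous_const (Continuous.sqrt (by fun_prop))
    have hpr := isClosedMap_snd_of_compactSpace _ hcl
    convert hpr.measurableSet using 1
    ext ξ
    simp only [mem_preimage, mem_Ici, mem_image, mem_ofPred_eq, Prod.exists, exists_eq_right]
    constructor
    · intro h
      set A : Set (ℝ × ℝ) := {l | 0 ≤ l.1 ∧ 0 ≤ l.2 ∧
        segment ℝ (ξ - l.1 • e) (ξ + l.2 • e) ⊆ Ω} with hA
      have hAc : IsCompact A := by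
        refine (isCompact_Icc.prod isCompact_Icc : IsCompact
          (Icc (0 : ℝ) (2 * R) ×ˢ Icc (0 : ℝ) (2 * R))).of_isClosed_subset ?_ ?_
        · refine (isClosed_le continuous_const continuous_fst).inter
            ((isClosed_le continuous_const continuous_snd).inter ?_)
          exact (isClosed_segment_subset hΩ.isClosed).preimage
            (f := fun l : ℝ × ℝ => (ξ - l.1 • e, ξ + l.2 • e)) (by fun_prop)
        · rintro l ⟨h1, h2, h3⟩
          obtain ⟨-, k1, k2⟩ := phi_le_iff_aux hR he h1 h2 h3
          exact ⟨⟨h1, k1⟩, ⟨h2, k2⟩⟩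
      have him : {s | ∃ l₁ l₂ : ℝ, 0 ≤ l₁ ∧ 0 ≤ l₂ ∧
          segment ℝ (ξ - l₁ • e) (ξ + l₂ • e) ⊆ Ω ∧ s = Real.sqrt (l₁ * l₂)} =
          (fun l : ℝ × ℝ => Real.sqrt (l.1 * l.2)) '' A := by
        ext s
        constructor
        · rintro ⟨l₁, l₂, h1, h2, h3, rfl⟩
          exact ⟨(l₁, l₂), ⟨h1, h2, h3⟩, rfl⟩
        · rintro ⟨⟨l₁, l₂⟩, ⟨h1, h2, h3⟩, rfl⟩
          exact ⟨l₁, l₂, h1, h2, h3, rfl⟩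
      rw [phi, him] at h
      have hne : A.Nonempty := by
        by_contra hne
        rw [not_nonempty_iff_eq_empty] at hne
        rw [hne, image_empty, Real.sSup_empty] at h
        linarith
      obtain ⟨⟨l₁, l₂⟩, ⟨h1, h2, h3⟩, hl⟩ := (hAc.image (f := fun l : ℝ × ℝ =>
        Real.sqrt (l.1 * l.2)) (by fun_prop)).sSup_mem (hne.image _)
      obtain ⟨-, k1, k2⟩ := phi_le_iff_aux hR he h1 h2 h3
      exact ⟨⟨l₁, h1, k1⟩, ⟨l₂, h2, k2⟩, h3, by rw [← hl] at h; exact h⟩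
    · rintro ⟨l₁, l₂, h3, h4⟩
      exact h4.trans (le_csSup ⟨_, phi_bddAbove hR he ξ⟩ ⟨l₁, l₂, l₁.2.1, l₂.2.1, h3, rfl⟩)

lemma isCompact_line_preimage (hΩ : IsCompact Ω) (he : ‖e‖ = 1) (ξ : Euc n) :
    IsCompact {s : ℝ | ξ + s • e ∈ Ω} := by
  obtain ⟨R, hR⟩ := hΩ.isBounded.subset_closedBall ξ
  refine (isCompact_Icc : IsCompact (Icc (-R) R)).of_isClosed_subset
    (hΩ.isClosed.preimage (by fun_prop)) fun s hs => ?_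
  have := hR hs
  rw [mem_closedBall_iff_norm, add_sub_cancel_left, norm_smul, he, mul_one, Real.norm_eq_abs] at this
  exact abs_le.mp this

/-- The best l₁ and l₂ at y reach the ends a and b of the component of the line section, so the
maximum of √(l₁l₂) is √((y - a)(b - y)). -/
lemma isChebyshevWeight_phi (hΩ : IsCompact Ω) (he : ‖e‖ = 1) (ξ : Euc n) :
    IsChebyshevWeight {s : ℝ | ξ + s • e ∈ Ω} (fun s => phi Ω e (ξ + s • e)) := by
  intro x hx
  obtain ⟨R, hR⟩ := hΩ.isBounded.subset_closedBall 0
  obtain ⟨a, b, hax, hxb, hab, hmax⟩ := exists_maximal_Icc (isCompact_line_preimage hΩ he ξ) hx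
  refine ⟨a, b, hax, hxb, hab, hmax, fun y hy => ?_⟩
  have hseg : ∀ l₁ l₂ : ℝ, 0 ≤ l₁ → 0 ≤ l₂ →
      (segment ℝ (ξ + y • e - l₁ • e) (ξ + y • e + l₂ • e) ⊆ Ω ↔
        Icc (y - l₁) (y + l₂) ⊆ {s : ℝ | ξ + s • e ∈ Ω}) := by
    intro l₁ l₂ h1 h2
    rw [← uIcc_of_le (by linarith), ← segment_line_subset_iff]
    have e1 : ξ + y • e - l₁ • e = ξ + (y - l₁) • e := by module
    have e2 : ξ + y • e + l₂ • e = ξ + (y + l₂) • e := by module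
    rw [e1, e2]
  have hyΩ : ξ + y • e ∈ Ω := hab hy
  apply le_antisymm
  · refine csSup_le ⟨_, 0, 0, le_rfl, le_rfl, by simpa using hyΩ, rfl⟩ ?_
    rintro s ⟨l₁, l₂, h1, h2, h3, rfl⟩
    rw [hseg l₁ l₂ h1 h2] at h3
    have hun : Icc (min a (y - l₁)) (max b (y + l₂)) ⊆ {s : ℝ | ξ + s • e ∈ Ω} := by
      rw [← Icc_union_Icc' (by linarith [hy.1, hy.2]) (by linarith [hy.1, hy.2])]
      exact union_subset hab h3
    have q := hmax _ _ ((min_le_left _ _).trans hax) (hxb.trans (le_max_left _ _)) hun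
    have q1 := q.1.trans (min_le_right _ _)
    have q2 := (le_max_right _ _).trans q.2
    refine Real.sqrt_le_sqrt ?_
    have := hy.1
    gcongr <;> linarith
  · refine le_csSup ⟨_, phi_bddAbove hR he _⟩ ⟨y - a, b - y, by linarith [hy.1],
      by linarith [hy.2], ?_, rfl⟩
    rw [hseg _ _ (by linarith [hy.1]) (by linarith [hy.2])]
    simpa using hab

lemma measurableSet_phi_segment (hΩ : IsCompact Ω) (he : ‖e‖ = 1) (c : ℝ) :
    MeasurableSet {ξ | segment ℝ ξ (ξ + (c * phi Ω e ξ) • e) ⊆ Ω} := by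
  have hm : Measurable fun ξ : Euc n => (ξ, ξ + (c * phi Ω e ξ) • e) := by
    have := measurable_phi hΩ he
    fun_prop
  exact hm (isClosed_segment_subset hΩ.isClosed).measurableSet

end Phi

section Fubini

variable {d : ℕ}

lemma lintegral_euc_eq_lines (j : Fin (d + 1)) {H : Euc (d + 1) → ℝ≥0∞} (hH : Measurable H) :
    ∫⁻ ξ, H ξ = ∫⁻ y : Fin d → ℝ, ∫⁻ s : ℝ,
      H (WithLp.toLp 2 (j.insertNth (0 : ℝ) y) + s • EuclideanSpace.single j 1) := by
  have h1 := (PiLp.volume_preserving_toLp (Fin (d + 1))).lintegral_comp hH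
  have h2 := (volume_preserving_piFinSuccAbove (fun _ : Fin (d + 1) => ℝ) j).symm.lintegral_comp
    (f := fun a => H (WithLp.toLp 2 a)) (hH.comp (by fun_prop))
  rw [← h1, ← h2, Measure.volume_eq_prod]
  rw [lintegral_prod_symm']
  · refine lintegral_congr fun y => lintegral_congr fun s => ?_
    congr 1
    ext i
    refine Fin.succAboveCases j ?_ (fun k => ?_) i
    · simp
    · simp
  · exact (hH.comp (by fun_prop)).comp (MeasurableEquiv.measurable _)

/-- Fubini reduces this to lines parallel to the j-th axis, on each of which φ_Ω is a Chebyshev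
weight. -/
lemma lintegral_comp_phi_le {Ω : Set (Euc (d + 1))} (hΩ : IsCompact Ω) (j : Fin (d + 1))
    {r h τ : ℝ} (hτ : 0 ≤ τ) (hτr : τ ≤ r) {F : Euc (d + 1) → ℝ≥0∞} (hF : Measurable F) :
    ∫⁻ ξ in {ξ | segment ℝ ξ (ξ + (r * h * phi Ω (EuclideanSpace.single j 1) ξ) •
        EuclideanSpace.single j 1) ⊆ Ω},
      F (ξ + (τ * h * phi Ω (EuclideanSpace.single j 1) ξ) • EuclideanSpace.single j 1) ≤
      3 * ∫⁻ ξ in Ω, F ξ := by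
  set e : Euc (d + 1) := EuclideanSpace.single j 1 with he'
  have he : ‖e‖ = 1 := by simp [he']
  have hφ := measurable_phi hΩ he
  have hG := measurableSet_phi_segment hΩ he (r * h)
  rw [← lintegral_indicator hG, ← lintegral_indicator hΩ.measurableSet,
    lintegral_euc_eq_lines j, lintegral_euc_eq_lines j (hF.indicator hΩ.measurableSet),
    ← lintegral_const_mul' _ _ (by simp)]
  swap
  · exact (hF.comp (by fun_prop)).indicator hG
  refine lintegral_mono fun y => ?_
  set η : Euc (d + 1) := WithLp.toLp 2 (j.insertNth (0 : ℝ) y)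
  have hset : {s : ℝ | uIcc s (s + r * h * phi Ω e (η + s • e)) ⊆ {s | η + s • e ∈ Ω}} =
      {s | η + s • e ∈ {ξ | segment ℝ ξ (ξ + (r * h * phi Ω e ξ) • e) ⊆ Ω}} := by
    ext s
    rw [mem_ofPred_eq, ← segment_line_subset_iff, add_smul, ← add_assoc]
    rfl
  have hc : Measurable fun s : ℝ => η + s • e := by fun_prop
  have hGm : MeasurableSet {s | η + s • e ∈ {ξ | segment ℝ ξ (ξ + (r * h * phi Ω e ξ) • e) ⊆ Ω}} :=
    hc hG
  have key := lintegral_comp_chebyshev_le (isChebyshevWeight_phi hΩ he η)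
    (hφ.comp hc) (h := h) hτ hτr (by rw [hset]; exact hGm) (fun s => F (η + s • e))
  rw [hset, ← lintegral_indicator hGm, ← lintegral_indicator
    (isCompact_line_preimage hΩ he η).measurableSet] at key
  refine le_trans (le_of_eq ?_) (key.trans (le_of_eq ?_))
  · refine lintegral_congr fun s => ?_
    simp only [indicator, mem_ofPred_eq]
    have : η + s • e + (τ * h * phi Ω e (η + s • e)) • e =
      η + (s + τ * h * phi Ω e (η + s • e)) • e := by module
    rw [this]
  · congr 1

end Fubini

end IvanovModuli

/-! ### Graph charts and the distance to the frontier -/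

namespace IvanovModuli

/-- In the ball of radius `ε` about `ξ` the set `Ω` is `{0 ≤ ψ}` and its frontier is `{ψ = 0}`,
where `ψ` is `C^{1,1}` and decreases with unit speed in the direction of the unit vector `e`. -/
structure IsGraphChartAt {n : ℕ} (Ω : Set (Euc n)) (ψ : Euc n → ℝ) (e : Euc n) (ε M Λ : ℝ)
    (ξ : Euc n) : Prop where
  norm_dir : ‖e‖ = 1
  diff : Differentiable ℝ ψ
  shift : ∀ z (s : ℝ), ψ (z + s • e) = ψ z - s
  mem_iff : ∀ z ∈ Metric.ball ξ ε, (z ∈ Ω ↔ 0 ≤ ψ z)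
  frontier_iff : ∀ z ∈ Metric.ball ξ ε, (z ∈ frontier Ω ↔ ψ z = 0)
  lip : ∀ z ∈ Metric.ball ξ ε, ∀ z' ∈ Metric.ball ξ ε,
    ‖fderiv ℝ ψ z - fderiv ℝ ψ z'‖ ≤ M * ‖z - z'‖
  bound : ∀ z ∈ Metric.ball ξ ε, ‖fderiv ℝ ψ z‖ ≤ Λ

/-- Compatibility of the radius `κ` with the constants of a chart. -/
structure IsSmallScale (ε M Λ κ : ℝ) : Prop where
  one_le_M : 1 ≤ M
  one_le_Λ : 1 ≤ Λ
  pos : 0 < κ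
  le_one : κ ≤ 1
  radius : 100 * Λ * κ ≤ ε
  curvature : 100 * M * Λ ^ 2 * κ ≤ 1

namespace IsGraphChartAt

variable {n : ℕ} {Ω : Set (Euc n)} {ψ : Euc n → ℝ} {e : Euc n} {ε M Λ κ : ℝ} {ξ : Euc n}

/-- The linearisation is taken at a third point z₀, so that increments at different places can be
compared through one and the same linear form. -/
lemma taylor (H : IsGraphChartAt Ω ψ e ε M Λ ξ) (hM : 0 ≤ M) {z₀ z z' : Euc n} {τ : ℝ}
    (h0 : z₀ ∈ Metric.ball ξ ε)
    (hz : z ∈ Metric.ball ξ ε) (hz' : z' ∈ Metric.ball ξ ε) (h1 : ‖z - z₀‖ ≤ τ)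
    (h2 : ‖z' - z₀‖ ≤ τ) :
    |ψ z' - ψ z - fderiv ℝ ψ z₀ (z' - z)| ≤ M * τ * ‖z' - z‖ := by
  have hc : Convex ℝ (Metric.ball ξ ε ∩ Metric.closedBall z₀ τ) :=
    (convex_ball _ _).inter (convex_closedBall _ _)
  have := hc.norm_image_sub_le_of_norm_fderiv_le' (𝕜 := ℝ) (f := ψ) (φ := fderiv ℝ ψ z₀)
    (C := M * τ) (fun x _ => H.diff x) (fun x hx => ?_)
    (x := z) (y := z') ⟨hz, by rwa [mem_closedBall_iff_norm]⟩ ⟨hz', by rwa [mem_closedBall_iff_norm]⟩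
  · simpa using this
  · refine (H.lip x hx.1 z₀ h0).trans ?_
    have := mem_closedBall_iff_norm.mp hx.2
    gcongr

lemma lipschitz (H : IsGraphChartAt Ω ψ e ε M Λ ξ) {z z' : Euc n}
    (hz : z ∈ Metric.ball ξ ε) (hz' : z' ∈ Metric.ball ξ ε) :
    |ψ z' - ψ z| ≤ Λ * ‖z' - z‖ :=
  (convex_ball ξ ε).norm_image_sub_le_of_norm_fderiv_le (𝕜 := ℝ) (fun x _ => H.diff x)
    (fun x hx => H.bound x hx) hz hz'

lemma fderiv_dir (H : IsGraphChartAt Ω ψ e ε M Λ ξ) (z : Euc n) : fderiv ℝ ψ z e = -1 := by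
  have h1 : HasDerivAt (fun s : ℝ => ψ (z + s • e)) (fderiv ℝ ψ z e) 0 := by
    have h2 : HasDerivAt (fun s : ℝ => z + s • e) e 0 := by
      simpa using ((hasDerivAt_id (0 : ℝ)).smul_const e).const_add z
    have h3 := (H.diff (z + (0 : ℝ) • e)).hasFDerivAt.comp_hasDerivAt (0 : ℝ) h2
    simpa [Function.comp_def] using h3
  have h4 : HasDerivAt (fun s : ℝ => ψ (z + s • e)) (-1) 0 := by
    simp only [H.shift]
    simpa using (hasDerivAt_id (0 : ℝ)).const_sub (ψ z)
  exact h1.unique h4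

end IsGraphChartAt

section Distance

variable {n : ℕ} {Ω : Set (Euc n)}

lemma exists_nearest_frontier (hΓ : (frontier Ω).Nonempty) (x : Euc n) :
    ∃ p ∈ frontier Ω, Metric.infDist x (frontier Ω) = ‖x - p‖ := by
  obtain ⟨p, hp, h⟩ := isClosed_frontier.exists_infDist_eq_dist hΓ x
  exact ⟨p, hp, by rw [h, dist_eq_norm]⟩

lemma infDist_frontier_le {p : Euc n} (hp : p ∈ frontier Ω) (x : Euc n) :
    Metric.infDist x (frontier Ω) ≤ ‖x - p‖ := by
  rw [← dist_eq_norm]; exact Metric.infDist_le_dist_of_mem hp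

lemma infDist_frontier_le_add (Ω : Set (Euc n)) (x y : Euc n) :
    Metric.infDist x (frontier Ω) ≤ Metric.infDist y (frontier Ω) + ‖x - y‖ := by
  rw [← dist_eq_norm]; exact Metric.infDist_le_infDist_add_dist

lemma infDist_frontier_nonneg (Ω : Set (Euc n)) (x : Euc n) :
    0 ≤ Metric.infDist x (frontier Ω) := Metric.infDist_nonneg

/-- A segment that leaves Ω meets the frontier, by connectedness. -/
lemma mem_of_norm_lt_infDist_frontier {x y : Euc n} (hx : x ∈ Ω)
    (hxy : ‖y - x‖ < Metric.infDist x (frontier Ω)) : y ∈ Ω := by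
  by_contra hy
  have hseg : IsPreconnected (segment ℝ x y) := (convex_segment x y).isPreconnected
  obtain ⟨z, hz, hzΓ⟩ : ∃ z ∈ segment ℝ x y, z ∈ frontier Ω := by
    by_contra! hno
    have hint : ∀ z ∈ segment ℝ x y, z ∈ closure Ω → z ∈ interior Ω := fun z hz hc => by
      by_contra hi
      exact hno z hz ⟨hc, hi⟩
    obtain ⟨z, -, hz1, hz2⟩ := hseg (interior Ω) (closure Ω)ᶜ isOpen_interior
      isClosed_closure.isOpen_compl
      (fun z hz => (em (z ∈ closure Ω)).elim (fun h => Or.inl (hint z hz h)) Or.inr)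
      ⟨x, left_mem_segment ℝ x y, hint x (left_mem_segment ℝ x y) (subset_closure hx)⟩
      ⟨y, right_mem_segment ℝ x y, fun h =>
        hy (interior_subset (hint y (right_mem_segment ℝ x y) h))⟩
    exact hz2 (interior_subset_closure hz1)
  have h1 := infDist_frontier_le hzΓ x
  have h2 : ‖x - z‖ ≤ ‖y - x‖ := by
    rw [segment_eq_image'] at hz
    obtain ⟨θ, hθ, rfl⟩ := hz
    simp only [sub_add_cancel_left, norm_neg, norm_smul, Real.norm_eq_abs, abs_of_nonneg hθ.1]
    exact mul_le_of_le_one_left (norm_nonneg _) hθ.2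
  linarith

namespace IsGraphChartAt

variable {ψ : Euc n → ℝ} {e : Euc n} {ε M Λ κ : ℝ} {ξ : Euc n}

lemma mem_ball_of_le (hs : IsSmallScale ε M Λ κ) {z : Euc n} (h : ‖z - ξ‖ ≤ 20 * Λ * κ) :
    z ∈ Metric.ball ξ ε := by
  rw [mem_ball_iff_norm]
  have := hs.radius
  have : 0 < Λ * κ := mul_pos (by linarith [hs.one_le_Λ]) hs.pos
  linarith

lemma mem_ball_of_le' (hs : IsSmallScale ε M Λ κ) {z : Euc n} (h : ‖z - ξ‖ ≤ 20 * κ) :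
    z ∈ Metric.ball ξ ε := by
  refine mem_ball_of_le hs (h.trans ?_)
  have : κ * 1 ≤ κ * Λ := mul_le_mul_of_nonneg_left hs.one_le_Λ hs.pos.le
  linarith

/-- The distance to the frontier changes under a displacement by at most the change of `ψ`, up to
a quadratic error. -/
lemma infDist_le_add (H : IsGraphChartAt Ω ψ e ε M Λ ξ) (hs : IsSmallScale ε M Λ κ)
    (hΓ : (frontier Ω).Nonempty) (hξ : Metric.infDist ξ (frontier Ω) ≤ κ) {z z' : Euc n}
    (hz : ‖z - ξ‖ ≤ κ) (hz' : ‖z' - ξ‖ ≤ κ) :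
    Metric.infDist z' (frontier Ω) ≤ Metric.infDist z (frontier Ω) + |ψ z' - ψ z| +
      2 * M * (Metric.infDist z (frontier Ω) + ‖z' - z‖) * ‖z' - z‖ := by
  obtain ⟨p, hp, hzp⟩ := exists_nearest_frontier hΓ z
  have hΛκ : κ ≤ Λ * κ := le_mul_of_one_le_left hs.pos.le hs.one_le_Λ
  have hρ := infDist_frontier_le_add Ω z ξ
  have hpξ : ‖p - ξ‖ ≤ 3 * κ := by
    have : ‖p - ξ‖ ≤ ‖p - z‖ + ‖z - ξ‖ := norm_sub_le_norm_sub_add_norm_sub _ _ _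
    rw [norm_sub_rev p z] at this
    linarith
  set v := z' - z with hv
  have hvn : ‖v‖ ≤ 2 * κ := by
    have : ‖z' - z‖ ≤ ‖z' - ξ‖ + ‖ξ - z‖ := norm_sub_le_norm_sub_add_norm_sub _ _ _
    rw [norm_sub_rev ξ z] at this
    linarith
  have hpv : ‖p + v - ξ‖ ≤ 5 * κ := by
    have : ‖p + v - ξ‖ ≤ ‖p - ξ‖ + ‖v‖ := by
      rw [show p + v - ξ = (p - ξ) + v by abel]; exact norm_add_le _ _
    linarith
  have bz := mem_ball_of_le' hs (hz.trans (by linarith [hs.pos]) : ‖z - ξ‖ ≤ 20 * κ)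
  have bz' := mem_ball_of_le' hs (hz'.trans (by linarith [hs.pos]) : ‖z' - ξ‖ ≤ 20 * κ)
  have bp := mem_ball_of_le' hs (hpξ.trans (by linarith [hs.pos]) : ‖p - ξ‖ ≤ 20 * κ)
  have bpv := mem_ball_of_le' hs (hpv.trans (by linarith [hs.pos]) : ‖p + v - ξ‖ ≤ 20 * κ)
  have hψp : ψ p = 0 := (H.frontier_iff p bp).mp hp
  -- The nearest frontier point p of z is moved along with z; c is the correction along e that
  -- brings p + v back to the frontier, so the distance of z' is at most ‖z - p‖ + |c|.
  set c := ψ (p + v) with hc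
  have hcb : |c| ≤ Λ * (2 * κ) := by
    have := H.lipschitz bp bpv
    rw [hψp, sub_zero, add_sub_cancel_left] at this
    exact this.trans (mul_le_mul_of_nonneg_left hvn (by linarith [hs.one_le_Λ]))
  have hq : p + v + c • e ∈ frontier Ω := by
    refine (H.frontier_iff _ (mem_ball_of_le hs ?_)).mpr (by rw [H.shift]; ring)
    have : ‖p + v + c • e - ξ‖ ≤ ‖p + v - ξ‖ + ‖c • e‖ := by
      rw [show p + v + c • e - ξ = (p + v - ξ) + c • e by abel]; exact norm_add_le _ _
    rw [norm_smul, H.norm_dir, mul_one, Real.norm_eq_abs] at this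
    linarith [hs.pos]
  have hM : 0 ≤ M := by linarith [hs.one_le_M]
  have hτ0 : (0 : ℝ) ≤ Metric.infDist z (frontier Ω) := infDist_frontier_nonneg _ _
  have t1 := H.taylor hM (z₀ := z) (z := p) (z' := p + v)
    (τ := Metric.infDist z (frontier Ω) + ‖v‖) bz bp bpv
    (by rw [norm_sub_rev, ← hzp]; linarith [norm_nonneg v])
    (by
      rw [show p + v - z = (p - z) + v by abel]
      refine (norm_add_le _ _).trans ?_
      rw [norm_sub_rev, ← hzp])
  have t2 := H.taylor hM (z₀ := z) (z := z) (z' := z')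
    (τ := Metric.infDist z (frontier Ω) + ‖v‖) bz bz bz'
    (by simp; positivity) (by linarith)
  rw [add_sub_cancel_left, hψp, sub_zero] at t1
  rw [← hv] at t2
  have t3 : |c| ≤ |ψ z' - ψ z| +
      2 * M * (Metric.infDist z (frontier Ω) + ‖v‖) * ‖v‖ := by
    have e1 : c = (ψ z' - ψ z) + (c - fderiv ℝ ψ z v) - (ψ z' - ψ z - fderiv ℝ ψ z v) := by ring
    have e2 := abs_sub ((ψ z' - ψ z) + (c - fderiv ℝ ψ z v)) (ψ z' - ψ z - fderiv ℝ ψ z v)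
    have e3 := abs_add_le (ψ z' - ψ z) (c - fderiv ℝ ψ z v)
    rw [← e1] at e2
    linarith
  have hfin := infDist_frontier_le hq z'
  have : ‖z' - (p + v + c • e)‖ ≤ ‖z - p‖ + |c| := by
    rw [show z' - (p + v + c • e) = (z - p) - c • e by rw [hv]; abel]
    refine (norm_sub_le _ _).trans ?_
    rw [norm_smul, H.norm_dir, mul_one, Real.norm_eq_abs]
  rw [← hzp] at this
  linarith

/-- The distance to the frontier is strictly monotone along the direction of the chart. -/
lemma infDist_add_le (H : IsGraphChartAt Ω ψ e ε M Λ ξ) (hs : IsSmallScale ε M Λ κ)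
    (hΓ : (frontier Ω).Nonempty) (hξ : Metric.infDist ξ (frontier Ω) ≤ κ) {z : Euc n} {s : ℝ}
    (hz : ‖z - ξ‖ ≤ κ) (h0 : 0 ≤ s) (hsz : s ≤ ψ z) :
    Metric.infDist (z + s • e) (frontier Ω) + s / (2 * Λ) ≤ Metric.infDist z (frontier Ω) := by
  rcases h0.eq_or_lt with rfl | hs0
  · simp
  have hΛ0 : 0 < Λ := by linarith [hs.one_le_Λ]
  have hM : 0 ≤ M := by linarith [hs.one_le_M]
  have hΛκ : κ ≤ Λ * κ := le_mul_of_one_le_left hs.pos.le hs.one_le_Λ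
  obtain ⟨p, hp, hzp⟩ := exists_nearest_frontier hΓ z
  set ρ := Metric.infDist z (frontier Ω) with hρ
  have hρ2 : ρ ≤ 2 * κ := by linarith [infDist_frontier_le_add Ω z ξ]
  have hρ0 : 0 ≤ ρ := infDist_frontier_nonneg _ _
  have hpξ : ‖p - ξ‖ ≤ 3 * κ := by
    have : ‖p - ξ‖ ≤ ‖p - z‖ + ‖z - ξ‖ := norm_sub_le_norm_sub_add_norm_sub _ _ _
    rw [norm_sub_rev p z, ← hzp] at this
    linarith
  have bz := mem_ball_of_le' hs (hz.trans (by linarith [hs.pos]) : ‖z - ξ‖ ≤ 20 * κ)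
  have bp := mem_ball_of_le' hs (hpξ.trans (by linarith [hs.pos]) : ‖p - ξ‖ ≤ 20 * κ)
  have hψp : ψ p = 0 := (H.frontier_iff p bp).mp hp
  set P := ψ z with hP
  have hP0 : 0 < P := hs0.trans_le hsz
  have hPρ : P ≤ Λ * ρ := by
    have := H.lipschitz bp bz
    rw [hψp, sub_zero, ← hP, ← hzp] at this
    exact (le_abs_self P).trans this
  have hΛρ : Λ * ρ ≤ Λ * (2 * κ) := by gcongr
  -- The frontier point met from z in direction e. The homothety taking z to the fraction μ of the
  -- way to b takes p to the chord point q, and z + se - q = (1 - μ)(z - p).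
  set b := z + P • e with hb
  have hbξ : ‖b - ξ‖ ≤ 3 * Λ * κ := by
    have : ‖b - ξ‖ ≤ ‖z - ξ‖ + ‖P • e‖ := by
      rw [hb, show z + P • e - ξ = (z - ξ) + P • e by abel]; exact norm_add_le _ _
    rw [norm_smul, H.norm_dir, mul_one, Real.norm_eq_abs, abs_of_pos hP0] at this
    linarith
  have bb := mem_ball_of_le hs (hbξ.trans (by nlinarith [hs.pos]) : ‖b - ξ‖ ≤ 20 * Λ * κ)
  have hψb : ψ b = 0 := by rw [hb, H.shift]; simp [hP]
  have hD : ‖b - p‖ ≤ 2 * Λ * ρ := by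
    have : ‖b - p‖ ≤ ‖z - p‖ + ‖P • e‖ := by
      rw [hb, show z + P • e - p = (z - p) + P • e by abel]; exact norm_add_le _ _
    rw [norm_smul, H.norm_dir, mul_one, Real.norm_eq_abs, abs_of_pos hP0, ← hzp] at this
    have : ρ ≤ Λ * ρ := le_mul_of_one_le_left hρ0 hs.one_le_Λ
    linarith
  set μ := s / P with hμ
  have hμ0 : 0 < μ := div_pos hs0 hP0
  have hμ1 : μ ≤ 1 := (div_le_one hP0).mpr hsz
  set q := p + μ • (b - p) with hq
  have hqp : ‖q - p‖ = μ * ‖b - p‖ := by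
    rw [hq, add_sub_cancel_left, norm_smul, Real.norm_eq_abs, abs_of_pos hμ0]
  have bq : q ∈ Metric.ball ξ ε := (convex_ball ξ ε).add_smul_sub_mem bp bb ⟨hμ0.le, hμ1⟩
  -- Since ψ vanishes at both ends p and b of the chord, its linear part along the chord is itself
  -- of second order.
  have hψq : |ψ q| ≤ 2 * M * μ * ‖b - p‖ ^ 2 := by
    have t1 := H.taylor hM (z₀ := p) (z := p) (z' := q) (τ := ‖b - p‖) bp bp bq (by simp)
      (by rw [hqp]; exact mul_le_of_le_one_left (norm_nonneg _) hμ1)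
    have t2 := H.taylor hM (z₀ := p) (z := p) (z' := b) (τ := ‖b - p‖) bp bp bb (by simp) le_rfl
    rw [hψp, sub_zero, hqp] at t1
    rw [hψp, hψb, sub_zero, zero_sub, abs_neg] at t2
    have e1 : fderiv ℝ ψ p (q - p) = μ * fderiv ℝ ψ p (b - p) := by
      rw [hq, add_sub_cancel_left, map_smul, smul_eq_mul]
    rw [e1] at t1
    have e2 : |ψ q| ≤ |ψ q - μ * fderiv ℝ ψ p (b - p)| + |μ * fderiv ℝ ψ p (b - p)| := by
      have := abs_add_le (ψ q - μ * fderiv ℝ ψ p (b - p)) (μ * fderiv ℝ ψ p (b - p))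
      simpa using this
    rw [abs_mul μ, abs_of_pos hμ0] at e2
    have e3 := mul_le_mul_of_nonneg_left t2 hμ0.le
    nlinarith
  have hκ0 := hs.pos
  have hcurv := hs.curvature
  have hDsq : ‖b - p‖ ^ 2 ≤ (2 * Λ * ρ) ^ 2 := by gcongr
  have hψq2 : |ψ q| ≤ μ * ρ / 2 := by
    have h1 : 2 * M * μ * ‖b - p‖ ^ 2 ≤ 2 * M * μ * (2 * Λ * ρ) ^ 2 := by gcongr
    have h2 : 100 * M * Λ ^ 2 * ρ ≤ 2 := by
      have : 100 * M * Λ ^ 2 * ρ ≤ 100 * M * Λ ^ 2 * (2 * κ) := by gcongr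
      linarith
    have h3 : 2 * M * μ * (2 * Λ * ρ) ^ 2 = (8 * M * Λ ^ 2 * ρ) * (μ * ρ) := by ring
    have h4 : (8 * M * Λ ^ 2 * ρ) * (μ * ρ) ≤ (1 / 2) * (μ * ρ) := by
      have : 0 ≤ μ * ρ := by positivity
      have h5 : 8 * M * Λ ^ 2 * ρ ≤ 1 / 2 := by linarith
      gcongr
    linarith
  have hμρ : μ * ρ ≤ 2 * κ := (mul_le_of_le_one_left hρ0 hμ1).trans hρ2
  have hqξ : ‖q - ξ‖ ≤ 7 * Λ * κ := by
    have h1 : ‖q - ξ‖ ≤ ‖q - p‖ + ‖p - ξ‖ := norm_sub_le_norm_sub_add_norm_sub _ _ _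
    have h2 : μ * ‖b - p‖ ≤ ‖b - p‖ := mul_le_of_le_one_left (norm_nonneg _) hμ1
    linarith
  have hw : q + ψ q • e ∈ frontier Ω := by
    refine (H.frontier_iff _ (mem_ball_of_le hs ?_)).mpr (by rw [H.shift]; ring)
    have : ‖q + ψ q • e - ξ‖ ≤ ‖q - ξ‖ + ‖ψ q • e‖ := by
      rw [show q + ψ q • e - ξ = (q - ξ) + ψ q • e by abel]; exact norm_add_le _ _
    rw [norm_smul, H.norm_dir, mul_one, Real.norm_eq_abs] at this
    linarith
  have hfin := infDist_frontier_le hw (z + s • e)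
  have e1 : z + s • e - (q + ψ q • e) = (1 - μ) • (z - p) - ψ q • e := by
    have : s = μ * P := by rw [hμ]; field_simp
    rw [hq, hb, this]; module
  have e2 : ‖z + s • e - (q + ψ q • e)‖ ≤ (1 - μ) * ρ + |ψ q| := by
    rw [e1]
    refine (norm_sub_le _ _).trans ?_
    rw [norm_smul, norm_smul, H.norm_dir, mul_one, Real.norm_eq_abs, Real.norm_eq_abs, ← hzp,
      abs_of_nonneg (by linarith : 0 ≤ 1 - μ)]
  -- The distance drops by at least μρ - |ψ q| ≥ μρ/2, and μρ = sρ/P ≥ s/Λ since P ≤ Λρ.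
  have e3 : s / (2 * Λ) ≤ μ * ρ / 2 := by
    rw [hμ, div_mul_eq_mul_div, div_div, div_le_div_iff₀ (by positivity) (by positivity)]
    nlinarith
  linarith

lemma psi_nonneg (H : IsGraphChartAt Ω ψ e ε M Λ ξ) (hs : IsSmallScale ε M Λ κ) {z : Euc n}
    (hz : ‖z - ξ‖ ≤ κ) (hzΩ : z ∈ Ω) : 0 ≤ ψ z :=
  (H.mem_iff z (mem_ball_of_le' hs (hz.trans (by linarith [hs.pos])))).mp hzΩ

lemma psi_le_mul_infDist (H : IsGraphChartAt Ω ψ e ε M Λ ξ) (hs : IsSmallScale ε M Λ κ)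
    (hΓ : (frontier Ω).Nonempty) (hξ : Metric.infDist ξ (frontier Ω) ≤ κ) :
    ψ ξ ≤ Λ * Metric.infDist ξ (frontier Ω) := by
  obtain ⟨p, hp, hzp⟩ := exists_nearest_frontier hΓ ξ
  have bp : p ∈ Metric.ball ξ ε :=
    mem_ball_of_le' hs (by rw [norm_sub_rev, ← hzp]; linarith [hs.pos])
  have bz : ξ ∈ Metric.ball ξ ε := mem_ball_of_le' hs (by simpa using hs.pos.le)
  have := H.lipschitz bp bz
  rw [(H.frontier_iff p bp).mp hp, sub_zero, ← hzp] at this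
  exact (le_abs_self _).trans this

/-- The variation of `ψ` is controlled by that of the distance to the frontier. -/
lemma abs_psi_sub_le (H : IsGraphChartAt Ω ψ e ε M Λ ξ) (hs : IsSmallScale ε M Λ κ)
    (hΓ : (frontier Ω).Nonempty) (hξ : Metric.infDist ξ (frontier Ω) ≤ κ) (hξΩ : ξ ∈ Ω)
    {η : Euc n} {δ : ℝ} (hη : η ∈ Ω) (hδ : ‖η - ξ‖ ≤ δ) (hδκ : 2 * Λ * δ ≤ κ) :
    |ψ η - ψ ξ| ≤ 2 * Λ * (|Metric.infDist η (frontier Ω) - Metric.infDist ξ (frontier Ω)| +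
      4 * M * Λ * δ * (Metric.infDist ξ (frontier Ω) + 4 * Λ * δ)) := by
  have hΛ := hs.one_le_Λ
  have hM := hs.one_le_M
  have hδ0 : 0 ≤ δ := (norm_nonneg _).trans hδ
  have hδΛ : δ ≤ Λ * δ := le_mul_of_one_le_left hδ0 hΛ
  have hηκ : ‖η - ξ‖ ≤ κ := by linarith
  have hξκ : ‖ξ - ξ‖ ≤ κ := by simpa using hs.pos.le
  set ρ := Metric.infDist ξ (frontier Ω) with hρ
  have hρ0 : 0 ≤ ρ := infDist_frontier_nonneg _ _
  have bη := mem_ball_of_le' hs (hηκ.trans (by linarith [hs.pos]) : ‖η - ξ‖ ≤ 20 * κ)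
  have bξ := mem_ball_of_le' hs (hξκ.trans (by linarith [hs.pos]) : ‖ξ - ξ‖ ≤ 20 * κ)
  have hL : |ψ η - ψ ξ| ≤ Λ * δ :=
    (H.lipschitz bξ bη).trans (by gcongr)
  set c := ψ η - ψ ξ with hc
  -- The point over η on the level of ψ through ξ. Its distance to the frontier agrees with that of
  -- ξ up to a quadratic error, while between η and ζ the distance changes by at least |c|/(2Λ).
  set ζ := η + c • e with hζ
  have hψζ : ψ ζ = ψ ξ := by rw [hζ, H.shift, hc]; ring
  have hζξ : ‖ζ - ξ‖ ≤ 2 * Λ * δ := by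
    have : ‖ζ - ξ‖ ≤ ‖η - ξ‖ + ‖c • e‖ := by
      rw [hζ, show η + c • e - ξ = (η - ξ) + c • e by abel]; exact norm_add_le _ _
    rw [norm_smul, H.norm_dir, mul_one, Real.norm_eq_abs] at this
    linarith
  have hζκ : ‖ζ - ξ‖ ≤ κ := hζξ.trans hδκ
  have a1 := H.infDist_le_add hs hΓ hξ hξκ hζκ
  have a2 := H.infDist_le_add hs hΓ hξ hζκ hξκ
  rw [hψζ, sub_self, abs_zero, add_zero, ← hρ] at a1
  rw [hψζ, sub_self, abs_zero, add_zero, ← hρ, norm_sub_rev] at a2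
  have a3 := infDist_frontier_le_add Ω ζ ξ
  rw [← hρ] at a3
  have b1 : 2 * M * (ρ + ‖ζ - ξ‖) * ‖ζ - ξ‖ ≤ 4 * M * Λ * δ * (ρ + 4 * Λ * δ) := by
    have : 2 * M * (ρ + ‖ζ - ξ‖) * ‖ζ - ξ‖ ≤ 2 * M * (ρ + 4 * Λ * δ) * (2 * Λ * δ) := by
      gcongr
      nlinarith
    linarith
  have b2 : 2 * M * (Metric.infDist ζ (frontier Ω) + ‖ζ - ξ‖) * ‖ζ - ξ‖ ≤
      4 * M * Λ * δ * (ρ + 4 * Λ * δ) := by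
    have : 2 * M * (Metric.infDist ζ (frontier Ω) + ‖ζ - ξ‖) * ‖ζ - ξ‖ ≤
        2 * M * (ρ + 4 * Λ * δ) * (2 * Λ * δ) := by
      have : Metric.infDist ζ (frontier Ω) + ‖ζ - ξ‖ ≤ ρ + 4 * Λ * δ := by linarith
      gcongr
    linarith
  have hψη : 0 ≤ ψ η := H.psi_nonneg hs hηκ hη
  have hψξ : 0 ≤ ψ ξ := H.psi_nonneg hs hξκ hξΩ
  have hΛ0 : 0 < 2 * Λ := by linarith
  have habs := abs_le.mp (le_refl |Metric.infDist η (frontier Ω) - ρ|)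
  have key : |c| / (2 * Λ) ≤ |Metric.infDist η (frontier Ω) - ρ| +
      4 * M * Λ * δ * (ρ + 4 * Λ * δ) := by
    rcases le_total 0 c with h0 | h0
    · have := H.infDist_add_le hs hΓ hξ hηκ h0 (by linarith)
      rw [abs_of_nonneg h0]
      linarith
    · have := H.infDist_add_le hs hΓ hξ hζκ (s := -c) (by linarith) (by linarith)
      rw [hζ, add_assoc, ← add_smul, add_neg_cancel, zero_smul, add_zero] at this
      rw [abs_of_nonpos h0]
      linarith
  rwa [div_le_iff₀' hΛ0] at key

end IsGraphChartAt

end Distance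

end IvanovModuli

namespace IvanovModuli

/-! ### Volume of a sheared box -/

section Slab

variable {d : ℕ}

/-- The parallelepiped `|uᵢ| ≤ R` for `i ≠ k` and `a ≤ β u ≤ b`. -/
def slab (β : Euc (d + 1) →L[ℝ] ℝ) (k : Fin (d + 1)) (R a b : ℝ) : Set (Euc (d + 1)) :=
  {u | (∀ i, i ≠ k → |u i| ≤ R) ∧ β u ∈ Icc a b}

lemma isClosed_slab (β : Euc (d + 1) →L[ℝ] ℝ) (k : Fin (d + 1)) (R a b : ℝ) :
    IsClosed (slab β k R a b) := by
  have : slab β k R a b = (⋂ i, ⋂ (_ : i ≠ k), {u | |u i| ≤ R}) ∩ β ⁻¹' Icc a b := by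
    ext u; simp [slab]
  rw [this]
  refine IsClosed.inter (isClosed_iInter fun i => isClosed_iInter fun _ => ?_)
    (isClosed_Icc.preimage β.continuous)
  exact isClosed_le (by fun_prop) continuous_const

/-- Along the k-th axis β has slope ±1, so every line over the cube of side 2R meets the slab in an
interval of length b - a. -/
lemma volume_slab {β : Euc (d + 1) →L[ℝ] ℝ} {k : Fin (d + 1)}
    (hβ : |β (EuclideanSpace.single k 1)| = 1) {R : ℝ} (hR : 0 ≤ R) (a b : ℝ) :
    volume (slab β k R a b) = ENNReal.ofReal ((2 * R) ^ d) * ENNReal.ofReal (b - a) := by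
  have hm := (isClosed_slab β k R a b).measurableSet
  rw [← lintegral_indicator_one hm, lintegral_euc_eq_lines k (measurable_one.indicator hm)]
  have hin : ∀ y : Fin d → ℝ, ∫⁻ s : ℝ, (slab β k R a b).indicator 1
      (WithLp.toLp 2 (k.insertNth (0 : ℝ) y) + s • EuclideanSpace.single k 1) =
      (Icc (fun _ => -R) (fun _ => R) : Set (Fin d → ℝ)).indicator
        (fun _ => ENNReal.ofReal (b - a)) y := by
    intro y
    set η : Euc (d + 1) := WithLp.toLp 2 (k.insertNth (0 : ℝ) y)
    have hco : ∀ (s : ℝ) (i : Fin d), (η + s • EuclideanSpace.single k 1 : Euc (d + 1)) (k.succAbove i) = y i := by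
      intro s i; simp [η]
    have hiff : ∀ s : ℝ, η + s • EuclideanSpace.single k 1 ∈ slab β k R a b ↔
        y ∈ (Icc (fun _ => -R) (fun _ => R) : Set (Fin d → ℝ)) ∧
          β η + s * β (EuclideanSpace.single k 1) ∈ Icc a b := by
      intro s
      simp only [slab, mem_ofPred_eq, map_add, map_smul, smul_eq_mul]
      refine and_congr_left fun _ => ?_
      rw [mem_Icc, Pi.le_def, Pi.le_def, ← forall_and]
      constructor
      · intro h i
        have := h (k.succAbove i) (k.succAbove_ne i)
        rw [hco] at this
        exact abs_le.mp this
      · intro h i hi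
        obtain ⟨i, rfl⟩ := Fin.exists_succAbove_eq hi
        rw [hco]
        exact abs_le.mpr (h i)
    by_cases hy : y ∈ (Icc (fun _ => -R) (fun _ => R) : Set (Fin d → ℝ))
    · rw [indicator_of_mem hy]
      have hset : (fun s : ℝ => (slab β k R a b).indicator (1 : Euc (d + 1) → ℝ≥0∞)
          (η + s • EuclideanSpace.single k 1)) =
          {s : ℝ | β η + s * β (EuclideanSpace.single k 1) ∈ Icc a b}.indicator 1 := by
        ext s
        simp only [indicator, hiff, hy, true_and, mem_ofPred_eq, Pi.one_apply]
      have hms : MeasurableSet {s : ℝ | β η + s * β (EuclideanSpace.single k 1) ∈ Icc a b} := by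
        have : Measurable fun s : ℝ => β η + s * β (EuclideanSpace.single k 1) := by fun_prop
        exact this measurableSet_Icc
      rw [hset, lintegral_indicator_one hms]
      rcases (abs_eq zero_le_one).mp hβ with h1 | h1
      · have : {s : ℝ | β η + s * β (EuclideanSpace.single k 1) ∈ Icc a b} =
            Icc (a - β η) (b - β η) := by
          ext s; simp only [h1, mem_ofPred_eq, mem_Icc]
          constructor <;> rintro ⟨h2, h3⟩ <;> constructor <;> linarith
        rw [this, Real.volume_Icc]; congr 1; ring
      · have : {s : ℝ | β η + s * β (EuclideanSpace.single k 1) ∈ Icc a b} =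
            Icc (β η - b) (β η - a) := by
          ext s; simp only [h1, mem_ofPred_eq, mem_Icc]
          constructor <;> rintro ⟨h2, h3⟩ <;> constructor <;> linarith
        rw [this, Real.volume_Icc]; congr 1; ring
    · rw [indicator_of_notMem hy]
      have hset : (fun s : ℝ => (slab β k R a b).indicator (1 : Euc (d + 1) → ℝ≥0∞)
          (η + s • EuclideanSpace.single k 1)) = fun _ => 0 := by
        ext s
        simp only [indicator, hiff, hy, false_and, if_false]
      rw [hset, lintegral_zero]
  simp_rw [hin]
  rw [lintegral_indicator_const measurableSet_Icc, Real.volume_Icc_pi, mul_comm, Finset.prod_const, Finset.card_univ,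
    Fintype.card_fin, ENNReal.ofReal_pow (by positivity), sub_neg_eq_add, two_mul]

end Slab

end IvanovModuli

/-! ### Shape and volume of Ivanov balls -/

namespace IvanovModuli

/-- Either the difference of roots is at most t, or t < √a + √b, so that √a + t ≤ 2(√a + √b) and
this sum can be cancelled from |b - a| = |√b - √a|(√a + √b). -/
lemma abs_sqrt_sub_sqrt_le {a b t D : ℝ} (ha : 0 ≤ a) (hb : 0 ≤ b) (ht : 0 ≤ t) (hD : 0 ≤ D)
    (h : |b - a| ≤ D * t * (Real.sqrt a + t)) :
    |Real.sqrt b - Real.sqrt a| ≤ (1 + 2 * D) * t := by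
  set x := Real.sqrt a
  set y := Real.sqrt b
  have hx : 0 ≤ x := Real.sqrt_nonneg a
  have hy : 0 ≤ y := Real.sqrt_nonneg b
  have e : |b - a| = |y - x| * (y + x) := by
    rw [← abs_of_nonneg (add_nonneg hy hx), ← abs_mul]
    congr 1
    rw [← Real.sq_sqrt ha, ← Real.sq_sqrt hb]; ring
  rw [e] at h
  rcases le_or_gt (|y - x|) t with h1 | h1
  · nlinarith
  · have h2 : |y - x| ≤ y + x := abs_le.mpr ⟨by linarith, by linarith⟩
    have h3 : 0 < y + x := by linarith
    have h4 : |y - x| * (y + x) ≤ 2 * D * t * (y + x) := by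
      refine h.trans ?_
      have : D * t * (x + t) ≤ D * t * (2 * (y + x)) := by
        gcongr; linarith
      linarith
    have := le_of_mul_le_mul_right h4 h3
    linarith

section Rho

variable {n : ℕ} {Ω : Set (Euc n)}

lemma rho_triangle (Ω : Set (Euc n)) (x y z : Euc n) : rho Ω x z ≤ rho Ω x y + rho Ω y z := by
  simp only [rho]
  have h1 : ‖x - z‖ ≤ ‖x - y‖ + ‖y - z‖ := norm_sub_le_norm_sub_add_norm_sub _ _ _
  have h2 := abs_sub_le (Real.sqrt (Metric.infDist x (frontier Ω)))
    (Real.sqrt (Metric.infDist y (frontier Ω))) (Real.sqrt (Metric.infDist z (frontier Ω)))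
  linarith

lemma rho_comm (Ω : Set (Euc n)) (x y : Euc n) : rho Ω x y = rho Ω y x := by
  rw [rho, rho, norm_sub_rev, abs_sub_comm]

/-- A family of graph charts around all points of `Ω` close to the frontier. -/
def HasGraphCharts {d : ℕ} (Ω : Set (Euc (d + 1))) (ε M Λ κ : ℝ) : Prop :=
  ∀ ξ ∈ Ω, Metric.infDist ξ (frontier Ω) ≤ κ → ∃ (ψ : Euc (d + 1) → ℝ) (k : Fin (d + 1)) (σ : ℝ),
    |σ| = 1 ∧ IsGraphChartAt Ω ψ (EuclideanSpace.single k σ) ε M Λ ξ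

lemma IsGraphChartAt.abs_fderiv_single {d : ℕ} {Ω : Set (Euc (d + 1))} {ψ : Euc (d + 1) → ℝ}
    {k : Fin (d + 1)} {σ ε M Λ : ℝ} {ξ : Euc (d + 1)} (hσ : |σ| = 1)
    (H : IsGraphChartAt Ω ψ (EuclideanSpace.single k σ) ε M Λ ξ) :
    |fderiv ℝ ψ ξ (EuclideanSpace.single k 1)| = 1 := by
  have h := H.fderiv_dir ξ
  have e : (EuclideanSpace.single k σ : Euc (d + 1)) = σ • EuclideanSpace.single k 1 := by
    ext i; by_cases hi : i = k <;> simp [hi]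
  rw [e, map_smul, smul_eq_mul] at h
  have := congrArg abs h
  rwa [abs_mul, hσ, one_mul, abs_neg, abs_one] at this

/-- In the ball the distance to the frontier varies by at most δ(2√ρ + δ). Hence ψ varies by O(δ(√ρ
+ δ)), and replacing ψ by its differential costs only Mδ². -/
lemma rhoBall_subset_slab {d : ℕ} {Ω : Set (Euc (d + 1))} {ψ : Euc (d + 1) → ℝ}
    {k : Fin (d + 1)} {σ ε M Λ κ : ℝ} {ξ : Euc (d + 1)}
    (H : IsGraphChartAt Ω ψ (EuclideanSpace.single k σ) ε M Λ ξ) (hs : IsSmallScale ε M Λ κ)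
    (hΓ : (frontier Ω).Nonempty) (hξ : Metric.infDist ξ (frontier Ω) ≤ κ) (hξΩ : ξ ∈ Ω)
    {δ : ℝ} (hδκ : 2 * Λ * δ ≤ κ) :
    rhoBall Ω ξ δ ⊆ (fun η => η + -ξ) ⁻¹' slab (fderiv ℝ ψ ξ) k δ
      (-((2 * Λ * (2 + 16 * M * Λ ^ 2) + M) * δ * (Real.sqrt (Metric.infDist ξ (frontier Ω)) + δ)))
      ((2 * Λ * (2 + 16 * M * Λ ^ 2) + M) * δ * (Real.sqrt (Metric.infDist ξ (frontier Ω)) + δ)) := by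
  rintro η ⟨hη, hρη⟩
  rw [rho, norm_sub_rev, abs_sub_comm] at hρη
  have hΛ := hs.one_le_Λ
  have hM := hs.one_le_M
  have hn : ‖η - ξ‖ ≤ δ := by
    have := abs_nonneg (Real.sqrt (Metric.infDist η (frontier Ω)) -
      Real.sqrt (Metric.infDist ξ (frontier Ω)))
    linarith
  have hδ0 : 0 ≤ δ := (norm_nonneg _).trans hn
  have hδΛ : δ ≤ Λ * δ := le_mul_of_one_le_left hδ0 hΛ
  have hsd : |Real.sqrt (Metric.infDist η (frontier Ω)) -
      Real.sqrt (Metric.infDist ξ (frontier Ω))| ≤ δ := by linarith [norm_nonneg (η - ξ)]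
  have key := H.abs_psi_sub_le hs hΓ hξ hξΩ hη hn hδκ
  have hρ0 := infDist_frontier_nonneg Ω ξ
  have hρ0' := infDist_frontier_nonneg Ω η
  set ρ := Metric.infDist ξ (frontier Ω)
  set ρ' := Metric.infDist η (frontier Ω)
  have hx0 := Real.sqrt_nonneg ρ
  have hsq := Real.sq_sqrt hρ0
  set x := Real.sqrt ρ
  have hx1 : x ≤ 1 := Real.sqrt_le_one.mpr (hξ.trans hs.le_one)
  have hρx : ρ ≤ x := by rw [← hsq]; nlinarith
  have hdiff : |ρ' - ρ| ≤ δ * (2 * x + δ) := by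
    have hy0 := Real.sqrt_nonneg ρ'
    have e : ρ' - ρ = (Real.sqrt ρ' - x) * (Real.sqrt ρ' + x) := by
      rw [← hsq]; nth_rewrite 1 [← Real.sq_sqrt hρ0']; ring
    rw [e, abs_mul, abs_of_nonneg (by positivity : 0 ≤ Real.sqrt ρ' + x)]
    have h1 : Real.sqrt ρ' + x ≤ 2 * x + δ := by linarith [(abs_le.mp hsd).2]
    gcongr
  have hκ1 : ‖η - ξ‖ ≤ κ := by linarith
  have bη := IsGraphChartAt.mem_ball_of_le' hs
    (hκ1.trans (by linarith [hs.pos]) : ‖η - ξ‖ ≤ 20 * κ)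
  have bξ : ξ ∈ Metric.ball ξ ε :=
    IsGraphChartAt.mem_ball_of_le' hs (by simpa using hs.pos.le)
  have ht := H.taylor (by linarith) bξ bξ bη (by simpa using hδ0) hn
  have hβ : |fderiv ℝ ψ ξ (η - ξ)| ≤ |ψ η - ψ ξ| + M * δ * δ := by
    have h1 : M * δ * ‖η - ξ‖ ≤ M * δ * δ := by gcongr
    have h2 := abs_sub (ψ η - ψ ξ) (ψ η - ψ ξ - fderiv ℝ ψ ξ (η - ξ))
    rw [sub_sub_cancel] at h2
    linarith
  have hfin : |fderiv ℝ ψ ξ (η - ξ)| ≤ (2 * Λ * (2 + 16 * M * Λ ^ 2) + M) * δ * (x + δ) := by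
    have h1 : 4 * M * Λ * δ * (ρ + 4 * Λ * δ) ≤ 4 * M * Λ * δ * (4 * Λ * (x + δ)) := by
      gcongr
      nlinarith
    have h2 : δ * (2 * x + δ) ≤ 2 * δ * (x + δ) := by nlinarith
    have h3 : M * δ * δ ≤ M * δ * (x + δ) := by gcongr; linarith
    have h4 : 2 * Λ * (|ρ' - ρ| + 4 * M * Λ * δ * (ρ + 4 * Λ * δ)) ≤
        2 * Λ * (2 * δ * (x + δ) + 4 * M * Λ * δ * (4 * Λ * (x + δ))) := by
      gcongr; linarith
    calc _ ≤ 2 * Λ * (2 * δ * (x + δ) + 4 * M * Λ * δ * (4 * Λ * (x + δ))) + M * δ * (x + δ) := by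
          linarith
      _ = _ := by ring
  refine ⟨fun i _ => ?_, ?_⟩
  · beta_reduce
    rw [← sub_eq_add_neg]
    exact (by simpa using PiLp.norm_apply_le (η - ξ) i : |(η - ξ) i| ≤ ‖η - ξ‖).trans hn
  · beta_reduce
    rw [← sub_eq_add_neg]
    exact abs_le.mp hfin

/-- The constants C₁, C₂, C₃ serve three regimes: ξ close to the frontier with small t (slab), ξ
away from it (Euclidean ball, √ρ bounded below), and t bounded below (all of Ω). -/
lemma volume_rhoBall_le {d : ℕ} {Ω : Set (Euc (d + 1))} {ε M Λ κ : ℝ} (hΩ : IsCompact Ω)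
    (hA : HasGraphCharts Ω ε M Λ κ) (hs : IsSmallScale ε M Λ κ) (hΓ : (frontier Ω).Nonempty)
    {c : ℝ} (hc : 0 < c) :
    ∃ C : ℝ, 0 < C ∧ ∀ ξ ∈ Ω, ∀ t ∈ Ioc (0 : ℝ) 1, volume (rhoBall Ω ξ (c * t)) ≤
      ENNReal.ofReal (C * (t ^ (d + 1) * (Real.sqrt (Metric.infDist ξ (frontier Ω)) + t))) := by
  set D := 2 * Λ * (2 + 16 * M * Λ ^ 2) + M with hD
  have hΛ := hs.one_le_Λ
  have hM := hs.one_le_M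
  have hκ := hs.pos
  have hD0 : 0 < D := by positivity
  set C₁ := (2 * c) ^ d * (2 * D * c * (1 + c)) with hC₁
  set v := (volume (Metric.ball (0 : Euc (d + 1)) 1)).toReal with hv
  set C₂ := c ^ (d + 1) * v / Real.sqrt κ with hC₂
  set t₁ := κ / (2 * Λ * c) with ht₁
  have ht₁0 : 0 < t₁ := by positivity
  set C₃ := (volume Ω).toReal / t₁ ^ (d + 2) with hC₃
  have hC₁0 : 0 < C₁ := by positivity
  have hC₂0 : 0 ≤ C₂ := by positivity
  have hC₃0 : 0 ≤ C₃ := by positivity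
  refine ⟨C₁ + C₂ + C₃, by positivity, fun ξ hξΩ t ht => ?_⟩
  set ρ := Metric.infDist ξ (frontier Ω) with hρ
  have hρ0 : 0 ≤ ρ := infDist_frontier_nonneg Ω ξ
  have hx0 := Real.sqrt_nonneg ρ
  have ht0 := ht.1
  have hQ : 0 ≤ t ^ (d + 1) * (Real.sqrt ρ + t) := by positivity
  rcases lt_or_ge κ (2 * Λ * (c * t)) with hbig | hsmall
  · have htt : t₁ ≤ t := by
      rw [ht₁, div_le_iff₀ (by positivity)]; linarith
    calc volume (rhoBall Ω ξ (c * t)) ≤ volume Ω := measure_mono fun η hη => hη.1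
      _ = ENNReal.ofReal (volume Ω).toReal := (ENNReal.ofReal_toReal hΩ.measure_lt_top.ne).symm
      _ ≤ _ := by
        refine ENNReal.ofReal_le_ofReal ?_
        have h1 : (volume Ω).toReal = C₃ * (t₁ ^ (d + 1) * (0 + t₁)) := by
          rw [hC₃, zero_add, ← pow_succ]; field_simp
        rw [h1]
        have h2 : t₁ ^ (d + 1) * (0 + t₁) ≤ t ^ (d + 1) * (Real.sqrt ρ + t) := by gcongr
        have h3 : C₃ ≤ C₁ + C₂ + C₃ := by linarith
        gcongr
  · rcases le_or_gt ρ κ with hnear | hfar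
    · obtain ⟨ψ, k, σ, hσ, H⟩ := hA ξ hξΩ hnear
      refine (measure_mono (rhoBall_subset_slab H hs hΓ hnear hξΩ hsmall)).trans ?_
      rw [measure_preimage_add_right, volume_slab (H.abs_fderiv_single hσ) (by positivity),
        ← ENNReal.ofReal_mul (by positivity)]
      refine ENNReal.ofReal_le_ofReal ?_
      rw [← hD, ← hρ]
      have h1 : Real.sqrt ρ + c * t ≤ (1 + c) * (Real.sqrt ρ + t) := by nlinarith
      calc (2 * (c * t)) ^ d * (D * (c * t) * (Real.sqrt ρ + c * t) -
            -(D * (c * t) * (Real.sqrt ρ + c * t)))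
          = (2 * (c * t)) ^ d * (2 * D * (c * t) * (Real.sqrt ρ + c * t)) := by ring
        _ ≤ (2 * (c * t)) ^ d * (2 * D * (c * t) * ((1 + c) * (Real.sqrt ρ + t))) := by gcongr
        _ = C₁ * (t ^ (d + 1) * (Real.sqrt ρ + t)) := by
          rw [hC₁, ← mul_assoc 2 c t, mul_pow, pow_succ]; ring
        _ ≤ _ := by
          have h3 : C₁ ≤ C₁ + C₂ + C₃ := by linarith
          gcongr
    · have hsub : rhoBall Ω ξ (c * t) ⊆ Metric.closedBall ξ (c * t) := by
        rintro η ⟨-, h⟩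
        rw [rho] at h
        rw [mem_closedBall_iff_norm, norm_sub_rev]
        have := abs_nonneg (Real.sqrt ρ - Real.sqrt (Metric.infDist η (frontier Ω)))
        linarith
      refine (measure_mono hsub).trans ?_
      rw [Measure.addHaar_closedBall _ _ (by positivity), finrank_euclideanSpace_fin,
        ← ENNReal.ofReal_toReal (measure_ball_lt_top (x := (0 : Euc (d + 1))) (r := 1)).ne, ← hv,
        ← ENNReal.ofReal_mul (by positivity)]
      refine ENNReal.ofReal_le_ofReal ?_
      have h1 : Real.sqrt κ ≤ Real.sqrt ρ + t := by
        have := Real.sqrt_le_sqrt hfar.le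
        linarith
      have hκs : 0 < Real.sqrt κ := Real.sqrt_pos.mpr hκ
      calc (c * t) ^ (d + 1) * v = C₂ * (t ^ (d + 1) * Real.sqrt κ) := by
            rw [hC₂, mul_pow]; field_simp
        _ ≤ C₂ * (t ^ (d + 1) * (Real.sqrt ρ + t)) := by gcongr
        _ ≤ _ := by
          have h3 : C₂ ≤ C₁ + C₂ + C₃ := by linarith
          gcongr

end Rho

end IvanovModuli

/-! ### Averaging sets of auxiliary steps -/

namespace IvanovModuli

variable {d : ℕ} {Ω : Set (Euc (d + 1))}

/-- A set of steps `s` that keep points of the segment `[ξ, ξ + r v] ∩ Ω` inside `Ω`, of volume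
comparable to that of an Ivanov ball about `ξ`. -/
structure IsAveragingSet (Ω : Set (Euc (d + 1))) (r : ℝ) (ξ v : Euc (d + 1)) (t c : ℝ)
    (S : Set (Euc (d + 1))) : Prop where
  meas : MeasurableSet S
  vol : ENNReal.ofReal (c * (t ^ (d + 1) * (Real.sqrt (Metric.infDist ξ (frontier Ω)) + t))) ≤
    volume S
  mem : ∀ s ∈ S, ∀ μ ∈ Icc (0 : ℝ) r, ∀ l ∈ Icc (0 : ℝ) (r ^ 2), ξ + μ • v ∈ Ω →
    ξ + μ • v + l • s ∈ Ω

/-- A converse to `rhoBall_subset_slab`: a displacement of length O(t) with normal part O(t(√ρ + t))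
changes the distance by O(t(√ρ + t)), hence its square root by O(t). -/
lemma rho_le_of_tangential {ψ : Euc (d + 1) → ℝ} {e : Euc (d + 1)} {ε M Λ κ : ℝ}
    {ξ : Euc (d + 1)} (H : IsGraphChartAt Ω ψ e ε M Λ ξ) (hs : IsSmallScale ε M Λ κ)
    (hΓ : (frontier Ω).Nonempty) (hξ : Metric.infDist ξ (frontier Ω) ≤ κ) {T t : ℝ}
    (hT : 0 ≤ T) (ht : 0 ≤ t) (hTt : T * t ≤ κ) {w : Euc (d + 1)} (hw : ‖w‖ ≤ T * t)
    (hβ : |fderiv ℝ ψ ξ w| ≤ T * t * (Real.sqrt (Metric.infDist ξ (frontier Ω)) + t)) :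
    rho Ω ξ (ξ + w) ≤ (T + (1 + 2 * (T + 2 * M * T + 5 * M * T ^ 2))) * t := by
  have hM : 0 ≤ M := by linarith [hs.one_le_M]
  have hξκ : ‖ξ - ξ‖ ≤ κ := by simpa using hs.pos.le
  have hηκ : ‖ξ + w - ξ‖ ≤ κ := by rw [add_sub_cancel_left]; linarith
  have a1 := H.infDist_le_add hs hΓ hξ hξκ hηκ
  have a2 := H.infDist_le_add hs hΓ hξ hηκ hξκ
  have a3 := infDist_frontier_le_add Ω (ξ + w) ξ
  rw [abs_sub_comm, norm_sub_rev] at a2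
  rw [add_sub_cancel_left] at a1 a2 a3
  have bη := IsGraphChartAt.mem_ball_of_le' hs
    (hηκ.trans (by linarith [hs.pos]) : ‖ξ + w - ξ‖ ≤ 20 * κ)
  have bξ : ξ ∈ Metric.ball ξ ε :=
    IsGraphChartAt.mem_ball_of_le' hs (by simpa using hs.pos.le)
  have htay := H.taylor hM bξ bξ bη (τ := T * t) (by simp; positivity)
    (by rwa [add_sub_cancel_left])
  rw [add_sub_cancel_left] at htay
  have hρ0 := infDist_frontier_nonneg Ω ξ
  have hρ0' := infDist_frontier_nonneg Ω (ξ + w)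
  set ρ := Metric.infDist ξ (frontier Ω)
  set ρ' := Metric.infDist (ξ + w) (frontier Ω)
  have hx0 := Real.sqrt_nonneg ρ
  have hx1 : Real.sqrt ρ ≤ 1 := Real.sqrt_le_one.mpr (hξ.trans hs.le_one)
  have hρx : ρ ≤ Real.sqrt ρ := by nlinarith [Real.sq_sqrt hρ0]
  have hψ : |ψ (ξ + w) - ψ ξ| ≤ T * t * (Real.sqrt ρ + t) + M * (T * t) * (T * t) := by
    have h1 : M * (T * t) * ‖w‖ ≤ M * (T * t) * (T * t) := by gcongr
    have h2 := abs_add_le (ψ (ξ + w) - ψ ξ - fderiv ℝ ψ ξ w) (fderiv ℝ ψ ξ w)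
    rw [sub_add_cancel] at h2
    linarith
  have b1 : 2 * M * (ρ + ‖w‖) * ‖w‖ ≤ 2 * M * (Real.sqrt ρ + 2 * (T * t)) * (T * t) := by
    gcongr; nlinarith
  have b2 : 2 * M * (ρ' + ‖w‖) * ‖w‖ ≤ 2 * M * (Real.sqrt ρ + 2 * (T * t)) * (T * t) := by
    have h1 : ρ' + ‖w‖ ≤ Real.sqrt ρ + 2 * (T * t) := by linarith
    gcongr
  have hD : |ρ' - ρ| ≤ (T + 2 * M * T + 5 * M * T ^ 2) * t * (Real.sqrt ρ + t) := by
    have c1 : |ρ' - ρ| ≤ |ψ (ξ + w) - ψ ξ| + 2 * M * (Real.sqrt ρ + 2 * (T * t)) * (T * t) :=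
      abs_le.mpr ⟨by linarith, by linarith⟩
    have c2 : 0 ≤ 2 * M * T * t * t + 5 * M * T ^ 2 * t * Real.sqrt ρ := by positivity
    nlinarith
  have hsq := abs_sqrt_sub_sqrt_le hρ0 hρ0' ht (by positivity) hD
  rw [rho, sub_add_cancel_left, norm_neg, abs_sub_comm, add_mul]
  exact add_le_add hw hsq

/-- The coordinates other than the k-th are bounded directly; the k-th is recovered from β s,
because β has slope ±1 in that direction. -/
lemma norm_le_of_mem_slab {β : Euc (d + 1) →L[ℝ] ℝ} {k : Fin (d + 1)} {Λ R a b : ℝ}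
    (hβ : |β (EuclideanSpace.single k 1)| = 1) (hΛ : ‖β‖ ≤ Λ) (hΛ1 : 1 ≤ Λ) (hR : 0 ≤ R)
    (ha : 0 ≤ a) {s : Euc (d + 1)} (hs : s ∈ slab β k R a b) :
    ‖s‖ ≤ b + 2 * Λ * ((d + 1) * R) := by
  set s' : Euc (d + 1) := s - s k • EuclideanSpace.single k 1 with hs'
  have h1 : ‖s'‖ ≤ (d + 1) * R := by
    rw [EuclideanSpace.norm_eq]
    refine Real.sqrt_le_iff.mpr ⟨by positivity, ?_⟩
    calc ∑ i, ‖s' i‖ ^ 2 ≤ ∑ _i : Fin (d + 1), R ^ 2 := by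
          refine Finset.sum_le_sum fun i _ => ?_
          rw [Real.norm_eq_abs, sq_abs]
          by_cases hi : i = k
          · subst hi; simp [hs']; positivity
          · have := hs.1 i hi
            have e : s' i = s i := by simp [hs', hi]
            rw [e, ← sq_abs]; gcongr
      _ = (d + 1) * R ^ 2 := by simp
      _ ≤ _ := by
          rw [mul_pow]
          have : (1 : ℝ) ≤ d + 1 := by linarith [(Nat.cast_nonneg d : (0 : ℝ) ≤ d)]
          have : ((d : ℝ) + 1) ≤ (d + 1) ^ 2 := by nlinarith
          gcongr
  have h2 : |s k| ≤ b + Λ * ‖s'‖ := by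
    have e : s k * β (EuclideanSpace.single k 1) = β s - β s' := by
      rw [hs', map_sub, map_smul, smul_eq_mul]; ring
    have e2 : |s k| = |β s - β s'| := by rw [← e, abs_mul, hβ, mul_one]
    have e3 : |β s'| ≤ Λ * ‖s'‖ := (β.le_opNorm s').trans (by gcongr)
    have e4 : |β s| ≤ b := abs_le.mpr ⟨by linarith [hs.2.1, hs.2.2], hs.2.2⟩
    rw [e2]
    linarith [abs_sub (β s) (β s')]
  have h3 : ‖s‖ ≤ ‖s'‖ + |s k| := by
    have : s = s' + s k • EuclideanSpace.single k 1 := by rw [hs']; abel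
    calc ‖s‖ = ‖s' + s k • EuclideanSpace.single k 1‖ := by rw [← this]
      _ ≤ ‖s'‖ + ‖s k • (EuclideanSpace.single k 1 : Euc (d + 1))‖ := norm_add_le _ _
      _ = _ := by rw [norm_smul]; simp
  have h4 : ‖s'‖ ≤ Λ * ‖s'‖ := le_mul_of_one_le_left (norm_nonneg _) hΛ1
  have h5 : Λ * ‖s'‖ ≤ Λ * ((d + 1) * R) := by gcongr
  linarith

/-- S consists of steps pushing inward by at least A = t(√ρ + t), with narrow tangential width. That
such steps stay in Ω needs only |v| ≤ Kt; the bound on dψ(ξ)v is required only for the estimate of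
`rho`. Keeping the two apart matters, since for large t only the first is used. -/
lemma exists_averagingSet_near {ε M Λ κ : ℝ} (hs : IsSmallScale ε M Λ κ)
    (hΓ : (frontier Ω).Nonempty) {r K : ℝ} (hr : 1 ≤ r) (hK : 1 ≤ K) :
    ∃ t₀ c C : ℝ, 0 < t₀ ∧ 0 < c ∧ 0 < C ∧ ∀ (ψ : Euc (d + 1) → ℝ) (k : Fin (d + 1)) (σ : ℝ)
      (ξ : Euc (d + 1)), |σ| = 1 → IsGraphChartAt Ω ψ (EuclideanSpace.single k σ) ε M Λ ξ →
      Metric.infDist ξ (frontier Ω) ≤ κ → ∀ t ∈ Ioc 0 t₀, ∀ v : Euc (d + 1), ‖v‖ ≤ K * t →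
      ∃ S, IsAveragingSet Ω r ξ v t c S ∧
        (|fderiv ℝ ψ ξ v| ≤ K * t * (Real.sqrt (Metric.infDist ξ (frontier Ω)) + t) →
          ∀ s ∈ S, ∀ μ ∈ Icc (0 : ℝ) r, ∀ l ∈ Icc (0 : ℝ) (r ^ 2),
            rho Ω ξ (ξ + (μ • v + l • s)) ≤ C * t) := by
  have hΛ := hs.one_le_Λ
  have hM := hs.one_le_M
  have hκ := hs.pos
  -- Steps of S have norm at most 5t, so every displacement μv + ls has norm at most Tt.
  set T := r * K + 5 * r ^ 2 with hT
  have hT1 : 1 ≤ T := by nlinarith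
  -- Chosen so that the tangential width θt contributes exactly t/(2MT) to the bound on ‖s‖.
  set θ := 1 / (4 * Λ * M * T * (d + 1)) with hθ
  have hθ0 : 0 < θ := by positivity
  refine ⟨κ / (4 * M * T), (2 * θ) ^ d, T + (1 + 2 * (T + 2 * M * T + 5 * M * T ^ 2)),
    by positivity, by positivity, by positivity, ?_⟩
  intro ψ k σ ξ hσ H hξ t ht v hv
  have ht0 := ht.1
  have htT : 4 * M * (T * t) ≤ κ := by
    have := (le_div_iff₀ (by positivity)).mp ht.2
    linarith
  have hTt : T * t ≤ κ := by
    have : T * t ≤ M * (T * t) := le_mul_of_one_le_left (by positivity) hM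
    have : 0 ≤ M * (T * t) := by positivity
    linarith
  have ht1 : t ≤ 1 := by
    have : t ≤ T * t := le_mul_of_one_le_left ht0.le hT1
    linarith [hs.le_one]
  have hρ0 := infDist_frontier_nonneg Ω ξ
  set ρ := Metric.infDist ξ (frontier Ω) with hρ
  have hx0 := Real.sqrt_nonneg ρ
  have hx1 : Real.sqrt ρ ≤ 1 := Real.sqrt_le_one.mpr (hξ.trans hs.le_one)
  set A := t * (Real.sqrt ρ + t) with hA
  have hA0 : 0 < A := by positivity
  have hAt : t ^ 2 ≤ A := by rw [hA]; nlinarith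
  have hA2 : A ≤ 2 * t := by rw [hA]; nlinarith
  set β := fderiv ℝ ψ ξ with hβ
  have bξ : ξ ∈ Metric.ball ξ ε :=
    IsGraphChartAt.mem_ball_of_le' hs (by simpa using hs.pos.le)
  have hβk := H.abs_fderiv_single hσ
  have hβΛ : ‖β‖ ≤ Λ := H.bound ξ bξ
  have hnorm : ∀ s ∈ slab β k (θ * t) A (2 * A), ‖s‖ ≤ 2 * A + t / (2 * M * T) := by
    intro s hsS
    have := norm_le_of_mem_slab hβk hβΛ hΛ (by positivity) hA0.le hsS
    have e : 2 * Λ * ((d + 1) * (θ * t)) = t / (2 * M * T) := by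
      rw [hθ]; field_simp; ring
    rwa [e] at this
  have hsmall : t / (2 * M * T) ≤ t := by
    rw [div_le_iff₀ (by positivity)]
    have : 1 ≤ M * T := one_le_mul_of_one_le_of_one_le hM hT1
    nlinarith
  have hnorm5 : ∀ s ∈ slab β k (θ * t) A (2 * A), ‖s‖ ≤ 5 * t := by
    intro s hsS
    linarith [hnorm s hsS]
  have hdisp : ∀ s ∈ slab β k (θ * t) A (2 * A), ∀ μ ∈ Icc (0 : ℝ) r, ∀ l ∈ Icc (0 : ℝ) (r ^ 2),
      ‖μ • v + l • s‖ ≤ T * t := by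
    intro s hsS μ hμ l hl
    refine (norm_add_le _ _).trans ?_
    rw [norm_smul, norm_smul, Real.norm_eq_abs, Real.norm_eq_abs, abs_of_nonneg hμ.1,
      abs_of_nonneg hl.1]
    have h1 : μ * ‖v‖ ≤ r * (K * t) := mul_le_mul hμ.2 hv (norm_nonneg _) (by linarith)
    have h2 : l * ‖s‖ ≤ r ^ 2 * (5 * t) :=
      mul_le_mul hl.2 (hnorm5 s hsS) (norm_nonneg _) (by positivity)
    rw [hT]; linarith
  refine ⟨slab β k (θ * t) A (2 * A), ⟨(isClosed_slab _ _ _ _ _).measurableSet, ?_, ?_⟩, ?_⟩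
  · rw [volume_slab hβk (by positivity), ← ENNReal.ofReal_mul (by positivity)]
    refine ENNReal.ofReal_le_ofReal (le_of_eq ?_)
    rw [← mul_assoc 2 θ t, mul_pow, hA, pow_succ]; ring
  · intro s hsS μ hμ l hl hz
    set z := ξ + μ • v with hz'
    have h0r : (0 : ℝ) ∈ Icc (0 : ℝ) (r ^ 2) := ⟨le_rfl, by positivity⟩
    have d1 : ‖z - ξ‖ ≤ T * t := by
      have := hdisp s hsS μ hμ 0 h0r
      rw [zero_smul, add_zero] at this
      rwa [hz', add_sub_cancel_left]
    have d2 : ‖z + l • s - ξ‖ ≤ T * t := by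
      have := hdisp s hsS μ hμ l hl
      rwa [show z + l • s - ξ = μ • v + l • s by rw [hz']; abel]
    have b1 := IsGraphChartAt.mem_ball_of_le' hs
      (d1.trans (by linarith) : ‖z - ξ‖ ≤ 20 * κ)
    have b2 := IsGraphChartAt.mem_ball_of_le' hs
      (d2.trans (by linarith) : ‖z + l • s - ξ‖ ≤ 20 * κ)
    rw [H.mem_iff _ b2]
    have hψz := (H.mem_iff _ b1).mp hz
    have ht' := H.taylor (by linarith) bξ b1 b2 d1 d2
    rw [add_sub_cancel_left, map_smul, smul_eq_mul, norm_smul, Real.norm_eq_abs,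
      abs_of_nonneg hl.1, ← hβ] at ht'
    -- The curvature error. Half of A absorbs the part of ‖s‖ of size 2A, as 4MTt ≤ κ ≤ 1; the other
    -- half absorbs the tangential part, which gives t²/2 ≤ A/2.
    have h1 : M * (T * t) * ‖s‖ ≤ A := by
      have e1 : M * (T * t) * ‖s‖ ≤ M * (T * t) * (2 * A + t / (2 * M * T)) := by
        gcongr; exact hnorm s hsS
      have e2 : M * (T * t) * (2 * A + t / (2 * M * T)) =
          2 * (M * (T * t)) * A + t ^ 2 / 2 := by field_simp
      have e3 : 2 * (M * (T * t)) * A ≤ (1 / 2) * A := by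
        have := hs.le_one
        gcongr; linarith
      linarith
    have h2 : l * A ≤ l * β s := mul_le_mul_of_nonneg_left hsS.2.1 hl.1
    have h3 : l * (M * (T * t) * ‖s‖) ≤ l * A := mul_le_mul_of_nonneg_left h1 hl.1
    have h4 := (abs_le.mp ht').1
    nlinarith
  · intro hβv s hsS μ hμ l hl
    refine rho_le_of_tangential H hs hΓ hξ (by linarith) ht0.le hTt (hdisp s hsS μ hμ l hl) ?_
    rw [map_add, map_smul, map_smul, smul_eq_mul, smul_eq_mul]
    refine (abs_add_le _ _).trans ?_
    rw [abs_mul, abs_mul, abs_of_nonneg hμ.1, abs_of_nonneg hl.1]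
    have h1 : μ * |β v| ≤ r * (K * t * (Real.sqrt ρ + t)) :=
      mul_le_mul hμ.2 hβv (abs_nonneg _) (by linarith)
    have h2 : l * |β s| ≤ r ^ 2 * (2 * A) := by
      refine mul_le_mul hl.2 (abs_le.mpr ⟨?_, hsS.2.2⟩) (abs_nonneg _) (by positivity)
      linarith [hsS.2.1]
    have h3 : 0 ≤ r ^ 2 * A := by positivity
    calc μ * |β v| + l * |β s| ≤ r * (K * t * (Real.sqrt ρ + t)) + r ^ 2 * (2 * A) := by linarith
      _ ≤ r * (K * t * (Real.sqrt ρ + t)) + 5 * r ^ 2 * A := by linarith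
      _ = T * t * (Real.sqrt ρ + t) := by rw [hA, hT]; ring

/-- At distance more than κ from the frontier, S is the ball of radius t: no displacement reaches
the frontier, and √ρ is Lipschitz there. The weight √ρ + t is at most B + 1, whence the constant
v₁/(B + 1). -/
lemma exists_averagingSet_interior {κ : ℝ} (hΩ : IsCompact Ω) (hκ : 0 < κ) {r K : ℝ}
    (hr : 1 ≤ r) (hK : 1 ≤ K) :
    ∃ t₀ c C : ℝ, 0 < t₀ ∧ 0 < c ∧ 0 < C ∧ ∀ ξ ∈ Ω, κ < Metric.infDist ξ (frontier Ω) →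
      ∀ t ∈ Ioc 0 t₀, ∀ v : Euc (d + 1), ‖v‖ ≤ K * t →
      ∃ S, IsAveragingSet Ω r ξ v t c S ∧
        ∀ s ∈ S, ∀ μ ∈ Icc (0 : ℝ) r, ∀ l ∈ Icc (0 : ℝ) (r ^ 2),
          rho Ω ξ (ξ + (μ • v + l • s)) ≤ C * t := by
  obtain ⟨B, hB0, hB⟩ : ∃ B : ℝ, 0 < B ∧ ∀ ξ ∈ Ω,
      Real.sqrt (Metric.infDist ξ (frontier Ω)) ≤ B := by
    have hc : ContinuousOn (fun ξ => Real.sqrt (Metric.infDist ξ (frontier Ω))) Ω :=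
      (Real.continuous_sqrt.comp (Metric.continuous_infDist_pt _)).continuousOn
    obtain ⟨B, hB⟩ := (hΩ.image_of_continuousOn hc).isBounded.bddAbove
    exact ⟨max B 1, by positivity, fun ξ hξ => (hB (mem_image_of_mem _ hξ)).trans (le_max_left _ _)⟩
  set T := r * K + r ^ 2 with hT
  have hT1 : 1 ≤ T := by nlinarith
  set v₁ := (volume (Metric.ball (0 : Euc (d + 1)) 1)).toReal with hv₁
  have hv₁0 : 0 < v₁ := ENNReal.toReal_pos (Metric.measure_ball_pos _ _ one_pos).ne'
    measure_ball_lt_top.ne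
  have hsκ : 0 < Real.sqrt κ := Real.sqrt_pos.mpr hκ
  refine ⟨min (κ / T) 1, v₁ / (B + 1), T + T / Real.sqrt κ, by positivity, by positivity,
    by positivity, ?_⟩
  intro ξ hξΩ hξ t ht v hv
  have ht0 := ht.1
  have hTt : T * t ≤ κ := by
    have := (le_div_iff₀ (by positivity)).mp (ht.2.trans (min_le_left _ _))
    linarith
  have ht1 : t ≤ 1 := ht.2.trans (min_le_right _ _)
  have hdisp : ∀ s ∈ Metric.ball (0 : Euc (d + 1)) t, ∀ μ ∈ Icc (0 : ℝ) r,
      ∀ l ∈ Icc (0 : ℝ) (r ^ 2), ‖μ • v + l • s‖ ≤ T * t := by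
    intro s hsS μ hμ l hl
    refine (norm_add_le _ _).trans ?_
    rw [norm_smul, norm_smul, Real.norm_eq_abs, Real.norm_eq_abs, abs_of_nonneg hμ.1,
      abs_of_nonneg hl.1]
    have h1 : μ * ‖v‖ ≤ r * (K * t) := mul_le_mul hμ.2 hv (norm_nonneg _) (by linarith)
    have h2 : l * ‖s‖ ≤ r ^ 2 * t :=
      mul_le_mul hl.2 (mem_ball_zero_iff.mp hsS).le (norm_nonneg _) (by positivity)
    rw [hT]; linarith
  refine ⟨Metric.ball 0 t, ⟨measurableSet_ball, ?_, ?_⟩, ?_⟩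
  · rw [Measure.addHaar_ball _ _ ht0.le, finrank_euclideanSpace_fin,
      ← ENNReal.ofReal_toReal (measure_ball_lt_top (x := (0 : Euc (d + 1))) (r := 1)).ne, ← hv₁,
      ← ENNReal.ofReal_mul (by positivity)]
    refine ENNReal.ofReal_le_ofReal ?_
    have := hB ξ hξΩ
    calc v₁ / (B + 1) * (t ^ (d + 1) * (Real.sqrt (Metric.infDist ξ (frontier Ω)) + t))
        ≤ v₁ / (B + 1) * (t ^ (d + 1) * (B + 1)) := by gcongr
      _ = _ := by field_simp
  · intro s hsS μ hμ l hl _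
    refine mem_of_norm_lt_infDist_frontier hξΩ (lt_of_le_of_lt ?_ hξ)
    rw [show ξ + μ • v + l • s - ξ = μ • v + l • s by abel]
    exact (hdisp s hsS μ hμ l hl).trans hTt
  · intro s hsS μ hμ l hl
    have hw := hdisp s hsS μ hμ l hl
    set w := μ • v + l • s
    rw [rho, sub_add_cancel_left, norm_neg]
    have h1 := infDist_frontier_le_add Ω (ξ + w) ξ
    have h2 := infDist_frontier_le_add Ω ξ (ξ + w)
    rw [add_sub_cancel_left] at h1
    rw [sub_add_cancel_left, norm_neg] at h2
    have hρ0 := infDist_frontier_nonneg Ω ξ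
    have hρ0' := infDist_frontier_nonneg Ω (ξ + w)
    set ρ := Metric.infDist ξ (frontier Ω)
    set ρ' := Metric.infDist (ξ + w) (frontier Ω)
    have h3 : |Real.sqrt ρ - Real.sqrt ρ'| ≤ T / Real.sqrt κ * t := by
      have e : ρ - ρ' = (Real.sqrt ρ - Real.sqrt ρ') * (Real.sqrt ρ + Real.sqrt ρ') := by
        nth_rewrite 1 [← Real.sq_sqrt hρ0]; nth_rewrite 1 [← Real.sq_sqrt hρ0']; ring
      have h4 : |ρ - ρ'| ≤ T * t := abs_le.mpr ⟨by linarith, by linarith⟩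
      have h5 : Real.sqrt κ ≤ Real.sqrt ρ + Real.sqrt ρ' := by
        linarith [Real.sqrt_le_sqrt hξ.le, Real.sqrt_nonneg ρ']
      rw [e, abs_mul, abs_of_nonneg (by linarith : 0 ≤ Real.sqrt ρ + Real.sqrt ρ')] at h4
      rw [div_mul_eq_mul_div, le_div_iff₀ hsκ]
      exact (mul_le_mul_of_nonneg_left h5 (abs_nonneg _)).trans h4
    linarith

end IvanovModuli

namespace IvanovModuli

/-! ### Measurability of differences and local moduli -/

section Measurability

variable {n : ℕ} {Ω : Set (Euc n)} {f : Euc n → ℝ}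

lemma finDiffOn_of_subset {V : Type*} [AddCommGroup V] [Module ℝ V] {r : ℕ} {h : V} {f : V → ℝ}
    {Ω : Set V} {η : V} (hs : segment ℝ η (η + (r : ℝ) • h) ⊆ Ω) :
    finDiffOn r h f Ω η = finDiff r h f η := if_pos hs

lemma finDiffOn_of_not_subset {V : Type*} [AddCommGroup V] [Module ℝ V] {r : ℕ} {h : V}
    {f : V → ℝ} {Ω : Set V} {η : V} (hs : ¬ segment ℝ η (η + (r : ℝ) • h) ⊆ Ω) :
    finDiffOn r h f Ω η = 0 := if_neg hs

lemma measurable_finDiff {α : Type*} [MeasurableSpace α] (r : ℕ) (hf : Measurable f)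
    {h η : α → Euc n} (hh : Measurable h) (hη : Measurable η) :
    Measurable fun a => finDiff r (h a) f (η a) := by
  unfold finDiff
  fun_prop

lemma measurable_finDiffOn {α : Type*} [MeasurableSpace α] (r : ℕ) (hΩ : IsClosed Ω)
    (hf : Measurable f) {h η : α → Euc n} (hh : Measurable h) (hη : Measurable η) :
    Measurable fun a => finDiffOn r (h a) f Ω (η a) := by
  classical
  have hS : MeasurableSet {a | segment ℝ (η a) (η a + (r : ℝ) • h a) ⊆ Ω} := by
    have hm : Measurable fun a => (η a, η a + (r : ℝ) • h a) := by fun_prop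
    exact hm (isClosed_segment_subset hΩ).measurableSet
  have : (fun a => finDiffOn r (h a) f Ω (η a)) =
      fun a => if a ∈ {a | segment ℝ (η a) (η a + (r : ℝ) • h a) ⊆ Ω} then
        finDiff r (h a) f (η a) else 0 := by
    ext a; simp [finDiffOn]
  rw [this]
  exact Measurable.ite hS (measurable_finDiff r hf hh hη) measurable_const

lemma continuous_rho (Ω : Set (Euc n)) : Continuous fun p : Euc n × Euc n => rho Ω p.1 p.2 := by
  unfold rho
  have h1 : Continuous fun p : Euc n × Euc n => Metric.infDist p.1 (frontier Ω) :=
    (Metric.continuous_infDist_pt _).comp continuous_fst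
  have h2 : Continuous fun p : Euc n × Euc n => Metric.infDist p.2 (frontier Ω) :=
    (Metric.continuous_infDist_pt _).comp continuous_snd
  fun_prop

lemma isClosed_rhoBall_pair (hΩ : IsClosed Ω) (δ : ℝ) :
    IsClosed {p : Euc n × Euc n | p.2 ∈ rhoBall Ω p.1 δ} :=
  (hΩ.preimage continuous_snd).inter (isClosed_le (continuous_rho Ω) continuous_const)

lemma measurableSet_rhoBall (hΩ : IsClosed Ω) (ξ : Euc n) (δ : ℝ) :
    MeasurableSet (rhoBall Ω ξ δ) :=
  ((isClosed_rhoBall_pair hΩ δ).preimage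
    (f := fun η : Euc n => (ξ, η)) (by fun_prop)).measurableSet

lemma measurable_localModulus (r : ℕ) (hΩ : IsClosed Ω) (hf : Measurable f) (δ : ℝ) {q : ℝ≥0∞}
    (hq : q ≠ ∞) : Measurable fun ξ => localModulus r Ω f ξ δ q := by
  have hP := (isClosed_rhoBall_pair hΩ δ).measurableSet
  simp only [localModulus, hq, if_false]
  have h1 : Measurable fun ξ => volume (rhoBall Ω ξ δ) := measurable_measure_prodMk_left hP
  have h2 : Measurable fun ξ => ∫⁻ η in rhoBall Ω ξ δ,
      ‖finDiffOn r ((r : ℝ)⁻¹ • (η - ξ)) f Ω ξ‖ₑ ^ q.toReal := by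
    have h3 : Measurable fun p : Euc n × Euc n => {p : Euc n × Euc n | p.2 ∈ rhoBall Ω p.1 δ}.indicator
        (fun p => ‖finDiffOn r ((r : ℝ)⁻¹ • (p.2 - p.1)) f Ω p.1‖ₑ ^ q.toReal) p :=
      (((measurable_finDiffOn r hΩ hf (by fun_prop) (by fun_prop)).enorm).pow_const _).indicator hP
    have h4 := h3.lintegral_prod_right' (ν := volume)
    convert h4 using 2 with ξ
    rw [← lintegral_indicator (measurableSet_rhoBall hΩ ξ δ)]
    rfl
  fun_prop

/-- The Jacobian contributes the factor l^(-n) ≤ 1. -/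
lemma lintegral_comp_affine_le {G : Euc n → ℝ≥0∞} (hG : Measurable G) (x : Euc n) {l : ℝ}
    (hl : 1 ≤ l) : ∫⁻ s, G (x + l • s) ≤ ∫⁻ η, G η := by
  have hG' : Measurable fun y => G (x + y) := by fun_prop
  have h1 := lintegral_map (μ := (volume : Measure (Euc n))) hG' (measurable_const_smul l)
  rw [Measure.map_addHaar_smul _ (by positivity), lintegral_smul_measure,
    lintegral_add_left_eq_self] at h1
  rw [← h1, smul_eq_mul]
  refine mul_le_of_le_one_left zero_le ?_
  rw [← ENNReal.ofReal_one]
  refine ENNReal.ofReal_le_ofReal ?_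
  rw [abs_of_nonneg (by positivity)]
  exact inv_le_one_of_one_le₀ (one_le_pow₀ hl)

end Measurability

/-! ### The averaging estimate at a point -/

section Pointwise

/-- Estimating every summand by the largest one covers all p > 0, including exponents below 1 where
convexity fails. -/
lemma sum_rpow_le_card_rpow_mul_sum {ι : Type*} (s : Finset ι) (a : ι → ℝ≥0∞) {p : ℝ} (hp : 0 < p) :
    (∑ i ∈ s, a i) ^ p ≤ (s.card : ℝ≥0∞) ^ p * ∑ i ∈ s, a i ^ p := by
  rcases s.eq_empty_or_nonempty with rfl | hne
  · simp [hp]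
  obtain ⟨m, hm, hmax⟩ := Finset.exists_max_image s a hne
  calc (∑ i ∈ s, a i) ^ p ≤ (s.card * a m) ^ p := by
        gcongr
        rw [← nsmul_eq_mul]
        exact Finset.sum_le_card_nsmul _ _ _ hmax
    _ = (s.card : ℝ≥0∞) ^ p * a m ^ p := ENNReal.mul_rpow_of_nonneg _ _ hp.le
    _ ≤ _ := by
        gcongr
        exact Finset.single_le_sum (f := fun i => a i ^ p) (fun _ _ => zero_le) hm

variable {d : ℕ} {Ω : Set (Euc (d + 1))}

lemma lintegral_rhoBall_le_localModulus (r : ℕ) (f : Euc (d + 1) → ℝ) (ξ : Euc (d + 1)) (δ : ℝ)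
    {q : ℝ≥0∞} (hq0 : 0 < q) (hq : q ≠ ∞) (hΩ : IsCompact Ω) :
    ∫⁻ η in rhoBall Ω ξ δ, ‖finDiffOn r ((r : ℝ)⁻¹ • (η - ξ)) f Ω ξ‖ₑ ^ q.toReal ≤
      volume (rhoBall Ω ξ δ) * localModulus r Ω f ξ δ q ^ q.toReal := by
  have hq' : 0 < q.toReal := ENNReal.toReal_pos hq0.ne' hq
  simp only [localModulus, hq, if_false]
  rw [← ENNReal.rpow_mul, one_div, inv_mul_cancel₀ hq'.ne', ENNReal.rpow_one]
  -- For a null ball the inverse volume is ∞ and cannot be cancelled, but then the left side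
  -- vanishes.
  rcases eq_or_ne (volume (rhoBall Ω ξ δ)) 0 with h0 | h0
  · rw [setLIntegral_measure_zero _ _ h0]; exact zero_le
  · have hfin : volume (rhoBall Ω ξ δ) ≠ ∞ :=
      ((measure_mono fun η hη => hη.1).trans_lt hΩ.measure_lt_top).ne
    rw [← mul_assoc, ENNReal.mul_inv_cancel h0 hfin, one_mul]

/-- The averaging estimate behind the comparison: an `r`-th difference is controlled by local
moduli at the nodes, as soon as sufficiently many auxiliary steps are available. -/
lemma exists_enorm_finDiff_le (hΩ : IsCompact Ω) {r : ℕ} (hr : 1 ≤ r) {q : ℝ≥0∞} (hq0 : 0 < q)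
    {C' : ℝ≥0∞} (hC' : C' ≠ ∞) :
    ∃ C : ℝ≥0∞, C ≠ ∞ ∧ ∀ (f : Euc (d + 1) → ℝ), (q = ∞ ∨ Measurable f) →
      ∀ (ξ v : Euc (d + 1)) (t c δ : ℝ) (S : Set (Euc (d + 1))), 0 < t → 0 < c → ξ ∈ Ω →
      segment ℝ ξ (ξ + (r : ℝ) • v) ⊆ Ω → IsAveragingSet Ω r ξ v t c S →
      (∀ s ∈ S, ∀ μ ∈ Icc (0 : ℝ) r, ∀ μ' ∈ Icc (0 : ℝ) r, ∀ l ∈ Icc (0 : ℝ) ((r : ℝ) ^ 2),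
        rho Ω (ξ + μ • v) (ξ + (μ' • v + l • s)) ≤ δ) →
      (∀ i ≤ r, volume (rhoBall Ω (ξ + (i : ℝ) • v) δ) ≤ C' * volume S) →
      ‖finDiff r v f ξ‖ₑ ≤ C * ∑ i ∈ Finset.range (r + 1),
        localModulus r Ω f (ξ + (i : ℝ) • v) δ q := by
  set c₁ : ℝ≥0∞ := 2 ^ r with hc₁
  have hc₁t : c₁ ≠ ∞ := by simp [hc₁]
  set C : ℝ≥0∞ := if q = ∞ then c₁ * (2 * r) else
    ((c₁ ^ q.toReal * (2 ^ q.toReal * (r : ℝ≥0∞) ^ q.toReal)) * (2 * r * C')) ^ (1 / q.toReal)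
    with hC
  have hCt : C ≠ ∞ := by
    rw [hC]
    split_ifs with hq
    · finiteness
    · have : 0 ≤ q.toReal := ENNReal.toReal_nonneg
      have : 0 ≤ 1 / q.toReal := by positivity
      finiteness
  refine ⟨C, hCt, fun f hf ξ v t c δ S ht0 hc0 hξ hseg hS hd hvol => ?_⟩
  have hr0 : (0 : ℝ) < r := by exact_mod_cast hr
  have hr1 : (1 : ℝ) ≤ r := by exact_mod_cast hr
  have hseg' : ∀ μ ∈ Icc (0 : ℝ) r, ξ + μ • v ∈ Ω := by
    intro μ hμ
    have := segment_add_subset_iff.mp hseg (μ / r) ⟨by have := hμ.1; positivity,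
      (div_le_one hr0).mpr hμ.2⟩
    rwa [smul_smul, div_mul_cancel₀ _ hr0.ne'] at this
  have hcast : ∀ j ∈ Finset.range r, ((j + 1 : ℕ) : ℝ) ∈ Icc (1 : ℝ) r := by
    intro j hj
    have := Finset.mem_range.mp hj
    exact ⟨by push_cast; linarith [(Nat.cast_nonneg j : (0 : ℝ) ≤ j)], by exact_mod_cast this⟩
  -- the two families of differences, expressed through the end points of their segments
  have hA : ∀ s ∈ S, ∀ j ∈ Finset.range r,
      ξ + (r : ℝ) • (v + ((j + 1 : ℕ) : ℝ) • s) ∈ rhoBall Ω ξ δ ∧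
      finDiff r (v + ((j + 1 : ℕ) : ℝ) • s) f ξ = finDiffOn r ((r : ℝ)⁻¹ •
        (ξ + (r : ℝ) • (v + ((j + 1 : ℕ) : ℝ) • s) - ξ)) f Ω ξ := by
    intro s hs j hj
    obtain ⟨hj1, hj2⟩ := hcast j hj
    have hmemseg : ∀ θ ∈ Icc (0 : ℝ) 1,
        ξ + θ • ((r : ℝ) • (v + ((j + 1 : ℕ) : ℝ) • s)) ∈ Ω := by
      intro θ hθ
      have hμ : θ * r ∈ Icc (0 : ℝ) r :=
        ⟨mul_nonneg hθ.1 hr0.le, mul_le_of_le_one_left hr0.le hθ.2⟩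
      -- The multiples of s that occur are at most r·r; this is why averaging sets allow l up to r².
      have hl : θ * r * ((j + 1 : ℕ) : ℝ) ∈ Icc (0 : ℝ) ((r : ℝ) ^ 2) :=
        ⟨mul_nonneg hμ.1 (by linarith), by
          rw [sq]; exact mul_le_mul hμ.2 hj2 (by linarith) (by linarith)⟩
      have := hS.mem s hs _ hμ _ hl (hseg' _ hμ)
      convert this using 1; module
    refine ⟨⟨by simpa using hmemseg 1 ⟨zero_le_one, le_rfl⟩, ?_⟩, ?_⟩
    · have := hd s hs 0 ⟨le_rfl, hr0.le⟩ r ⟨hr0.le, le_rfl⟩ (r * ((j + 1 : ℕ) : ℝ))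
        ⟨by positivity, by rw [sq]; gcongr⟩
      rw [zero_smul, add_zero] at this
      convert this using 2; module
    · rw [add_sub_cancel_left, smul_smul, inv_mul_cancel₀ hr0.ne', one_smul, finDiffOn_of_subset]
      exact segment_add_subset_iff.mpr hmemseg
  have hB : ∀ s ∈ S, ∀ j ∈ Finset.range r,
      ξ + ((j + 1 : ℕ) : ℝ) • v + ((r : ℝ) * ((j + 1 : ℕ) : ℝ)) • s ∈
        rhoBall Ω (ξ + ((j + 1 : ℕ) : ℝ) • v) δ ∧
      finDiff r (((j + 1 : ℕ) : ℝ) • s) f (ξ + ((j + 1 : ℕ) : ℝ) • v) = finDiffOn r ((r : ℝ)⁻¹ •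
        (ξ + ((j + 1 : ℕ) : ℝ) • v + ((r : ℝ) * ((j + 1 : ℕ) : ℝ)) • s -
          (ξ + ((j + 1 : ℕ) : ℝ) • v))) f Ω (ξ + ((j + 1 : ℕ) : ℝ) • v) := by
    intro s hs j hj
    obtain ⟨hj1, hj2⟩ := hcast j hj
    have hμ : ((j + 1 : ℕ) : ℝ) ∈ Icc (0 : ℝ) r := ⟨by linarith, hj2⟩
    have hl0 : (r : ℝ) * ((j + 1 : ℕ) : ℝ) ≤ (r : ℝ) ^ 2 := by rw [sq]; gcongr
    have hmemseg : ∀ θ ∈ Icc (0 : ℝ) 1, ξ + ((j + 1 : ℕ) : ℝ) • v +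
        θ • (((r : ℝ) * ((j + 1 : ℕ) : ℝ)) • s) ∈ Ω := by
      intro θ hθ
      have hl : θ * (r * ((j + 1 : ℕ) : ℝ)) ∈ Icc (0 : ℝ) ((r : ℝ) ^ 2) :=
        ⟨mul_nonneg hθ.1 (by positivity), (mul_le_of_le_one_left (by positivity) hθ.2).trans hl0⟩
      have := hS.mem s hs _ hμ _ hl (hseg' _ hμ)
      convert this using 1; module
    refine ⟨⟨by simpa using hmemseg 1 ⟨zero_le_one, le_rfl⟩, ?_⟩, ?_⟩
    · have := hd s hs _ hμ _ hμ (r * ((j + 1 : ℕ) : ℝ)) ⟨by positivity, hl0⟩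
      rwa [← add_assoc] at this
    · rw [add_sub_cancel_left, smul_smul, ← mul_assoc, inv_mul_cancel₀ hr0.ne', one_mul,
        finDiffOn_of_subset]
      refine segment_add_subset_iff.mpr ?_
      rw [smul_smul]
      exact hmemseg
  set W : ℕ → ℝ≥0∞ := fun i => localModulus r Ω f (ξ + (i : ℝ) • v) δ q with hW
  set W₀ := ∑ i ∈ Finset.range (r + 1), W i with hW₀
  have hW0 : localModulus r Ω f ξ δ q ≤ W₀ := by
    have : W 0 ≤ W₀ := Finset.single_le_sum (f := W) (fun _ _ => zero_le) (by simp)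
    simpa [hW] using this
  have hWj : ∀ j ∈ Finset.range r,
      localModulus r Ω f (ξ + ((j + 1 : ℕ) : ℝ) • v) δ q ≤ W₀ := by
    intro j hj
    exact Finset.single_le_sum (f := W) (fun _ _ => zero_le)
      (Finset.mem_range.mpr (by have := Finset.mem_range.mp hj; omega))
  have hpt : ∀ s : Euc (d + 1), ‖finDiff r v f ξ‖ₑ ≤
      c₁ * (∑ j ∈ Finset.range r, ‖finDiff r (v + ((j + 1 : ℕ) : ℝ) • s) f ξ‖ₑ +
        ∑ j ∈ Finset.range r,
          ‖finDiff r (((j + 1 : ℕ) : ℝ) • s) f (ξ + ((j + 1 : ℕ) : ℝ) • v)‖ₑ) := by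
    intro s
    have h := ENNReal.ofReal_le_ofReal (norm_finDiff_le_sum hr v s f ξ)
    rw [ofReal_norm, ENNReal.ofReal_mul (by positivity), ENNReal.ofReal_add
      (by positivity) (by positivity), ENNReal.ofReal_sum_of_nonneg (by intros; positivity),
      ENNReal.ofReal_sum_of_nonneg (by intros; positivity), ENNReal.ofReal_pow (by norm_num),
      ENNReal.ofReal_ofNat] at h
    simpa only [ofReal_norm] using h
  have hSpos : volume S ≠ 0 := by
    refine (lt_of_lt_of_le ?_ hS.vol).ne'
    rw [ENNReal.ofReal_pos]; positivity
  have hSne : S.Nonempty := nonempty_of_measure_ne_zero hSpos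
  -- With μ = 0 and l = 1 the defining property puts ξ + S into the compact set Ω. Finiteness allows
  -- division by the volume at the end.
  have hSfin : volume S ≠ ∞ := by
    have hsub : S ⊆ (fun s => ξ + s) ⁻¹' Ω := by
      intro s hs
      have := hS.mem s hs 0 ⟨le_rfl, hr0.le⟩ 1 ⟨zero_le_one, by nlinarith⟩ (by simpa using hξ)
      simpa using this
    refine ((measure_mono hsub).trans_lt ?_).ne
    rw [measure_preimage_add]
    exact hΩ.measure_lt_top
  -- For q = ∞ the local modulus is a true supremum, so a single step s suffices and f need not be
  -- measurable.
  rcases eq_or_ne q ∞ with hq | hq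
  · obtain ⟨s, hs⟩ := hSne
    refine (hpt s).trans ?_
    have hloc : ∀ x : Euc (d + 1), ∀ η ∈ rhoBall Ω x δ,
        ‖finDiffOn r ((r : ℝ)⁻¹ • (η - x)) f Ω x‖ₑ ≤ localModulus r Ω f x δ q := by
      intro x η hη
      rw [localModulus, if_pos hq]
      exact le_iSup₂ (f := fun η (_ : η ∈ rhoBall Ω x δ) =>
        ‖finDiffOn r ((r : ℝ)⁻¹ • (η - x)) f Ω x‖ₑ) η hη
    rw [hC, if_pos hq, mul_assoc]
    gcongr
    have h1 : ∑ j ∈ Finset.range r, ‖finDiff r (v + ((j + 1 : ℕ) : ℝ) • s) f ξ‖ₑ ≤ r * W₀ := by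
      refine (Finset.sum_le_card_nsmul _ _ W₀ fun j hj => ?_).trans (by simp)
      rw [(hA s hs j hj).2]
      exact (hloc _ _ (hA s hs j hj).1).trans hW0
    have h2 : ∑ j ∈ Finset.range r, ‖finDiff r (((j + 1 : ℕ) : ℝ) • s) f
        (ξ + ((j + 1 : ℕ) : ℝ) • v)‖ₑ ≤ r * W₀ := by
      refine (Finset.sum_le_card_nsmul _ _ W₀ fun j hj => ?_).trans (by simp)
      rw [(hB s hs j hj).2]
      exact (hloc _ _ (hB s hs j hj).1).trans (hWj j hj)
    calc _ ≤ (r : ℝ≥0∞) * W₀ + r * W₀ := add_le_add h1 h2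
      _ = _ := by ring
  · have hfm : Measurable f := hf.resolve_left hq
    set q' := q.toReal with hq'
    have hq'0 : 0 < q' := ENNReal.toReal_pos hq0.ne' hq
    have hGm : ∀ x : Euc (d + 1), Measurable fun η => (rhoBall Ω x δ).indicator
        (fun η => ‖finDiffOn r ((r : ℝ)⁻¹ • (η - x)) f Ω x‖ₑ ^ q') η := fun x =>
      ((measurable_finDiffOn r hΩ.isClosed hfm (by fun_prop)
        measurable_const).enorm.pow_const _).indicator (measurableSet_rhoBall hΩ.isClosed x δ)
    -- Substituting the end point η = y + ls for s turns the mean over S into one over the Ivanov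
    -- ball about x. It is applied with l = r(j + 1) ≥ 1.
    have hint : ∀ (x y : Euc (d + 1)) (l : ℝ) (g : Euc (d + 1) → ℝ), 1 ≤ l →
        localModulus r Ω f x δ q ≤ W₀ → volume (rhoBall Ω x δ) ≤ C' * volume S →
        (∀ s ∈ S, y + l • s ∈ rhoBall Ω x δ ∧
          g s = finDiffOn r ((r : ℝ)⁻¹ • (y + l • s - x)) f Ω x) →
        ∫⁻ s in S, ‖g s‖ₑ ^ q' ≤ C' * volume S * W₀ ^ q' := by
      intro x y l g hl hle hv hg
      calc ∫⁻ s in S, ‖g s‖ₑ ^ q' ≤ ∫⁻ s in S, (rhoBall Ω x δ).indicator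
            (fun η => ‖finDiffOn r ((r : ℝ)⁻¹ • (η - x)) f Ω x‖ₑ ^ q') (y + l • s) := by
            refine setLIntegral_mono' hS.meas fun s hs => ?_
            rw [indicator_of_mem (hg s hs).1, (hg s hs).2]
        _ ≤ ∫⁻ s, (rhoBall Ω x δ).indicator
            (fun η => ‖finDiffOn r ((r : ℝ)⁻¹ • (η - x)) f Ω x‖ₑ ^ q') (y + l • s) :=
            setLIntegral_le_lintegral _ _
        _ ≤ ∫⁻ η, (rhoBall Ω x δ).indicator
            (fun η => ‖finDiffOn r ((r : ℝ)⁻¹ • (η - x)) f Ω x‖ₑ ^ q') η :=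
            lintegral_comp_affine_le (hGm x) y hl
        _ = ∫⁻ η in rhoBall Ω x δ, ‖finDiffOn r ((r : ℝ)⁻¹ • (η - x)) f Ω x‖ₑ ^ q' :=
            lintegral_indicator (measurableSet_rhoBall hΩ.isClosed x δ) _
        _ ≤ volume (rhoBall Ω x δ) * localModulus r Ω f x δ q ^ q' :=
            lintegral_rhoBall_le_localModulus r f x δ hq0 hq hΩ
        _ ≤ _ := by gcongr
    have h1 : ∀ j ∈ Finset.range r, ∫⁻ s in S,
        ‖finDiff r (v + ((j + 1 : ℕ) : ℝ) • s) f ξ‖ₑ ^ q' ≤ C' * volume S * W₀ ^ q' := by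
      intro j hj
      refine hint ξ (ξ + (r : ℝ) • v) (r * ((j + 1 : ℕ) : ℝ)) _ ?_ hW0 ?_ ?_
      · exact one_le_mul_of_one_le_of_one_le hr1 (hcast j hj).1
      · have := hvol 0 (by omega)
        simpa using this
      · intro s hs
        have e : ξ + (r : ℝ) • v + (r * ((j + 1 : ℕ) : ℝ)) • s =
          ξ + (r : ℝ) • (v + ((j + 1 : ℕ) : ℝ) • s) := by module
        rw [e]
        exact hA s hs j hj
    have h2 : ∀ j ∈ Finset.range r, ∫⁻ s in S, ‖finDiff r (((j + 1 : ℕ) : ℝ) • s) f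
        (ξ + ((j + 1 : ℕ) : ℝ) • v)‖ₑ ^ q' ≤ C' * volume S * W₀ ^ q' := by
      intro j hj
      refine hint (ξ + ((j + 1 : ℕ) : ℝ) • v) (ξ + ((j + 1 : ℕ) : ℝ) • v)
        (r * ((j + 1 : ℕ) : ℝ)) _ ?_ (hWj j hj) ?_ (fun s hs => hB s hs j hj)
      · exact one_le_mul_of_one_le_of_one_le hr1 (hcast j hj).1
      · exact hvol (j + 1) (by have := Finset.mem_range.mp hj; omega)
    have hm1 : ∀ j ∈ Finset.range r, Measurable fun s : Euc (d + 1) =>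
        ‖finDiff r (v + ((j + 1 : ℕ) : ℝ) • s) f ξ‖ₑ ^ q' := fun j _ =>
      (measurable_finDiff r hfm (by fun_prop) measurable_const).enorm.pow_const _
    have hm2 : ∀ j ∈ Finset.range r, Measurable fun s : Euc (d + 1) =>
        ‖finDiff r (((j + 1 : ℕ) : ℝ) • s) f (ξ + ((j + 1 : ℕ) : ℝ) • v)‖ₑ ^ q' := fun j _ =>
      (measurable_finDiff r hfm (by fun_prop) measurable_const).enorm.pow_const _
    set B := c₁ ^ q' * (2 ^ q' * (r : ℝ≥0∞) ^ q') with hBdef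
    have hptq : ∀ s : Euc (d + 1), ‖finDiff r v f ξ‖ₑ ^ q' ≤
        B * (∑ j ∈ Finset.range r, ‖finDiff r (v + ((j + 1 : ℕ) : ℝ) • s) f ξ‖ₑ ^ q' +
          ∑ j ∈ Finset.range r,
            ‖finDiff r (((j + 1 : ℕ) : ℝ) • s) f (ξ + ((j + 1 : ℕ) : ℝ) • v)‖ₑ ^ q') := by
      intro s
      have k1 := sum_rpow_le_card_rpow_mul_sum (Finset.range r)
        (fun j => ‖finDiff r (v + ((j + 1 : ℕ) : ℝ) • s) f ξ‖ₑ) hq'0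
      have k2 := sum_rpow_le_card_rpow_mul_sum (Finset.range r) (fun j =>
        ‖finDiff r (((j + 1 : ℕ) : ℝ) • s) f (ξ + ((j + 1 : ℕ) : ℝ) • v)‖ₑ) hq'0
      have k3 : ∀ a b : ℝ≥0∞, (a + b) ^ q' ≤ 2 ^ q' * (a ^ q' + b ^ q') := by
        intro a b
        have := sum_rpow_le_card_rpow_mul_sum (Finset.univ : Finset (Fin 2)) ![a, b] hq'0
        simpa using this
      rw [Finset.card_range] at k1 k2
      refine (ENNReal.rpow_le_rpow (hpt s) hq'0.le).trans ?_
      rw [ENNReal.mul_rpow_of_nonneg _ _ hq'0.le]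
      refine (mul_le_mul' le_rfl ((k3 _ _).trans (mul_le_mul' le_rfl (add_le_add k1 k2)))).trans
        (le_of_eq ?_)
      rw [hBdef]; ring
    have hBt : B ≠ ∞ := by rw [hBdef]; finiteness
    have hfinal : ‖finDiff r v f ξ‖ₑ ^ q' * volume S ≤ (B * (2 * r * C')) * W₀ ^ q' * volume S := by
      calc ‖finDiff r v f ξ‖ₑ ^ q' * volume S = ∫⁻ _ in S, ‖finDiff r v f ξ‖ₑ ^ q' := by
            rw [setLIntegral_const]
        _ ≤ ∫⁻ s in S, B * (∑ j ∈ Finset.range r,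
              ‖finDiff r (v + ((j + 1 : ℕ) : ℝ) • s) f ξ‖ₑ ^ q' +
            ∑ j ∈ Finset.range r, ‖finDiff r (((j + 1 : ℕ) : ℝ) • s) f
              (ξ + ((j + 1 : ℕ) : ℝ) • v)‖ₑ ^ q') := lintegral_mono fun s => hptq s
        _ = B * (∑ j ∈ Finset.range r, (∫⁻ s in S,
              ‖finDiff r (v + ((j + 1 : ℕ) : ℝ) • s) f ξ‖ₑ ^ q') +
            ∑ j ∈ Finset.range r, ∫⁻ s in S, ‖finDiff r (((j + 1 : ℕ) : ℝ) • s) f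
              (ξ + ((j + 1 : ℕ) : ℝ) • v)‖ₑ ^ q') := by
            rw [lintegral_const_mul' _ _ hBt, lintegral_add_left (Finset.measurable_fun_sum _ hm1),
              lintegral_finsetSum _ hm1, lintegral_finsetSum _ hm2]
        _ ≤ B * (r * (C' * volume S * W₀ ^ q') + r * (C' * volume S * W₀ ^ q')) := by
            gcongr
            · exact (Finset.sum_le_card_nsmul _ _ _ h1).trans (by simp)
            · exact (Finset.sum_le_card_nsmul _ _ _ h2).trans (by simp)
        _ = _ := by ring
    have hcancel : ‖finDiff r v f ξ‖ₑ ^ q' ≤ (B * (2 * r * C')) * W₀ ^ q' :=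
      (ENNReal.mul_le_mul_iff_left hSpos hSfin).mp hfinal
    have hroot := ENNReal.rpow_le_rpow hcancel (by positivity : 0 ≤ 1 / q')
    rw [← ENNReal.rpow_mul, mul_one_div_cancel hq'0.ne', ENNReal.rpow_one,
      ENNReal.mul_rpow_of_nonneg _ _ (by positivity), ← ENNReal.rpow_mul,
      mul_one_div_cancel hq'0.ne', ENNReal.rpow_one] at hroot
    rw [hC, if_neg hq]
    exact hroot

end Pointwise

end IvanovModuli

/-! ### The pointwise bound for all t in (0, 1] -/

namespace IvanovModuli

variable {d : ℕ} {Ω : Set (Euc (d + 1))}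

lemma exists_rho_bound (hΩ : IsCompact Ω) : ∃ B : ℝ, 0 < B ∧ ∀ x ∈ Ω, ∀ y ∈ Ω, rho Ω x y ≤ B := by
  obtain ⟨B, hB⟩ := ((hΩ.prod hΩ).image (continuous_rho Ω)).isBounded.bddAbove
  exact ⟨max B 1, by positivity, fun x hx y hy =>
    (hB ⟨(x, y), ⟨hx, hy⟩, rfl⟩).trans (le_max_left _ _)⟩

lemma IsAveragingSet.mono_const {r : ℝ} {ξ v : Euc (d + 1)} {t c c' : ℝ} {S : Set (Euc (d + 1))}
    (h : IsAveragingSet Ω r ξ v t c S) (hc : c' ≤ c) (ht : 0 ≤ t) :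
    IsAveragingSet Ω r ξ v t c' S := by
  refine ⟨h.meas, (ENNReal.ofReal_le_ofReal ?_).trans h.vol, h.mem⟩
  have := Real.sqrt_nonneg (Metric.infDist ξ (frontier Ω))
  gcongr

/-- The data of the previous two constructions combined. -/
lemma exists_averagingSet {ε M Λ κ : ℝ} (hΩ : IsCompact Ω) (hA : HasGraphCharts Ω ε M Λ κ)
    (hs : IsSmallScale ε M Λ κ) (hΓ : (frontier Ω).Nonempty) {r K : ℝ} (hr : 1 ≤ r) (hK : 1 ≤ K) :
    ∃ t₀ c C : ℝ, 0 < t₀ ∧ 0 < c ∧ 0 < C ∧ ∀ ξ ∈ Ω, ∀ t ∈ Ioc 0 t₀, ∀ v : Euc (d + 1),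
      ‖v‖ ≤ K * t → (∃ S, IsAveragingSet Ω r ξ v t c S) ∧
      ((Metric.infDist ξ (frontier Ω) ≤ κ → ∃ (ψ : Euc (d + 1) → ℝ) (k : Fin (d + 1)) (σ : ℝ),
        |σ| = 1 ∧ IsGraphChartAt Ω ψ (EuclideanSpace.single k σ) ε M Λ ξ ∧
        |fderiv ℝ ψ ξ v| ≤ K * t * (Real.sqrt (Metric.infDist ξ (frontier Ω)) + t)) →
        ∃ S, IsAveragingSet Ω r ξ v t c S ∧ ∀ s ∈ S, ∀ μ ∈ Icc (0 : ℝ) r,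
          ∀ l ∈ Icc (0 : ℝ) (r ^ 2), rho Ω ξ (ξ + (μ • v + l • s)) ≤ C * t) := by
  obtain ⟨t₁, c₁, C₁, ht₁, hc₁, hC₁, h₁⟩ := exists_averagingSet_near hs hΓ hr hK
  obtain ⟨t₂, c₂, C₂, ht₂, hc₂, hC₂, h₂⟩ := exists_averagingSet_interior hΩ hs.pos hr hK
  refine ⟨min t₁ t₂, min c₁ c₂, max C₁ C₂, by positivity, by positivity, by positivity, ?_⟩
  intro ξ hξ t ht v hv
  have ht1 : t ∈ Ioc 0 t₁ := ⟨ht.1, ht.2.trans (min_le_left _ _)⟩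
  have ht2 : t ∈ Ioc 0 t₂ := ⟨ht.1, ht.2.trans (min_le_right _ _)⟩
  have m1 : C₁ * t ≤ max C₁ C₂ * t := mul_le_mul_of_nonneg_right (le_max_left _ _) ht.1.le
  have m2 : C₂ * t ≤ max C₁ C₂ * t := mul_le_mul_of_nonneg_right (le_max_right _ _) ht.1.le
  rcases le_or_gt (Metric.infDist ξ (frontier Ω)) κ with hn | hf
  · constructor
    · obtain ⟨ψ, k, σ, hσ, H⟩ := hA ξ hξ hn
      obtain ⟨S, hS, -⟩ := h₁ ψ k σ ξ hσ H hn t ht1 v hv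
      exact ⟨S, hS.mono_const (min_le_left _ _) ht.1.le⟩
    · intro h
      obtain ⟨ψ, k, σ, hσ, H, hβ⟩ := h hn
      obtain ⟨S, hS, hS'⟩ := h₁ ψ k σ ξ hσ H hn t ht1 v hv
      exact ⟨S, hS.mono_const (min_le_left _ _) ht.1.le,
        fun s hs μ hμ l hl => (hS' hβ s hs μ hμ l hl).trans m1⟩
  · obtain ⟨S, hS, hS'⟩ := h₂ ξ hξ hf t ht2 v hv
    have hS2 := hS.mono_const (min_le_right c₁ c₂) ht.1.le
    exact ⟨⟨S, hS2⟩, fun _ => ⟨S, hS2, fun s hs μ hμ l hl => (hS' s hs μ hμ l hl).trans m2⟩⟩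

lemma mem_of_segment_subset {r : ℝ} (hr : 0 < r) {ξ v : Euc (d + 1)}
    (h : segment ℝ ξ (ξ + r • v) ⊆ Ω) {μ : ℝ} (hμ : μ ∈ Icc 0 r) : ξ + μ • v ∈ Ω := by
  have := segment_add_subset_iff.mp h (μ / r) ⟨div_nonneg hμ.1 hr.le, (div_le_one hr).mpr hμ.2⟩
  rwa [smul_smul, div_mul_cancel₀ _ hr.ne'] at this

/-- The nodes ξ + (k/N)v include both the integer nodes needed for small t and the nodes of the
short steps v/N used for large t. Both c₀ and N are chosen before q. -/
theorem exists_enorm_finDiff_le_sum_localModulus {ε M Λ κ : ℝ} (hΩ : IsCompact Ω)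
    (hA : HasGraphCharts Ω ε M Λ κ) (hs : IsSmallScale ε M Λ κ) (hΓ : (frontier Ω).Nonempty)
    {r : ℕ} (hr : 1 ≤ r) {K t₁ : ℝ} (hK : 1 ≤ K) (ht₁ : 0 < t₁) :
    ∃ (c₀ : ℝ) (N : ℕ), 1 < c₀ ∧ 1 ≤ N ∧ ∀ q : ℝ≥0∞, 0 < q → ∃ C : ℝ≥0∞, C ≠ ∞ ∧
      ∀ f : Euc (d + 1) → ℝ, (q = ∞ ∨ Measurable f) → ∀ ξ ∈ Ω, ∀ t ∈ Ioc (0 : ℝ) 1,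
      ∀ v : Euc (d + 1), ‖v‖ ≤ K * t → segment ℝ ξ (ξ + (r : ℝ) • v) ⊆ Ω →
      (t ≤ t₁ → Metric.infDist ξ (frontier Ω) ≤ κ →
        ∃ (ψ : Euc (d + 1) → ℝ) (k : Fin (d + 1)) (σ : ℝ),
        |σ| = 1 ∧ IsGraphChartAt Ω ψ (EuclideanSpace.single k σ) ε M Λ ξ ∧
        |fderiv ℝ ψ ξ v| ≤ K * t * (Real.sqrt (Metric.infDist ξ (frontier Ω)) + t)) →
      ‖finDiff r v f ξ‖ₑ ≤ C * ∑ k ∈ Finset.range (r * N + 1),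
        localModulus r Ω f (ξ + ((k : ℝ) / N) • v) (c₀ * t) q := by
  have hr0 : (0 : ℝ) < r := by exact_mod_cast hr
  have hr1 : (1 : ℝ) ≤ r := by exact_mod_cast hr
  obtain ⟨t₂, c, C₁, ht₂, hc, hC₁, hset⟩ := exists_averagingSet hΩ hA hs hΓ hr1 hK
  obtain ⟨B, hB0, hB⟩ := exists_rho_bound hΩ
  set t₀ := min (min t₁ t₂) 1 with ht₀
  have ht₀0 : 0 < t₀ := by positivity
  -- 2C₁ covers the passage from one node to another through ξ, B/t₀ makes c₀t at least the
  -- `rho`-diameter bound B of Ω once t > t₀, and 2 ensures c₀ > 1.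
  set c₀ := 2 + 2 * C₁ + B / t₀ with hc₀
  have hBt : 0 < B / t₀ := by positivity
  have hc₀0 : 0 < c₀ := by positivity
  obtain ⟨C₂, hC₂, hvol⟩ := volume_rhoBall_le hΩ hA hs hΓ hc₀0
  obtain ⟨N, hN⟩ := exists_nat_gt (1 / t₀)
  have hN0 : (0 : ℝ) < N := lt_trans (by positivity) hN
  have hN1 : 1 ≤ N := by exact_mod_cast hN0
  refine ⟨c₀, N, by linarith, hN1, fun q hq0 => ?_⟩
  obtain ⟨D₁, hD₁, hav₁⟩ := exists_enorm_finDiff_le hΩ hr hq0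
    (C' := ENNReal.ofReal (C₂ * (1 + C₁) / c)) ENNReal.ofReal_ne_top
  obtain ⟨D₂, hD₂, hav₂⟩ := exists_enorm_finDiff_le hΩ hr hq0
    (C' := ENNReal.ofReal ((volume Ω).toReal / (c * (t₀ ^ (d + 1) * t₀)))) ENNReal.ofReal_ne_top
  obtain ⟨b, hb⟩ := exists_finDiff_split (V := Euc (d + 1)) r N hN1
  set D₃ : ℝ≥0∞ := ∑ k ∈ Finset.range (r * (N - 1) + 1), ‖b k‖ₑ with hD₃
  have hD₃t : D₃ ≠ ∞ := ENNReal.sum_ne_top.mpr fun k _ => enorm_ne_top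
  refine ⟨D₁ + D₃ * D₂, by finiteness, fun f hf ξ hξ t ht v hv hseg hadm => ?_⟩
  set W := ∑ k ∈ Finset.range (r * N + 1),
        localModulus r Ω f (ξ + ((k : ℝ) / N) • v) (c₀ * t) q with hW
  have hterm : ∀ k ≤ r * N, localModulus r Ω f (ξ + ((k : ℝ) / N) • v) (c₀ * t) q ≤ W :=
    fun k hk => Finset.single_le_sum
      (f := fun k : ℕ => localModulus r Ω f (ξ + ((k : ℝ) / N) • v) (c₀ * t) q)
      (fun _ _ => zero_le) (Finset.mem_range.mpr (Nat.lt_succ_of_le hk))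
  rcases le_or_gt t t₀ with hsmall | hlarge
  · -- small parameters: one averaging step
    have htt₁ : t ≤ t₁ := hsmall.trans ((min_le_left _ _).trans (min_le_left _ _))
    have htt₂ : t ≤ t₂ := hsmall.trans ((min_le_left _ _).trans (min_le_right _ _))
    obtain ⟨S, hS, hSd⟩ := (hset ξ hξ t ⟨ht.1, htt₂⟩ v hv).2 (hadm htt₁)
    have hSne : S.Nonempty := by
      refine nonempty_of_measure_ne_zero (μ := volume) (lt_of_lt_of_le ?_ hS.vol).ne'
      rw [ENNReal.ofReal_pos]
      have := Real.sqrt_nonneg (Metric.infDist ξ (frontier Ω))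
      have := ht.1
      positivity
    obtain ⟨s₀, hs₀⟩ := hSne
    have hnode : ∀ μ ∈ Icc (0 : ℝ) r, rho Ω ξ (ξ + μ • v) ≤ C₁ * t := by
      intro μ hμ
      have := hSd s₀ hs₀ μ hμ 0 ⟨le_rfl, by positivity⟩
      rwa [zero_smul, add_zero] at this
    have main := hav₁ f hf ξ v t c (c₀ * t) S ht.1 hc hξ hseg hS ?_ ?_
    · refine main.trans ?_
      -- The integer nodes are those with k = iN.
      have hsub : ∑ i ∈ Finset.range (r + 1), localModulus r Ω f (ξ + (i : ℝ) • v) (c₀ * t) q ≤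
          W := by
        rw [hW]
        have hinj : Set.InjOn (fun i : ℕ => i * N) (Finset.range (r + 1)) := fun i _ j _ h =>
          Nat.eq_of_mul_eq_mul_right hN1 h
        calc _ = ∑ i ∈ Finset.range (r + 1),
              localModulus r Ω f (ξ + (((i * N : ℕ) : ℝ) / N) • v) (c₀ * t) q := by
              refine Finset.sum_congr rfl fun i _ => ?_
              rw [Nat.cast_mul, mul_div_cancel_right₀ _ hN0.ne']
          _ = ∑ k ∈ (Finset.range (r + 1)).image (fun i => i * N),
              localModulus r Ω f (ξ + ((k : ℝ) / N) • v) (c₀ * t) q :=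
              (Finset.sum_image (f := fun k : ℕ =>
                localModulus r Ω f (ξ + ((k : ℝ) / N) • v) (c₀ * t) q) hinj).symm
          _ ≤ _ := by
              refine Finset.sum_le_sum_of_subset fun k hk => ?_
              obtain ⟨i, hi, rfl⟩ := Finset.mem_image.mp hk
              have hi' := Nat.lt_succ_iff.mp (Finset.mem_range.mp hi)
              exact Finset.mem_range.mpr (Nat.lt_succ_of_le (Nat.mul_le_mul_right N hi'))
      calc _ ≤ D₁ * W := by gcongr
        _ ≤ _ := by gcongr; exact le_self_add
    · intro s hsS μ hμ μ' hμ' l hl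
      have h1 := hnode μ hμ
      have h2 := hSd s hsS μ' hμ' l hl
      have h3 := rho_triangle Ω (ξ + μ • v) ξ (ξ + (μ' • v + l • s))
      rw [rho_comm Ω (ξ + μ • v) ξ] at h3
      have h4 : 0 < (2 + B / t₀) * t := mul_pos (by positivity) ht.1
      rw [hc₀]
      linarith
    · intro i hi
      have hiI : (i : ℝ) ∈ Icc (0 : ℝ) r := ⟨Nat.cast_nonneg _, by exact_mod_cast hi⟩
      have hx := mem_of_segment_subset hr0 hseg hiI
      refine (hvol _ hx t ht).trans ?_
      refine le_trans ?_ (mul_le_mul' le_rfl hS.vol)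
      have h1 := hnode _ hiI
      rw [rho] at h1
      have h2 := (abs_le.mp (le_refl |Real.sqrt (Metric.infDist ξ (frontier Ω)) -
        Real.sqrt (Metric.infDist (ξ + (i : ℝ) • v) (frontier Ω))|)).1
      have h3 := norm_nonneg (ξ - (ξ + (i : ℝ) • v))
      have ht0 := ht.1
      have hx0 := Real.sqrt_nonneg (Metric.infDist ξ (frontier Ω))
      set x := Real.sqrt (Metric.infDist ξ (frontier Ω))
      rw [← ENNReal.ofReal_mul (by positivity)]
      refine ENNReal.ofReal_le_ofReal ?_
      -- All nodes are within C₁t of ξ in `rho`, so the weights √ρ + t at the nodes are controlled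
      -- by the one at ξ, to which the volume of S refers.
      have h4 : Real.sqrt (Metric.infDist (ξ + (i : ℝ) • v) (frontier Ω)) + t ≤
          (1 + C₁) * (x + t) := by nlinarith
      calc _ ≤ C₂ * (t ^ (d + 1) * ((1 + C₁) * (x + t))) := by gcongr
        _ = _ := by field_simp
  · -- large parameters: split into short steps
    -- Since 1/N < t₀, the step w is short enough for an averaging set at the fixed scale t₀, while
    -- the local moduli keep the radius c₀t.
    set w : Euc (d + 1) := ((N : ℝ)⁻¹) • v with hw
    have hNw : (N : ℝ) • w = v := by rw [hw, smul_smul, mul_inv_cancel₀ hN0.ne', one_smul]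
    have hwn : ‖w‖ ≤ K * t₀ := by
      rw [hw, norm_smul, norm_inv, Real.norm_natCast]
      have h1 : (N : ℝ)⁻¹ ≤ t₀ := by
        rw [inv_le_comm₀ hN0 ht₀0, ← one_div]; exact hN.le
      have h2 : ‖v‖ ≤ K := hv.trans (mul_le_of_le_one_right (by linarith) ht.2)
      rw [mul_comm K]
      exact mul_le_mul h1 h2 (norm_nonneg _) ht₀0.le
    have hkw : ∀ k : ℕ, (k : ℝ) • w = ((k : ℝ) / N) • v := fun k => by
      rw [hw, smul_smul, div_eq_mul_inv]
    have hshort : ∀ k ∈ Finset.range (r * (N - 1) + 1),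
        ‖finDiff r w f (ξ + (k : ℝ) • w)‖ₑ ≤ D₂ * W := by
      intro k hk
      have hk' := Nat.lt_succ_iff.mp (Finset.mem_range.mp hk)
      have hkr : k + r ≤ r * N := by
        calc k + r ≤ r * (N - 1) + r := by omega
          _ = r * N := by rw [← Nat.mul_succ]; congr 1; omega
      have hin : ∀ μ ∈ Icc (0 : ℝ) r, ξ + (k : ℝ) • w + μ • w ∈ Ω := by
        intro μ hμ
        have e : ξ + (k : ℝ) • w + μ • w = ξ + ((k + μ) / N) • v := by
          rw [hw]; module
        rw [e]
        refine mem_of_segment_subset hr0 hseg ⟨div_nonneg (by linarith [hμ.1,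
          (Nat.cast_nonneg k : (0 : ℝ) ≤ k)]) hN0.le, ?_⟩
        rw [div_le_iff₀ hN0]
        have : ((k + r : ℕ) : ℝ) ≤ ((r * N : ℕ) : ℝ) := by exact_mod_cast hkr
        push_cast at this
        linarith [hμ.2]
      have hx : ξ + (k : ℝ) • w ∈ Ω := by
        simpa using hin 0 ⟨le_rfl, hr0.le⟩
      have hsegk : segment ℝ (ξ + (k : ℝ) • w) (ξ + (k : ℝ) • w + (r : ℝ) • w) ⊆ Ω := by
        refine segment_add_subset_iff.mpr fun θ hθ => ?_
        have := hin (θ * r) ⟨mul_nonneg hθ.1 hr0.le, mul_le_of_le_one_left hr0.le hθ.2⟩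
        rwa [mul_smul] at this
      have htt₂ : t₀ ≤ t₂ := (min_le_left _ _).trans (min_le_right _ _)
      obtain ⟨S, hS⟩ := (hset _ hx t₀ ⟨ht₀0, htt₂⟩ w hwn).1
      have main := hav₂ f hf (ξ + (k : ℝ) • w) w t₀ c (c₀ * t) S ht₀0 hc hx hsegk hS ?_ ?_
      · refine main.trans ?_
        gcongr
        have hr' : r + 1 + k ≤ r * N + 1 := by omega
        calc ∑ i ∈ Finset.range (r + 1),
              localModulus r Ω f (ξ + (k : ℝ) • w + (i : ℝ) • w) (c₀ * t) q
            = ∑ i ∈ Finset.range (r + 1),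
              localModulus r Ω f (ξ + (((i + k : ℕ) : ℝ) / N) • v) (c₀ * t) q := by
              refine Finset.sum_congr rfl fun i _ => ?_
              rw [← hkw]; congr 1; push_cast; module
          _ = ∑ j ∈ (Finset.range (r + 1)).image (fun i => i + k),
              localModulus r Ω f (ξ + ((j : ℝ) / N) • v) (c₀ * t) q :=
              (Finset.sum_image (f := fun k : ℕ =>
                localModulus r Ω f (ξ + ((k : ℝ) / N) • v) (c₀ * t) q)
                fun i _ j _ h => Nat.add_right_cancel h).symm
          _ ≤ _ := by
              refine Finset.sum_le_sum_of_subset fun j hj => ?_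
              obtain ⟨i, hi, rfl⟩ := Finset.mem_image.mp hj
              have hi' := Finset.mem_range.mp hi
              exact Finset.mem_range.mpr (by omega)
      · intro s hsS μ hμ μ' hμ' l hl
        have h1 := hS.mem s hsS μ' hμ' l hl (hin μ' hμ')
        rw [add_assoc _ (μ' • w)] at h1
        refine (hB _ (hin μ hμ) _ h1).trans ?_
        -- At this radius the Ivanov ball is all of Ω, so membership in Ω replaces any
        -- almost-tangency of w.
        have h2 : B ≤ B / t₀ * t := by
          rw [div_mul_eq_mul_div, le_div_iff₀ ht₀0]; gcongr
        have h3 : 0 < (2 + 2 * C₁) * t := mul_pos (by positivity) ht.1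
        rw [hc₀]; linarith
      · intro i _
        have h1 : volume (rhoBall Ω (ξ + (k : ℝ) • w + (i : ℝ) • w) (c₀ * t)) ≤ volume Ω :=
          measure_mono fun η hη => hη.1
        refine h1.trans ?_
        refine le_trans ?_ (mul_le_mul' le_rfl hS.vol)
        rw [← ENNReal.ofReal_mul (by positivity)]
        conv_lhs => rw [← ENNReal.ofReal_toReal hΩ.measure_lt_top.ne]
        refine ENNReal.ofReal_le_ofReal ?_
        have hx0 := Real.sqrt_nonneg (Metric.infDist (ξ + (k : ℝ) • w) (frontier Ω))
        calc (volume Ω).toReal = (volume Ω).toReal / (c * (t₀ ^ (d + 1) * t₀)) *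
              (c * (t₀ ^ (d + 1) * (0 + t₀))) := by field_simp; ring
          _ ≤ _ := by gcongr
    rw [← hNw, hb]
    calc ‖∑ k ∈ Finset.range (r * (N - 1) + 1), b k * finDiff r w f (ξ + (k : ℝ) • w)‖ₑ
        ≤ ∑ k ∈ Finset.range (r * (N - 1) + 1), ‖b k * finDiff r w f (ξ + (k : ℝ) • w)‖ₑ :=
          enorm_sum_le _ _
      _ ≤ ∑ k ∈ Finset.range (r * (N - 1) + 1), ‖b k‖ₑ * (D₂ * W) := by
          refine Finset.sum_le_sum fun k hk => ?_
          rw [enorm_mul]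
          gcongr
          exact hshort k hk
      _ = D₃ * D₂ * W := by rw [← Finset.sum_mul, mul_assoc]
      _ ≤ _ := by gcongr; exact le_add_self

end IvanovModuli

/-! ### Charts supplied by the attached domains -/

namespace IvanovModuli

namespace SpecialDomain

variable {d : ℕ} (G : SpecialDomain d)

lemma toNormal_apply (z : Euc (d + 1)) (i : Fin (d + 1)) :
    G.toNormal z i = (if G.down ∧ Equiv.swap G.dir (Fin.last d) i = G.dir then -1 else 1) *
      z (Equiv.swap G.dir (Fin.last d) i) - G.shift i := by
  cases h : G.down
  · simp [toNormal, h, swapLast]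
  · by_cases hi : Equiv.swap G.dir (Fin.last d) i = G.dir
    · simp [toNormal, h, swapLast, negCoord, hi]
    · simp [toNormal, h, swapLast, negCoord, hi]

/-- The linear part of the motion to the normal form. -/
noncomputable def linPart : Euc (d + 1) ≃ₗᵢ[ℝ] Euc (d + 1) :=
  LinearIsometry.toLinearIsometryEquiv
    { toFun := fun z => G.toNormal z + G.shift
      map_add' := fun z w => by
        ext i; simp only [PiLp.add_apply, toNormal_apply]; ring
      map_smul' := fun c z => by
        ext i; simp only [PiLp.add_apply, PiLp.smul_apply, toNormal_apply, smul_eq_mul,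
          RingHom.id_apply]; ring
      norm_map' := fun z => by
        change ‖G.toNormal z + G.shift‖ = ‖z‖
        rw [EuclideanSpace.norm_eq, EuclideanSpace.norm_eq]
        congr 1
        rw [← Equiv.sum_comp (Equiv.swap G.dir (Fin.last d)) fun i => ‖z i‖ ^ 2]
        refine Finset.sum_congr rfl fun i _ => ?_
        simp only [PiLp.add_apply, toNormal_apply, sub_add_cancel]
        split_ifs <;> simp }
    rfl

lemma toNormal_eq (z : Euc (d + 1)) : G.toNormal z = G.linPart z - G.shift :=
  (add_sub_cancel_right (G.toNormal z) G.shift).symm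

lemma ofNormal_eq (z : Euc (d + 1)) : G.ofNormal z = G.linPart.symm (z + G.shift) := by
  rw [LinearIsometryEquiv.eq_symm_apply]
  have := G.toNormal_ofNormal z
  rw [toNormal_eq, sub_eq_iff_eq_add] at this
  exact this

lemma toNormal_add (z w : Euc (d + 1)) : G.toNormal (z + w) = G.toNormal z + G.linPart w := by
  rw [toNormal_eq, toNormal_eq, map_add]; abel

lemma ofNormal_add (z w : Euc (d + 1)) :
    G.ofNormal (z + w) = G.ofNormal z + G.linPart.symm w := by
  rw [ofNormal_eq, ofNormal_eq, ← map_add]; congr 1; abel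

lemma continuous_toNormal : Continuous G.toNormal := by
  have : G.toNormal = fun z => G.linPart z - G.shift := funext G.toNormal_eq
  rw [this]
  exact G.linPart.continuous.sub continuous_const

lemma continuous_ofNormal : Continuous G.ofNormal := by
  have : G.ofNormal = fun z => G.linPart.symm (z + G.shift) := funext G.ofNormal_eq
  rw [this]
  exact G.linPart.symm.continuous.comp (by fun_prop)

lemma mem_image_ofNormal_iff (S : Set (Euc (d + 1))) (z : Euc (d + 1)) :
    z ∈ G.ofNormal '' S ↔ G.toNormal z ∈ S := by
  constructor
  · rintro ⟨w, hw, rfl⟩; rwa [toNormal_ofNormal]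
  · exact fun h => ⟨_, h, G.ofNormal_toNormal z⟩

/-- The sign of the coordinate direction in which the domain is a subgraph. -/
noncomputable def sgn : ℝ := if G.down then -1 else 1

lemma abs_sgn : |G.sgn| = 1 := by
  unfold sgn; split_ifs <;> simp

lemma linPart_apply (z : Euc (d + 1)) (i : Fin (d + 1)) :
    G.linPart z i = (if G.down ∧ Equiv.swap G.dir (Fin.last d) i = G.dir then -1 else 1) *
      z (Equiv.swap G.dir (Fin.last d) i) := by
  have h := congrArg (fun w : Euc (d + 1) => w i) (G.toNormal_eq z)
  simp only [PiLp.sub_apply, toNormal_apply] at h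
  linarith

/-- The signed axis along which the height falls with unit speed, as a chart requires of its
direction. -/
lemma linPart_single :
    G.linPart (EuclideanSpace.single G.dir G.sgn) = EuclideanSpace.single (Fin.last d) 1 := by
  ext i
  rw [linPart_apply]
  by_cases hi : i = Fin.last d
  · subst hi; cases h : G.down <;> simp [sgn, h]
  · have : Equiv.swap G.dir (Fin.last d) i ≠ G.dir := by
      intro h
      apply hi
      rw [Equiv.swap_apply_eq_iff, Equiv.swap_apply_left] at h
      exact h
    simp [this, hi]

/-- The height of the graph above a point: nonnegative on the domain, zero on its essential
boundary. -/
noncomputable def height (z : Euc (d + 1)) : ℝ :=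
  G.g (horiz (G.toNormal z)) - G.toNormal z (Fin.last d)

lemma contDiff_horiz : ContDiff ℝ 2 (horiz : Euc (d + 1) → Euc d) := by
  rw [contDiff_euclidean]
  intro i
  exact (EuclideanSpace.proj i.castSucc : Euc (d + 1) →L[ℝ] ℝ).contDiff

lemma contDiff_toNormal : ContDiff ℝ 2 G.toNormal := by
  have : G.toNormal = fun z => G.linPart z - G.shift := funext G.toNormal_eq
  rw [this]
  exact G.linPart.contDiff.sub contDiff_const

lemma contDiff_height : ContDiff ℝ 2 G.height := by
  refine (G.g_contDiff.comp (contDiff_horiz.comp G.contDiff_toNormal)).sub ?_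
  exact (EuclideanSpace.proj (Fin.last d) : Euc (d + 1) →L[ℝ] ℝ).contDiff.comp G.contDiff_toNormal

lemma continuous_height : Continuous G.height := G.contDiff_height.continuous

lemma height_add_smul (z : Euc (d + 1)) (s : ℝ) :
    G.height (z + s • EuclideanSpace.single G.dir G.sgn) = G.height z - s := by
  have e : G.toNormal (z + s • EuclideanSpace.single G.dir G.sgn) =
      G.toNormal z + s • EuclideanSpace.single (Fin.last d) 1 := by
    rw [toNormal_add, map_smul, linPart_single]
  have h1 : horiz (G.toNormal z + s • EuclideanSpace.single (Fin.last d) 1) =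
      horiz (G.toNormal z) := by
    ext i
    simp [horiz]
  rw [height, height, e, h1]
  simp
  ring

lemma isOpen_openCube (s : ℝ) : IsOpen (openCube d s) := by
  have : openCube d s = ⋂ i, {x | x i ∈ Ioo (-s) s} := by ext; simp [openCube]
  rw [this]
  exact isOpen_iInter_of_finite fun i => isOpen_Ioo.preimage (by fun_prop)

lemma isClosed_closedCube (s : ℝ) : IsClosed (closedCube d s) := by
  have : closedCube d s = ⋂ i, {x | x i ∈ Icc (-s) s} := by ext; simp [closedCube]
  rw [this]
  exact isClosed_iInter fun i => isClosed_Icc.preimage (by fun_prop)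

lemma isBounded_closedCube (s : ℝ) : Bornology.IsBounded (closedCube d s) := by
  refine (Metric.isBounded_iff_subset_closedBall 0).mpr ⟨Real.sqrt (d * s ^ 2), fun x hx => ?_⟩
  rw [mem_closedBall_zero_iff, EuclideanSpace.norm_eq]
  refine Real.sqrt_le_sqrt ?_
  calc ∑ i, ‖x i‖ ^ 2 ≤ ∑ _i : Fin d, s ^ 2 := by
        refine Finset.sum_le_sum fun i _ => ?_
        rw [Real.norm_eq_abs]
        have := abs_le.mpr (hx i)
        gcongr
    _ = d * s ^ 2 := by simp

lemma isCompact_closedCube (s : ℝ) : IsCompact (closedCube d s) :=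
  Metric.isCompact_of_isClosed_isBounded (isClosed_closedCube s) (isBounded_closedCube s)

lemma sInf_le_g {x : Euc d} (hx : x ∈ closedCube d (2 * G.b)) :
    sInf (G.g '' closedCube d (2 * G.b)) ≤ G.g x :=
  csInf_le ((isCompact_closedCube _).image G.g_contDiff.continuous).isBounded.bddBelow
    (mem_image_of_mem _ hx)

lemma openCube_subset_closedCube {s s' : ℝ} (h : s ≤ s') : openCube d s ⊆ closedCube d s' :=
  fun _ hx i => ⟨by linarith [(hx i).1], by linarith [(hx i).2]⟩

/-- An open set in which `Ω` is described by `height`. -/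
def chartSet (lo hi : Fin (d + 1) → ℝ) : Set (Euc (d + 1)) :=
  {z | horiz (G.toNormal z) ∈ openCube d (2 * G.b) ∧
    sInf (G.g '' closedCube d (2 * G.b)) - 4 * G.L * G.b < G.toNormal z (Fin.last d)} ∩
  {z | ∀ i, z i ∈ Ioo (lo i) (hi i)}

lemma isOpen_chartSet (lo hi : Fin (d + 1) → ℝ) : IsOpen (G.chartSet lo hi) := by
  have hT := G.continuous_toNormal
  have hh : Continuous (horiz : Euc (d + 1) → Euc d) := contDiff_horiz.continuous
  refine IsOpen.inter (IsOpen.inter ?_ ?_) ?_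
  · exact (isOpen_openCube _).preimage (hh.comp hT)
  · exact isOpen_lt continuous_const
      ((EuclideanSpace.proj (Fin.last d) : Euc (d + 1) →L[ℝ] ℝ).continuous.comp hT)
  · have : {z : Euc (d + 1) | ∀ i, z i ∈ Ioo (lo i) (hi i)} = ⋂ i, {z | z i ∈ Ioo (lo i) (hi i)} := by
      ext; simp
    rw [this]
    exact isOpen_iInter_of_finite fun i => isOpen_Ioo.preimage (by fun_prop)

variable {G} {Ω : Set (Euc (d + 1))} {lo hi : Fin (d + 1) → ℝ}

lemma mem_star_iff (z : Euc (d + 1)) : z ∈ G.star ↔ G.toNormal z ∈ G.normalStar :=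
  G.mem_image_ofNormal_iff _ z

lemma height_eq_zero_of_mem_closure {z : Euc (d + 1)} (hz : z ∈ closure G.essBdryStar) :
    G.height z = 0 := by
  have hc : IsClosed {z | G.height z = 0} := isClosed_eq G.continuous_height continuous_const
  refine hc.closure_subset_iff.mpr (fun w hw => ?_) hz
  have := (G.mem_image_ofNormal_iff _ w).mp hw
  rw [mem_ofPred_eq, height, this.2, sub_self]

/-- In the chart set all conditions defining the star domain except the one on the height hold, and
inside the box the star domain is Ω. -/
lemma mem_iff_of_mem_chartSet (hbox : G.star = {z | ∀ i, z i ∈ Ioo (lo i) (hi i)} ∩ Ω)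
    {z : Euc (d + 1)} (hz : z ∈ G.chartSet lo hi) : z ∈ Ω ↔ 0 ≤ G.height z := by
  constructor
  · intro h
    have : z ∈ G.star := by rw [hbox]; exact ⟨hz.2, h⟩
    have := ((mem_star_iff z).mp this).2.2
    unfold height; linarith
  · intro h
    have : z ∈ G.star := (mem_star_iff z).mpr ⟨hz.1.1, hz.1.2, by unfold height at h; linarith⟩
    rw [hbox] at this
    exact this.2

lemma frontier_iff_of_mem_chartSet (hΩ : IsClosed Ω)
    (hbox : G.star = {z | ∀ i, z i ∈ Ioo (lo i) (hi i)} ∩ Ω)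
    (hfr : closure G.star ∩ frontier Ω = closure G.essBdryStar)
    {z : Euc (d + 1)} (hz : z ∈ G.chartSet lo hi) : z ∈ frontier Ω ↔ G.height z = 0 := by
  constructor
  · intro h
    have : z ∈ G.star := by rw [hbox]; exact ⟨hz.2, hΩ.frontier_subset h⟩
    apply height_eq_zero_of_mem_closure
    rw [← hfr]
    exact ⟨subset_closure this, h⟩
  · intro h
    have : z ∈ G.essBdryStar := (G.mem_image_ofNormal_iff _ z).mpr
      ⟨hz.1.1, by unfold height at h; linarith⟩
    have := subset_closure this
    rw [← hfr] at this
    exact this.2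

/-- The points of the closure of `G` on the frontier of `Ω` lie in the chart set. -/
lemma closure_carrier_inter_frontier_subset
    (hbox : G.star = {z | ∀ i, z i ∈ Ioo (lo i) (hi i)} ∩ Ω)
    (hfr : closure G.star ∩ frontier Ω = closure G.essBdryStar) :
    closure G.carrier ∩ frontier Ω ⊆ G.chartSet lo hi := by
  have hb := G.b_pos
  have hLb : 0 < G.L * G.b := mul_pos (by linarith [G.one_le_L]) hb
  have hsub : G.carrier ⊆ G.star := by
    intro z hz
    have hz' := (G.mem_image_ofNormal_iff _ z).mp hz
    rw [mem_star_iff]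
    have hx : horiz (G.toNormal z) ∈ openCube d (2 * G.b) := fun i =>
      ⟨by linarith [(hz'.1 i).1], by linarith [(hz'.1 i).2]⟩
    refine ⟨hx, ?_, hz'.2.2⟩
    have := G.sInf_le_g (openCube_subset_closedCube le_rfl hx)
    linarith [hz'.2.1]
  rintro p ⟨hp, hpΓ⟩
  have hpE : p ∈ closure G.essBdryStar := by
    rw [← hfr]; exact ⟨closure_mono hsub hp, hpΓ⟩
  have hh := height_eq_zero_of_mem_closure hpE
  have hcube : horiz (G.toNormal p) ∈ closedCube d G.b := by
    have hc : IsClosed {z : Euc (d + 1) | horiz (G.toNormal z) ∈ closedCube d G.b} :=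
      (isClosed_closedCube _).preimage (contDiff_horiz.continuous.comp G.continuous_toNormal)
    refine hc.closure_subset_iff.mpr (fun w hw => ?_) hp
    exact openCube_subset_closedCube (by linarith) ((G.mem_image_ofNormal_iff _ w).mp hw).1
  have hx : horiz (G.toNormal p) ∈ openCube d (2 * G.b) := fun i =>
    ⟨by linarith [(hcube i).1], by linarith [(hcube i).2]⟩
  have hlow := G.sInf_le_g (openCube_subset_closedCube le_rfl hx)
  unfold height at hh
  have hlow' : sInf (G.g '' closedCube d (2 * G.b)) - 4 * G.L * G.b <
      G.toNormal p (Fin.last d) := by linarith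
  refine ⟨⟨hx, hlow'⟩, ?_⟩
  have : p ∈ G.star := (mem_star_iff p).mpr ⟨hx, hlow', by linarith⟩
  rw [hbox] at this
  exact this.1

/-- A compactness argument: the contact set of the closure of G with the frontier is compact in the
open chart set, and the rest of that closure has positive distance from the frontier. -/
lemma exists_ball_subset_chartSet (hΩ : IsCompact Ω) (hcar : G.carrier ⊆ Ω)
    (hΓ : (frontier Ω).Nonempty)
    (hbox : G.star = {z | ∀ i, z i ∈ Ioo (lo i) (hi i)} ∩ Ω)
    (hfr : closure G.star ∩ frontier Ω = closure G.essBdryStar) :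
    ∃ ε > 0, ∀ z ∈ G.carrier, Metric.infDist z (frontier Ω) < ε →
      Metric.ball z ε ⊆ G.chartSet lo hi := by
  have hcl : IsCompact (closure G.carrier) :=
    hΩ.of_isClosed_subset isClosed_closure (closure_minimal hcar hΩ.isClosed)
  set Kc := closure G.carrier ∩ frontier Ω with hKc
  have hKcc : IsCompact Kc := hcl.inter_right isClosed_frontier
  obtain ⟨δ, hδ, hsub⟩ := hKcc.exists_thickening_subset_open (G.isOpen_chartSet lo hi)
    (closure_carrier_inter_frontier_subset hbox hfr)
  have hK2 : IsCompact (closure G.carrier \ Metric.thickening (δ / 2) Kc) :=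
    hcl.diff Metric.isOpen_thickening
  have hdis : Disjoint (closure G.carrier \ Metric.thickening (δ / 2) Kc) (frontier Ω) := by
    rw [disjoint_left]
    -- A common point would belong to Kc and hence to its thickening.
    rintro z ⟨hz, hz'⟩ hzΓ
    exact hz' (Metric.self_subset_thickening (by positivity) _ ⟨hz, hzΓ⟩)
  obtain ⟨δ₂, hδ₂, hd⟩ := hdis.exists_thickenings hK2 isClosed_frontier
  refine ⟨min (δ / 2) δ₂, by positivity, fun z hz hzε => ?_⟩
  have h1 : z ∈ Metric.thickening δ₂ (frontier Ω) := by
    rw [Metric.mem_thickening_iff]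
    obtain ⟨y, hy, hyd⟩ := (Metric.infDist_lt_iff hΓ).mp hzε
    exact ⟨y, hy, hyd.trans_le (min_le_right _ _)⟩
  have h2 : z ∈ Metric.thickening (δ / 2) Kc := by
    by_contra h
    exact disjoint_left.mp hd (Metric.self_subset_thickening hδ₂ _ ⟨subset_closure hz, h⟩) h1
  obtain ⟨y, hy, hyd⟩ := Metric.mem_thickening_iff.mp h2
  intro w hw
  refine hsub (Metric.mem_thickening_iff.mpr ⟨y, hy, ?_⟩)
  have h3 : dist w z < δ / 2 := (Metric.mem_ball.mp hw).trans_le (min_le_left _ _)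
  linarith [dist_triangle w z y]

end SpecialDomain

lemma exists_fderiv_bounds {n : ℕ} {ψ : Euc n → ℝ} (hψ : ContDiff ℝ 2 ψ) (R : ℝ) :
    ∃ M : ℝ, 0 ≤ M ∧ (∀ z ∈ Metric.closedBall (0 : Euc n) R, ‖fderiv ℝ ψ z‖ ≤ M) ∧
      ∀ z ∈ Metric.closedBall (0 : Euc n) R, ∀ z' ∈ Metric.closedBall (0 : Euc n) R,
        ‖fderiv ℝ ψ z - fderiv ℝ ψ z'‖ ≤ M * ‖z - z'‖ := by
  have h1 : ContDiff ℝ 1 (fderiv ℝ ψ) := hψ.fderiv_right (by norm_num)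
  have hB : IsCompact (Metric.closedBall (0 : Euc n) R) := isCompact_closedBall 0 R
  obtain ⟨M₁, hM₁⟩ := hB.exists_bound_of_continuousOn h1.continuous.continuousOn
  obtain ⟨M₂, hM₂⟩ := hB.exists_bound_of_continuousOn
    (h1.continuous_fderiv one_ne_zero).continuousOn
  refine ⟨max 0 (max M₁ M₂), le_max_left _ _, fun z hz => (hM₁ z hz).trans
    ((le_max_left _ _).trans (le_max_right _ _)), fun z hz z' hz' => ?_⟩
  refine ((convex_closedBall (0 : Euc n) R).norm_image_sub_le_of_norm_fderiv_le (𝕜 := ℝ)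
    (fun x _ => (h1.differentiable one_ne_zero) x) hM₂ hz' hz).trans ?_
  gcongr
  exact (le_max_right _ _).trans (le_max_right _ _)

/-- The second conclusion fixes the chart at points of G i to be the height of that very domain,
because the tangential modulus uses vectors tangent to its graph. -/
theorem exists_graphCharts {d m : ℕ} {G : Fin m → SpecialDomain d} {Ω : Set (Euc (d + 1))}
    (hΩ : IsCompact Ω) (hΓ : (frontier Ω).Nonempty) (hG : IsBoundaryCover G Ω) :
    ∃ ε M : ℝ, 0 < ε ∧ ε ≤ 1 ∧ 1 ≤ M ∧
      (∀ ξ ∈ Ω, Metric.infDist ξ (frontier Ω) < ε → ∃ i, IsGraphChartAt Ω (G i).height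
        (EuclideanSpace.single (G i).dir (G i).sgn) ε M M ξ) ∧
      ∀ i, ∀ ξ ∈ (G i).carrier, Metric.infDist ξ (frontier Ω) < ε → IsGraphChartAt Ω (G i).height
        (EuclideanSpace.single (G i).dir (G i).sgn) ε M M ξ := by
  obtain ⟨hatt, hcov⟩ := hG
  choose hcar hfr lo hi _ hbox using fun i => (hatt i).1
  choose ε₁ hε₁ hball using fun i =>
    SpecialDomain.exists_ball_subset_chartSet hΩ (hcar i) hΓ (hbox i) (hfr i)
  obtain ⟨δ, hδ, hleb⟩ := lebesgue_number_lemma_of_metric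
    (hΩ.of_isClosed_subset isClosed_frontier hΩ.isClosed.frontier_subset)
    (c := fun i => (G i).chartSet (lo i) (hi i))
    (fun i => (G i).isOpen_chartSet _ _) (fun p hp => by
      obtain ⟨i, hpi⟩ := mem_iUnion.mp (hcov hp)
      exact mem_iUnion.mpr ⟨i, SpecialDomain.closure_carrier_inter_frontier_subset
        (hbox i) (hfr i) ⟨subset_closure hpi, hp⟩⟩)
  obtain ⟨R, hR⟩ := hΩ.isBounded.subset_closedBall 0
  choose M₁ hM₁0 hM₁ hM₁' using fun i => exists_fderiv_bounds (G i).contDiff_height (R + 1)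
  set M := 1 + ∑ i, M₁ i with hM
  have hMi : ∀ i, M₁ i ≤ M := fun i => by
    have := Finset.single_le_sum (f := M₁) (fun i _ => hM₁0 i) (Finset.mem_univ i)
    linarith
  have hM1 : 1 ≤ M := by
    have := Finset.sum_nonneg fun i (_ : i ∈ Finset.univ) => hM₁0 i
    linarith
  obtain ⟨ε₂, hε₂, hε₂i⟩ : ∃ ε₂ > 0, ∀ i, ε₂ ≤ ε₁ i := by
    rcases isEmpty_or_nonempty (Fin m) with h | h
    · exact ⟨1, one_pos, fun i => (IsEmpty.false i).elim⟩
    · obtain ⟨i₀, hi₀⟩ := Finite.exists_min ε₁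
      exact ⟨ε₁ i₀, hε₁ i₀, hi₀⟩
  -- δ/2 comes from the Lebesgue number of the cover, ε₂ from the individual carriers, and 1 keeps
  -- the balls in the ball of radius R + 1 where the derivative bounds hold.
  set ε := min (min (δ / 2) ε₂) 1 with hε
  have hchart : ∀ i, ∀ ξ ∈ Ω, Metric.ball ξ ε ⊆ (G i).chartSet (lo i) (hi i) →
      IsGraphChartAt Ω (G i).height (EuclideanSpace.single (G i).dir (G i).sgn) ε M M ξ := by
    intro i ξ hξ hsub
    have hin : ∀ z ∈ Metric.ball ξ ε, z ∈ Metric.closedBall (0 : Euc (d + 1)) (R + 1) := by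
      intro z hz
      have h1 := mem_closedBall_zero_iff.mp (hR hξ)
      have h2 : ‖z - ξ‖ < 1 := (mem_ball_iff_norm.mp hz).trans_le (min_le_right _ _)
      rw [mem_closedBall_zero_iff]
      have := norm_add_le (z - ξ) ξ
      rw [sub_add_cancel] at this
      linarith
    exact
      { norm_dir := by simpa using (G i).abs_sgn
        diff := (G i).contDiff_height.differentiable (by norm_num)
        shift := (G i).height_add_smul
        mem_iff := fun z hz => SpecialDomain.mem_iff_of_mem_chartSet (hbox i) (hsub hz)
        frontier_iff := fun z hz =>
          SpecialDomain.frontier_iff_of_mem_chartSet hΩ.isClosed (hbox i) (hfr i) (hsub hz)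
        lip := fun z hz z' hz' => (hM₁' i z (hin z hz) z' (hin z' hz')).trans
          (mul_le_mul_of_nonneg_right (hMi i) (norm_nonneg _))
        bound := fun z hz => (hM₁ i z (hin z hz)).trans (hMi i) }
  refine ⟨ε, M, by positivity, min_le_right _ _, hM1, fun ξ hξ hd => ?_, fun i ξ hξ hd => ?_⟩
  · obtain ⟨p, hp, hpd⟩ := (Metric.infDist_lt_iff hΓ).mp hd
    obtain ⟨i, hi⟩ := hleb p hp
    refine ⟨i, hchart i ξ hξ fun z hz => hi ?_⟩
    have h1 : ε ≤ δ / 2 := (min_le_left _ _).trans (min_le_left _ _)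
    rw [Metric.mem_ball] at hz ⊢
    linarith [dist_triangle z ξ p]
  · have h1 : ε ≤ ε₁ i := ((min_le_left _ _).trans (min_le_right _ _)).trans (hε₂i i)
    exact hchart i ξ (hcar i hξ)
      ((Metric.ball_subset_ball h1).trans (hball i ξ hξ (hd.trans_le h1)))

end IvanovModuli

namespace IvanovModuli

/-! ### Steps of both moduli are almost tangential -/

section DitzianTotik

variable {n : ℕ} {Ω : Set (Euc n)} {ψ : Euc n → ℝ} {e u : Euc n} {ε M Λ κ R : ℝ} {ξ : Euc n}

/-- The step of the Ditzian–Totik modulus is small in the directions transversal to the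
frontier. -/
lemma IsGraphChartAt.phi_mul_abs_fderiv_le (H : IsGraphChartAt Ω ψ e ε M Λ ξ)
    (hs : IsSmallScale ε M Λ κ) (hΓ : (frontier Ω).Nonempty)
    (hξ : Metric.infDist ξ (frontier Ω) ≤ κ) (hξΩ : ξ ∈ Ω) (hR0 : 0 < R)
    (hR : Ω ⊆ Metric.closedBall 0 R) (hu : ‖u‖ = 1) :
    phi Ω u ξ * |fderiv ℝ ψ ξ u| ≤
      (2 * R * (Λ / κ + M * κ) + Real.sqrt (2 * R) * (Λ + M)) *
        Real.sqrt (Metric.infDist ξ (frontier Ω)) := by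
  have hΛ := hs.one_le_Λ
  have hM := hs.one_le_M
  have hκ := hs.pos
  set C := 2 * R * (Λ / κ + M * κ) + Real.sqrt (2 * R) * (Λ + M) with hC
  have hC0 : 0 < C := by positivity
  have hψ := H.psi_le_mul_infDist hs hΓ hξ
  have hψ0 : 0 ≤ ψ ξ := H.psi_nonneg hs (by simpa using hκ.le) hξΩ
  have hρ0 := infDist_frontier_nonneg Ω ξ
  set ρ := Metric.infDist ξ (frontier Ω)
  have hx0 := Real.sqrt_nonneg ρ
  have hx1 : Real.sqrt ρ ≤ 1 := Real.sqrt_le_one.mpr (hξ.trans hs.le_one)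
  have hxsq := Real.sq_sqrt hρ0
  set x := Real.sqrt ρ
  set β := fderiv ℝ ψ ξ with hβ
  have bξ : ξ ∈ Metric.ball ξ ε :=
    IsGraphChartAt.mem_ball_of_le' hs (by simpa using hs.pos.le)
  have hβΛ : |β u| ≤ Λ := by
    have := (β.le_opNorm u).trans (mul_le_mul_of_nonneg_right (H.bound ξ bξ) (norm_nonneg u))
    rwa [hu, mul_one] at this
  -- The number y > 0 replaces x = √ρ, which may vanish on the frontier; y is sent to x at the end.
  have key : ∀ y : ℝ, 0 < y → y ≤ 1 → x ≤ y → phi Ω u ξ * |β u| ≤ C * y := by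
    intro y hy0 hy1 hxy
    have hDy : ψ ξ ≤ Λ * y ^ 2 := by
      refine hψ.trans ?_
      rw [← hxsq]; gcongr
    have hel : ∀ l₁ l₂ : ℝ, 0 ≤ l₁ → 0 ≤ l₂ → segment ℝ (ξ - l₁ • u) (ξ + l₂ • u) ⊆ Ω →
        Real.sqrt (l₁ * l₂) * |β u| ≤ C * y := by
      intro l₁ l₂ h₁ h₂ hseg
      obtain ⟨-, hb₁, hb₂⟩ := phi_le_iff_aux hR hu h₁ h₂ hseg
      -- Only the shorter arm matters: the longer one is at most 2R, and both points ξ ± lu are in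
      -- Ω.
      set l := min l₁ l₂ with hl
      have hl0 : 0 ≤ l := le_min h₁ h₂
      have hlR : l ≤ 2 * R := (min_le_left _ _).trans hb₁
      have hprod : Real.sqrt (l₁ * l₂) ≤ Real.sqrt l * Real.sqrt (2 * R) := by
        rw [← Real.sqrt_mul hl0]
        refine Real.sqrt_le_sqrt ?_
        rw [← min_mul_max l₁ l₂]
        exact mul_le_mul_of_nonneg_left (max_le hb₁ hb₂) hl0
      have hline : ∀ s : ℝ, |s| ≤ l → ξ + s • u ∈ Ω := by
        intro s hsl
        have h' : segment ℝ (ξ + (-l₁) • u) (ξ + l₂ • u) ⊆ Ω := by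
          rwa [neg_smul, ← sub_eq_add_neg]
        rw [segment_line_subset_iff, uIcc_of_le (by linarith)] at h'
        have h3 := abs_le.mp hsl
        exact h' ⟨by linarith [min_le_left l₁ l₂], by linarith [min_le_right l₁ l₂]⟩
      -- ψ is nonnegative at both points ξ ± l'u, so its linear decrease in one of these directions
      -- is at most ψ(ξ) plus the Taylor error.
      have htay : ∀ l' : ℝ, 0 ≤ l' → l' ≤ l → l' ≤ κ → l' * |β u| ≤ Λ * y ^ 2 + M * l' ^ 2 := by
        intro l' h0 hll hlκ
        have hone : ∀ s : ℝ, |s| = l' → -(s * β u) ≤ Λ * y ^ 2 + M * l' ^ 2 := by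
          intro s hsl
          have hn : ‖ξ + s • u - ξ‖ = l' := by
            rw [add_sub_cancel_left, norm_smul, hu, mul_one, Real.norm_eq_abs, hsl]
          have h1 : 0 ≤ ψ (ξ + s • u) :=
            H.psi_nonneg hs (by rw [hn]; exact hlκ) (hline s (hsl.trans_le hll))
          have b1 := IsGraphChartAt.mem_ball_of_le' hs
            (by rw [hn]; linarith : ‖ξ + s • u - ξ‖ ≤ 20 * κ)
          have h2 := H.taylor (by linarith) bξ bξ b1 (τ := l') (by simpa using h0) hn.le
          rw [hn, add_sub_cancel_left, map_smul, smul_eq_mul, ← hβ] at h2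
          have := (abs_le.mp h2).2
          nlinarith
        rcases abs_cases (β u) with ⟨h, -⟩ | ⟨h, -⟩
        · rw [h]
          have := hone (-l') (by rw [abs_neg, abs_of_nonneg h0])
          linarith
        · rw [h]
          have := hone l' (abs_of_nonneg h0)
          linarith
      have hR2 : Real.sqrt l * Real.sqrt (2 * R) ≤ 2 * R := by
        rw [← Real.sqrt_mul hl0]
        rw [Real.sqrt_le_iff]
        exact ⟨by positivity, by nlinarith⟩
      have hs2R := Real.sqrt_nonneg (2 * R)
      have hsl := Real.sqrt_nonneg l
      have hslsq := Real.sq_sqrt hl0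
      refine (mul_le_mul_of_nonneg_right hprod (abs_nonneg _)).trans ?_
      -- A long arm allows l' = κy and gives |β u| = O(y). For a short arm, either √l ≤ y already
      -- suffices, or l' = l is used and one factor √l is divided out.
      rcases le_or_gt (κ * y) l with hcase | hcase
      · have h1 := htay (κ * y) (by positivity) hcase (mul_le_of_le_one_right hκ.le hy1)
        have h2 : |β u| ≤ (Λ / κ + M * κ) * y := by
          have e : (κ * y) * ((Λ / κ + M * κ) * y) = Λ * y ^ 2 + M * (κ * y) ^ 2 := by
            field_simp
          rw [← e] at h1
          exact le_of_mul_le_mul_left h1 (by positivity)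
        calc Real.sqrt l * Real.sqrt (2 * R) * |β u| ≤ 2 * R * ((Λ / κ + M * κ) * y) := by gcongr
          _ ≤ C * y := by
            rw [hC]
            have : 0 ≤ Real.sqrt (2 * R) * (Λ + M) * y := by positivity
            linarith
      · have hly : l ≤ y := hcase.le.trans (mul_le_of_le_one_left hy0.le hs.le_one)
        have hsl1 : Real.sqrt l ≤ 1 := Real.sqrt_le_one.mpr (hly.trans hy1)
        have h3 : Real.sqrt l * |β u| ≤ (Λ + M) * y := by
          rcases le_or_gt (Real.sqrt l) y with h4 | h4
          · calc Real.sqrt l * |β u| ≤ y * Λ := by gcongr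
              _ ≤ _ := by nlinarith
          · have h5 := htay l hl0 le_rfl
              (hcase.le.trans (mul_le_of_le_one_right hκ.le hy1))
            have hslpos : 0 < Real.sqrt l := hy0.trans h4
            refine le_of_mul_le_mul_left (a := Real.sqrt l) ?_ hslpos
            calc Real.sqrt l * (Real.sqrt l * |β u|) = l * |β u| := by
                  rw [← mul_assoc, ← sq, hslsq]
              _ ≤ Λ * y ^ 2 + M * l ^ 2 := h5
              _ ≤ Λ * (Real.sqrt l * y) + M * (Real.sqrt l * y) := by
                have h6 : y ^ 2 ≤ Real.sqrt l * y := by rw [sq]; gcongr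
                have h7 : l ^ 2 ≤ Real.sqrt l * y := by
                  have : l ≤ Real.sqrt l := by nlinarith
                  rw [sq]; gcongr
                gcongr
              _ = _ := by ring
        calc Real.sqrt l * Real.sqrt (2 * R) * |β u| =
              Real.sqrt (2 * R) * (Real.sqrt l * |β u|) := by ring
          _ ≤ Real.sqrt (2 * R) * ((Λ + M) * y) := by gcongr
          _ ≤ C * y := by
            rw [hC]
            have : 0 ≤ 2 * R * (Λ / κ + M * κ) * y := by positivity
            linarith
    rcases eq_or_ne (|β u|) 0 with h0 | h0
    · rw [h0, mul_zero]; positivity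
    · have hpos : 0 < |β u| := lt_of_le_of_ne (abs_nonneg _) h0.symm
      rw [← le_div_iff₀ hpos]
      refine csSup_le ⟨_, 0, 0, le_rfl, le_rfl, by simpa using hξΩ, rfl⟩ ?_
      rintro s ⟨l₁, l₂, h₁, h₂, hseg, rfl⟩
      rw [le_div_iff₀ hpos]
      exact hel l₁ l₂ h₁ h₂ hseg
  refine le_of_forall_pos_le_add fun η hη => ?_
  have hmin : min 1 (x + η / C) ≤ x + η / C := min_le_right _ _
  refine (key (min 1 (x + η / C)) (by positivity) (min_le_left _ _)
    (le_min hx1 (by have : 0 < η / C := by positivity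
                    linarith))).trans ?_
  calc C * min 1 (x + η / C) ≤ C * (x + η / C) := by gcongr
    _ = C * x + η := by field_simp

end DitzianTotik

namespace SpecialDomain

variable {d : ℕ} (G : SpecialDomain d)

lemma fderiv_height (ξ v : Euc (d + 1)) : fderiv ℝ G.height ξ v =
    fderiv ℝ G.g (horiz (G.toNormal ξ)) (horiz (G.linPart v)) - G.linPart v (Fin.last d) := by
  have hd : DifferentiableAt ℝ G.height ξ := G.contDiff_height.differentiable (by norm_num) ξ
  have hg : DifferentiableAt ℝ G.g (horiz (G.toNormal ξ)) :=
    G.g_contDiff.differentiable (by norm_num) _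
  have h1 : HasDerivAt (fun s : ℝ => G.height (ξ + s • v)) (fderiv ℝ G.height ξ v) 0 := by
    have h2 : HasDerivAt (fun s : ℝ => ξ + s • v) v 0 := by
      simpa using ((hasDerivAt_id (0 : ℝ)).smul_const v).const_add ξ
    have h3 : HasFDerivAt G.height (fderiv ℝ G.height ξ) (ξ + (0 : ℝ) • v) := by
      simpa using hd.hasFDerivAt
    simpa [Function.comp_def] using h3.comp_hasDerivAt (0 : ℝ) h2
  have h4 : HasDerivAt (fun s : ℝ => G.g (horiz (G.toNormal ξ) + s • horiz (G.linPart v)))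
      (fderiv ℝ G.g (horiz (G.toNormal ξ)) (horiz (G.linPart v))) 0 := by
    have h2 : HasDerivAt (fun s : ℝ => horiz (G.toNormal ξ) + s • horiz (G.linPart v))
        (horiz (G.linPart v)) 0 := by
      simpa using ((hasDerivAt_id (0 : ℝ)).smul_const (horiz (G.linPart v))).const_add
        (horiz (G.toNormal ξ))
    have h3 : HasFDerivAt G.g (fderiv ℝ G.g (horiz (G.toNormal ξ)))
        (horiz (G.toNormal ξ) + (0 : ℝ) • horiz (G.linPart v)) := by
      simpa using hg.hasFDerivAt
    simpa [Function.comp_def] using h3.comp_hasDerivAt (0 : ℝ) h2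
  have h5 : HasDerivAt (fun s : ℝ => G.toNormal ξ (Fin.last d) + s * G.linPart v (Fin.last d))
      (G.linPart v (Fin.last d)) 0 := by
    simpa using ((hasDerivAt_id (0 : ℝ)).mul_const (G.linPart v (Fin.last d))).const_add
      (G.toNormal ξ (Fin.last d))
  have e : (fun s : ℝ => G.height (ξ + s • v)) = fun s : ℝ =>
      G.g (horiz (G.toNormal ξ) + s • horiz (G.linPart v)) -
        (G.toNormal ξ (Fin.last d) + s * G.linPart v (Fin.last d)) := by
    ext s
    rw [height, toNormal_add, map_smul]
    rfl
  rw [e] at h1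
  exact h1.unique (h4.sub h5)

lemma horiz_tangent (j : Fin d) (u : Euc d) : horiz (G.tangent j u) = EuclideanSpace.single j 1 := by
  ext i
  simp [horiz, tangent]

lemma tangent_last (j : Fin d) (u : Euc d) :
    G.tangent j u (Fin.last d) = fderiv ℝ G.g u (EuclideanSpace.single j 1) := by
  simp [tangent]

/-- At a point over x the differential of the height applied to the vector tangent over u is ∂_j
g(x) - ∂_j g(u), which is O(t) because ‖u - x‖ ≤ tb and g has a Lipschitz gradient on the cube. The
step length s ≤ t supplies the second factor t. -/
lemma exists_tangent_bounds : ∃ K : ℝ, 0 ≤ K ∧ ∀ ξ ∈ G.carrier, ∀ t ∈ Ioc (0 : ℝ) 1,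
    ∀ u ∈ G.baseBall (horiz (G.toNormal ξ)) (t * G.b), ∀ s ∈ Ioc 0 t, ∀ j : Fin d,
      ‖G.linPart.symm (s • G.tangent j u)‖ ≤ K * t ∧
      |fderiv ℝ G.height ξ (G.linPart.symm (s • G.tangent j u))| ≤ K * t * t := by
  obtain ⟨R, hR⟩ := (isBounded_closedCube (d := d) G.b).subset_closedBall 0
  obtain ⟨M, hM0, hM, hM'⟩ := exists_fderiv_bounds G.g_contDiff R
  have hb := G.b_pos
  refine ⟨1 + M + M * G.b, by positivity, ?_⟩
  intro ξ hξ t ht u hu s hs j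
  have hx := hR (openCube_subset_closedCube (by linarith)
    ((G.mem_image_ofNormal_iff _ ξ).mp hξ).1)
  have hu' := hR (openCube_subset_closedCube le_rfl hu.1)
  set x := horiz (G.toNormal ξ)
  have hsn : |s| ≤ t := by rw [abs_of_pos hs.1]; exact hs.2
  have ht0 := ht.1
  have hsingle : ‖(EuclideanSpace.single j 1 : Euc d)‖ = 1 := by simp
  have hgu : |fderiv ℝ G.g u (EuclideanSpace.single j 1)| ≤ M := by
    have := ((fderiv ℝ G.g u).le_opNorm (EuclideanSpace.single j 1)).trans
      (mul_le_mul_of_nonneg_right (hM u hu') (norm_nonneg _))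
    rwa [hsingle, mul_one] at this
  constructor
  · rw [LinearIsometryEquiv.norm_map, norm_smul, Real.norm_eq_abs]
    have h1 : ‖G.tangent j u‖ ≤ 1 + M := by
      refine (norm_add_le _ _).trans ?_
      rw [norm_smul]
      simpa using hgu
    calc |s| * ‖G.tangent j u‖ ≤ t * (1 + M) := by gcongr
      _ ≤ _ := by
        have : 0 ≤ M * G.b * t := by positivity
        linarith
  · rw [fderiv_height, LinearIsometryEquiv.apply_symm_apply]
    have e1 : horiz (s • G.tangent j u) = s • EuclideanSpace.single j 1 := by
      rw [← G.horiz_tangent j u]; rfl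
    have e2 : (s • G.tangent j u) (Fin.last d) =
        s * fderiv ℝ G.g u (EuclideanSpace.single j 1) := by
      rw [PiLp.smul_apply, tangent_last, smul_eq_mul]
    rw [e1, e2, map_smul, smul_eq_mul, ← mul_sub, abs_mul]
    have h1 : |fderiv ℝ G.g x (EuclideanSpace.single j 1) -
        fderiv ℝ G.g u (EuclideanSpace.single j 1)| ≤ M * (t * G.b) := by
      rw [← sub_apply]
      have h2 := ((fderiv ℝ G.g x - fderiv ℝ G.g u).le_opNorm (EuclideanSpace.single j 1)).trans
        (mul_le_mul_of_nonneg_right (hM' x hx u hu') (norm_nonneg _))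
      rw [hsingle, mul_one, norm_sub_rev x u] at h2
      exact h2.trans (mul_le_mul_of_nonneg_left hu.2 hM0)
    calc |s| * _ ≤ t * (M * (t * G.b)) := by gcongr
      _ ≤ _ := by
        have : 0 ≤ (1 + M) * t * t := by positivity
        linarith

end SpecialDomain

end IvanovModuli

namespace IvanovModuli

/-! ### Transfer of L^p norms along maps of bounded distortion -/

section Transfer

variable {α β : Type*} [MeasurableSpace α] [MeasurableSpace β] {μ : Measure α} {ν : Measure β}

lemma ae_comp_of_map_le {Φ : α → β} {A : ℝ≥0∞} (hm : Measurable Φ) (hΦ : μ.map Φ ≤ A • ν)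
    {P : β → Prop} (h : ∀ᵐ x ∂ν, P x) : ∀ᵐ a ∂μ, P (Φ a) :=
  Measure.QuasiMeasurePreserving.ae
    ⟨hm, (Measure.absolutelyContinuous_of_le hΦ).trans (Measure.smul_absolutelyContinuous)⟩ h

/-- The change-of-variables estimates in the form of a domination of measures, which serves all
exponents p at once, including the essential supremum. -/
lemma map_le_of_lintegral_comp_le {Φ : α → β} {A : ℝ≥0∞} (hm : Measurable Φ)
    (h : ∀ F : β → ℝ≥0∞, Measurable F → ∫⁻ a, F (Φ a) ∂μ ≤ A * ∫⁻ x, F x ∂ν) :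
    μ.map Φ ≤ A • ν := by
  refine Measure.le_iff.mpr fun s hs => ?_
  have h1 := h (s.indicator 1) (measurable_one.indicator hs)
  rw [lintegral_indicator_one hs, ← lintegral_map (measurable_one.indicator hs) hm,
    lintegral_indicator_one hs] at h1
  simpa using h1

/-- The constant in the transfer of an `L^p` norm along `n` maps which distort measure by at most
a factor `A`. -/
noncomputable def transferConst (A C : ℝ≥0∞) (n : ℕ) (p : ℝ≥0∞) : ℝ≥0∞ :=
  if p = ∞ then C * n else ((C * n) ^ p.toReal * (n * A)) ^ (1 / p.toReal)

lemma transferConst_ne_top {A C : ℝ≥0∞} (hA : A ≠ ∞) (hC : C ≠ ∞) (n : ℕ) (p : ℝ≥0∞) :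
    transferConst A C n p ≠ ∞ := by
  unfold transferConst
  split_ifs
  · exact ENNReal.mul_ne_top hC (ENNReal.natCast_ne_top n)
  · refine ENNReal.rpow_ne_top_of_nonneg (by positivity) (ENNReal.mul_ne_top ?_ ?_)
    · exact ENNReal.rpow_ne_top_of_nonneg (by positivity)
        (ENNReal.mul_ne_top hC (ENNReal.natCast_ne_top n))
    · exact ENNReal.mul_ne_top (ENNReal.natCast_ne_top n) hA

/-- For p = ∞ domination of the image measure carries almost-everywhere bounds back along Φ k, so W
need not be measurable; for p < ∞ it bounds the integrals of W^p. -/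
lemma eLpNorm_le_of_enorm_le_sum {Φ : ℕ → α → β} {A C : ℝ≥0∞} {n : ℕ}
    (hm : ∀ k < n, Measurable (Φ k)) (hΦ : ∀ k < n, μ.map (Φ k) ≤ A • ν) {p : ℝ≥0∞} (hp : p ≠ 0)
    {W : β → ℝ≥0∞} (hW : p = ∞ ∨ Measurable W) {g : α → ℝ}
    (hg : ∀ᵐ a ∂μ, ‖g a‖ₑ ≤ C * ∑ k ∈ Finset.range n, W (Φ k a)) :
    eLpNorm g p μ ≤ transferConst A C n p * eLpNorm W p ν := by
  unfold transferConst
  rcases eq_or_ne p ∞ with rfl | hp'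
  · rw [if_pos rfl, eLpNorm_exponent_top, eLpNorm_exponent_top]
    have h1 : ∀ᵐ a ∂μ, ∀ k ∈ Finset.range n, W (Φ k a) ≤ eLpNormEssSup W ν := by
      rw [Finset.eventually_all]
      intro k hk
      have hk' := Finset.mem_range.mp hk
      exact ae_comp_of_map_le (P := fun x => W x ≤ eLpNormEssSup W ν) (hm k hk') (hΦ k hk')
        ae_le_eLpNormEssSup
    refine essSup_le_of_ae_le _ ?_
    filter_upwards [h1, hg] with a h2 h3
    calc ‖g a‖ₑ ≤ _ := h3
      _ ≤ C * (n * eLpNormEssSup W ν) := by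
        gcongr
        calc _ ≤ (Finset.range n).card • eLpNormEssSup W ν := Finset.sum_le_card_nsmul _ _ _ h2
          _ = _ := by simp
      _ = _ := by ring
  · have hWm := hW.resolve_left hp'
    have hpp : 0 < p.toReal := ENNReal.toReal_pos hp hp'
    rw [if_neg hp', eLpNorm_eq_lintegral_rpow_enorm_toReal hp hp',
      eLpNorm_eq_lintegral_rpow_enorm_toReal hp hp', ← ENNReal.mul_rpow_of_nonneg _ _ (by positivity)]
    gcongr
    simp only [enorm_eq_self]
    have hWp : Measurable fun x => W x ^ p.toReal := hWm.pow_const _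
    calc ∫⁻ a, ‖g a‖ₑ ^ p.toReal ∂μ
        ≤ ∫⁻ a, (C * n) ^ p.toReal * ∑ k ∈ Finset.range n, W (Φ k a) ^ p.toReal ∂μ := by
          refine lintegral_mono_ae ?_
          filter_upwards [hg] with a ha
          calc ‖g a‖ₑ ^ p.toReal ≤ (C * ∑ k ∈ Finset.range n, W (Φ k a)) ^ p.toReal := by gcongr
            _ = C ^ p.toReal * (∑ k ∈ Finset.range n, W (Φ k a)) ^ p.toReal :=
              ENNReal.mul_rpow_of_nonneg _ _ hpp.le
            _ ≤ C ^ p.toReal * (((Finset.range n).card : ℝ≥0∞) ^ p.toReal *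
                ∑ k ∈ Finset.range n, W (Φ k a) ^ p.toReal) := by
              gcongr
              exact sum_rpow_le_card_rpow_mul_sum _ _ hpp
            _ = _ := by
              rw [Finset.card_range, ENNReal.mul_rpow_of_nonneg _ _ hpp.le, mul_assoc]
      _ = (C * n) ^ p.toReal * ∑ k ∈ Finset.range n, ∫⁻ a, W (Φ k a) ^ p.toReal ∂μ := by
          have hms : ∀ k ∈ Finset.range n, Measurable fun a => W (Φ k a) ^ p.toReal := fun k hk =>
            hWp.comp (hm k (Finset.mem_range.mp hk))
          rw [lintegral_const_mul _ (Finset.measurable_fun_sum _ hms),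
            lintegral_finsetSum _ hms]
      _ ≤ (C * n) ^ p.toReal * ∑ k ∈ Finset.range n, A * ∫⁻ x, W x ^ p.toReal ∂ν := by
          gcongr with k hk
          have hk' := Finset.mem_range.mp hk
          rw [← lintegral_map hWp (hm k hk'), ← smul_eq_mul, ← lintegral_smul_measure]
          exact lintegral_mono' (hΦ k hk') le_rfl
      _ = _ := by
          rw [Finset.sum_const, Finset.card_range, nsmul_eq_mul]
          ring

/-- The iterated `L^p` norm is the `L^p` norm over the product. -/
lemma eLpNorm_eLpNorm_le [SFinite μ] [SFinite ν] {S : Set α} {B : α → Set β}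
    (hS : MeasurableSet S) (hB : ∀ a, MeasurableSet (B a))
    (hSB : MeasurableSet {x : α × β | x.1 ∈ S ∧ x.2 ∈ B x.1}) {c : ℝ≥0∞} (hc : c ≠ 0)
    {p : ℝ≥0∞} (hp : p ≠ 0) {g g' : α × β → ℝ}
    (hgg' : g =ᵐ[(μ.prod ν).restrict {x | x.1 ∈ S ∧ x.2 ∈ B x.1}] g')
    (hg' : p = ∞ ∨ Measurable g') :
    eLpNorm (fun a => eLpNorm (fun b => g (a, b)) p (c • ν.restrict (B a))) p (μ.restrict S) ≤
      eLpNorm g p (c • (μ.prod ν).restrict {x | x.1 ∈ S ∧ x.2 ∈ B x.1}) := by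
  have key : ∀ {P : α × β → Prop},
      (∀ᵐ x ∂(μ.prod ν).restrict {x | x.1 ∈ S ∧ x.2 ∈ B x.1}, P x) →
      ∀ᵐ a ∂μ.restrict S, ∀ᵐ b ∂ν.restrict (B a), P (a, b) := by
    intro P h
    rw [ae_restrict_iff' hSB] at h
    rw [ae_restrict_iff' hS]
    filter_upwards [Measure.ae_ae_of_ae_prod h] with a ha haS
    rw [ae_restrict_iff' (hB a)]
    filter_upwards [ha] with b hb hbB using hb ⟨haS, hbB⟩
  rcases eq_or_ne p ∞ with rfl | hp'
  · simp only [eLpNorm_exponent_top]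
    refine essSup_le_of_ae_le _ ?_
    have h1 : ∀ᵐ x ∂(μ.prod ν).restrict {x | x.1 ∈ S ∧ x.2 ∈ B x.1},
        ‖g x‖ₑ ≤ eLpNormEssSup g (c • (μ.prod ν).restrict {x | x.1 ∈ S ∧ x.2 ∈ B x.1}) := by
      rw [← Measure.ae_ennreal_smul_measure_eq hc]
      exact ae_le_eLpNormEssSup
    filter_upwards [key h1] with a ha
    rw [enorm_eq_self]
    refine essSup_le_of_ae_le _ ?_
    rw [Filter.EventuallyLE, Measure.ae_ennreal_smul_measure_eq hc]
    exact ha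
  · have hg'm := hg'.resolve_left hp'
    have hpp : 0 < p.toReal := ENNReal.toReal_pos hp hp'
    have h1 : eLpNorm (fun a => eLpNorm (fun b => g (a, b)) p (c • ν.restrict (B a))) p
        (μ.restrict S) = eLpNorm (fun a => eLpNorm (fun b => g' (a, b)) p (c • ν.restrict (B a))) p
        (μ.restrict S) := by
      refine eLpNorm_congr_ae ?_
      filter_upwards [key hgg'] with a ha
      refine eLpNorm_congr_ae ?_
      rw [Filter.EventuallyEq, Measure.ae_ennreal_smul_measure_eq hc]
      exact ha
    have h2 : eLpNorm g p (c • (μ.prod ν).restrict {x | x.1 ∈ S ∧ x.2 ∈ B x.1}) =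
        eLpNorm g' p (c • (μ.prod ν).restrict {x | x.1 ∈ S ∧ x.2 ∈ B x.1}) := by
      refine eLpNorm_congr_ae ?_
      rw [Filter.EventuallyEq, Measure.ae_ennreal_smul_measure_eq hc]
      exact hgg'
    rw [h1, h2]
    simp only [eLpNorm_eq_lintegral_rpow_enorm_toReal hp hp', enorm_eq_self]
    gcongr
    have hm : Measurable fun x : α × β => ‖g' x‖ₑ ^ p.toReal := hg'm.enorm.pow_const _
    simp only [← ENNReal.rpow_mul, one_div_mul_cancel hpp.ne', ENNReal.rpow_one,
      lintegral_smul_measure, smul_eq_mul]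
    rw [← lintegral_indicator hSB, lintegral_prod _ (hm.indicator hSB).aemeasurable,
      ← lintegral_indicator hS]
    rw [← lintegral_const_mul _ (hm.indicator hSB).lintegral_prod_right']
    refine lintegral_mono fun a => ?_
    by_cases ha : a ∈ S
    · rw [indicator_of_mem ha, ← lintegral_indicator (hB a)]
      gcongr with b
      by_cases hb : b ∈ B a
      · rw [indicator_of_mem hb, indicator_of_mem
          (show (a, b) ∈ {x : α × β | x.1 ∈ S ∧ x.2 ∈ B x.1} from ⟨ha, hb⟩)]
      · rw [indicator_of_notMem hb]; exact zero_le
    · rw [indicator_of_notMem ha]; exact zero_le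

end Transfer

/-! ### Changing f on a null set -/

section AlmostEverywhere

variable {d : ℕ} {Ω : Set (Euc (d + 1))} {f f' : Euc (d + 1) → ℝ}

lemma finDiff_congr {r : ℕ} {h η : Euc (d + 1)} (hj : ∀ j ∈ Finset.range (r + 1),
    f (η + (j : ℝ) • h) = f' (η + (j : ℝ) • h)) : finDiff r h f η = finDiff r h f' η :=
  Finset.sum_congr rfl fun j hj' => by rw [hj j hj']

lemma finDiffOn_congr {r : ℕ} (hr : 0 < r) {h η : Euc (d + 1)} (hj : ∀ j ∈ Finset.range (r + 1),
    η + (j : ℝ) • h ∈ Ω → f (η + (j : ℝ) • h) = f' (η + (j : ℝ) • h)) :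
    finDiffOn r h f Ω η = finDiffOn r h f' Ω η := by
  by_cases hs : segment ℝ η (η + (r : ℝ) • h) ⊆ Ω
  · rw [finDiffOn_of_subset hs, finDiffOn_of_subset hs]
    refine finDiff_congr fun j hj' => hj j hj' ?_
    have hjr : j ≤ r := Nat.lt_succ_iff.mp (Finset.mem_range.mp hj')
    exact mem_of_segment_subset (Nat.cast_pos.mpr hr) hs
      ⟨Nat.cast_nonneg j, Nat.cast_le.mpr hjr⟩
  · rw [finDiffOn_of_not_subset hs, finDiffOn_of_not_subset hs]

lemma quasiMeasurePreserving_homothety (ξ : Euc (d + 1)) {c : ℝ} (hc : c ≠ 0) :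
    Measure.QuasiMeasurePreserving (fun η : Euc (d + 1) => ξ + c • (η - ξ)) volume volume :=
  ((measurePreserving_add_left volume ξ).quasiMeasurePreserving.comp
    (Measure.quasiMeasurePreserving_smul volume hc)).comp
      (measurePreserving_sub_right volume ξ).quasiMeasurePreserving

/-- The node j = 0 is ξ itself, so ξ must avoid a null set; for j ≥ 1 the node is a nondegenerate
homothety of η, under which preimages of null sets are null. A supremum, q = ∞, would not tolerate
such changes. -/
lemma tau_congr_ae {r : ℕ} (hr : 0 < r) (hΩ : IsClosed Ω) (hf : f =ᵐ[volume.restrict Ω] f')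
    (δ : ℝ) (p : ℝ≥0∞) {q : ℝ≥0∞} (hq : q ≠ ∞) : tau r Ω f δ p q = tau r Ω f' δ p q := by
  refine eLpNorm_congr_ae ?_
  have hf' := hf
  rw [Filter.EventuallyEq, ae_restrict_iff' hΩ.measurableSet] at hf'
  filter_upwards [hf] with ξ hξ
  simp only [localModulus, hq, if_false]
  congr 2
  refine lintegral_congr_ae ?_
  have h1 : ∀ᵐ η : Euc (d + 1), ∀ j ∈ Finset.range (r + 1),
      ξ + (j : ℝ) • ((r : ℝ)⁻¹ • (η - ξ)) ∈ Ω →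
        f (ξ + (j : ℝ) • ((r : ℝ)⁻¹ • (η - ξ))) = f' (ξ + (j : ℝ) • ((r : ℝ)⁻¹ • (η - ξ))) := by
    rw [Finset.eventually_all]
    intro j _
    rcases Nat.eq_zero_or_pos j with rfl | hj
    · exact Filter.Eventually.of_forall fun η _ => by simpa using hξ
    · simp only [smul_smul]
      have hc : (j : ℝ) * (r : ℝ)⁻¹ ≠ 0 := by positivity
      exact (quasiMeasurePreserving_homothety ξ hc).ae hf'
  filter_upwards [ae_restrict_of_ae h1] with η hη
  rw [finDiffOn_congr hr hη]

end AlmostEverywhere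

end IvanovModuli

/-! ### Bound for the Ditzian–Totik part -/

namespace IvanovModuli

variable {d : ℕ} {Ω : Set (Euc (d + 1))} {f f' : Euc (d + 1) → ℝ} {ε M Λ κ K t : ℝ} {r N : ℕ}

/-- The step `v` at `ξ` is of size at most `K t`, and near the frontier it is almost tangential. -/
def IsAdmissibleStep (Ω : Set (Euc (d + 1))) (ε M Λ κ K t : ℝ) (ξ v : Euc (d + 1)) : Prop :=
  ‖v‖ ≤ K * t ∧ (Metric.infDist ξ (frontier Ω) ≤ κ →
    ∃ (ψ : Euc (d + 1) → ℝ) (k : Fin (d + 1)) (σ : ℝ),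
      |σ| = 1 ∧ IsGraphChartAt Ω ψ (EuclideanSpace.single k σ) ε M Λ ξ ∧
      |fderiv ℝ ψ ξ v| ≤ K * t * (Real.sqrt (Metric.infDist ξ (frontier Ω)) + t))

/-- The differences of `f` with admissible steps are bounded by values of the local modulus. -/
def HasLocalBound (Ω : Set (Euc (d + 1))) (f : Euc (d + 1) → ℝ) (r N : ℕ) (ε M Λ κ K t δ : ℝ)
    (q C : ℝ≥0∞) : Prop :=
  ∀ ξ ∈ Ω, ∀ v, segment ℝ ξ (ξ + (r : ℝ) • v) ⊆ Ω → IsAdmissibleStep Ω ε M Λ κ K t ξ v →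
    ‖finDiff r v f ξ‖ₑ ≤ C * ∑ k ∈ Finset.range (r * N + 1),
      localModulus r Ω f (ξ + ((k : ℝ) / N) • v) δ q

section Core

variable {α : Type*} [MeasurableSpace α] {μ : Measure α} {ξ v : α → Euc (d + 1)} {A C : ℝ≥0∞}

lemma finDiff_congr_ae (hξ : Measurable ξ) (hv : Measurable v)
    (hΦ : ∀ τ ∈ Icc (0 : ℝ) r, μ.map (fun a => ξ a + τ • v a) ≤ A • volume.restrict Ω)
    (hff' : f =ᵐ[volume.restrict Ω] f') :
    (fun a => finDiff r (v a) f (ξ a)) =ᵐ[μ] fun a => finDiff r (v a) f' (ξ a) := by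
  have h : ∀ᵐ a ∂μ, ∀ j ∈ Finset.range (r + 1),
      f (ξ a + (j : ℝ) • v a) = f' (ξ a + (j : ℝ) • v a) := by
    rw [Finset.eventually_all]
    intro j hj
    have hjr : j ≤ r := Nat.lt_succ_iff.mp (Finset.mem_range.mp hj)
    exact ae_comp_of_map_le (P := fun x => f x = f' x) (by fun_prop)
      (hΦ j ⟨Nat.cast_nonneg j, Nat.cast_le.mpr hjr⟩) hff'
  filter_upwards [h] with a ha using finDiff_congr ha

/-- The common core of both estimates: base points and steps depend on a parameter a, and all
intermediate nodes have image measure at most A times Lebesgue measure on Ω. -/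
lemma eLpNorm_finDiff_le (hN : 1 ≤ N) (hξ : Measurable ξ) (hv : Measurable v)
    (hΦ : ∀ τ ∈ Icc (0 : ℝ) r, μ.map (fun a => ξ a + τ • v a) ≤ A • volume.restrict Ω)
    (hff' : f =ᵐ[volume.restrict Ω] f') {p q : ℝ≥0∞} (hp : p ≠ 0) {δ : ℝ}
    (hW : p = ∞ ∨ Measurable fun ξ => localModulus r Ω f' ξ δ q)
    (hb : HasLocalBound Ω f' r N ε M Λ κ K t δ q C)
    (ha : ∀ᵐ a ∂μ, ξ a ∈ Ω ∧ segment ℝ (ξ a) (ξ a + (r : ℝ) • v a) ⊆ Ω ∧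
      IsAdmissibleStep Ω ε M Λ κ K t (ξ a) (v a)) :
    eLpNorm (fun a => finDiff r (v a) f (ξ a)) p μ ≤
      transferConst A C (r * N + 1) p * tau r Ω f' δ p q := by
  rw [eLpNorm_congr_ae (finDiff_congr_ae hξ hv hΦ hff')]
  have hN0 : (0 : ℝ) < N := by exact_mod_cast hN
  refine eLpNorm_le_of_enorm_le_sum (Φ := fun k a => ξ a + ((k : ℝ) / N) • v a)
    (fun k _ => by fun_prop) (fun k hk => hΦ _ ⟨by positivity, ?_⟩) hp hW ?_
  · rw [div_le_iff₀ hN0]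
    exact_mod_cast Nat.lt_succ_iff.mp hk
  · filter_upwards [ha] with a h using hb _ h.1 _ h.2.1 h.2.2

end Core

lemma dtModulus_le (hΩ : IsCompact Ω) (hA : HasGraphCharts Ω ε M Λ κ)
    (hs : IsSmallScale ε M Λ κ) (hΓ : (frontier Ω).Nonempty) (hr : 1 ≤ r) (hN : 1 ≤ N) {R : ℝ}
    (hR0 : 0 < R) (hR : Ω ⊆ Metric.closedBall 0 R) (hK₁ : 2 * R ≤ K)
    (hK₂ : 2 * R * (Λ / κ + M * κ) + Real.sqrt (2 * R) * (Λ + M) ≤ K) (ht : 0 < t)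
    (hff' : f =ᵐ[volume.restrict Ω] f') {p q C : ℝ≥0∞} (hp : p ≠ 0) {δ : ℝ}
    (hW : p = ∞ ∨ Measurable fun ξ => localModulus r Ω f' ξ δ q)
    (hb : HasLocalBound Ω f' r N ε M Λ κ K t δ q C) (j : Fin (d + 1)) :
    dtModulus r Ω f t (EuclideanSpace.single j 1) p ≤
      transferConst 3 C (r * N + 1) p * tau r Ω f' δ p q := by
  refine iSup₂_le fun h hh => ?_
  have hht : |h| ≤ t := hh.trans (min_le_left _ _)
  set e : Euc (d + 1) := EuclideanSpace.single j 1 with he'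
  have he : ‖e‖ = 1 := by simp [he']
  have hr0 : (0 : ℝ) < r := by exact_mod_cast hr
  have hφ := measurable_phi hΩ he
  set S := {ξ | segment ℝ ξ (ξ + (r * h * phi Ω e ξ) • e) ⊆ Ω} with hS
  have hSm : MeasurableSet S := measurableSet_phi_segment hΩ he (r * h)
  have hseg : ∀ ξ, (r : ℝ) • ((h * phi Ω e ξ) • e) = (r * h * phi Ω e ξ) • e := fun ξ => by
    rw [smul_smul, mul_assoc]
  -- Off S the difference is 0 by convention, so the norm may be taken over S, where it is the plain
  -- difference.
  have hsupp : (fun ξ => finDiffOn r ((h * phi Ω e ξ) • e) f Ω ξ).support ⊆ S := by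
    intro ξ hξ
    by_contra hn
    exact hξ (finDiffOn_of_not_subset (by rwa [hseg]))
  rw [← eLpNorm_restrict_eq_of_support_subset hsupp]
  calc eLpNorm (fun ξ => finDiffOn r ((h * phi Ω e ξ) • e) f Ω ξ) p
        ((volume.restrict Ω).restrict S)
      ≤ eLpNorm (fun ξ => finDiffOn r ((h * phi Ω e ξ) • e) f Ω ξ) p (volume.restrict S) :=
        eLpNorm_mono_measure _ (Measure.restrict_mono_measure Measure.restrict_le_self S)
    _ = eLpNorm (fun ξ => finDiff r ((h * phi Ω e ξ) • e) f ξ) p (volume.restrict S) := by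
        refine eLpNorm_congr_ae ?_
        filter_upwards [ae_restrict_mem hSm] with ξ hξ
        exact finDiffOn_of_subset (by rwa [hseg])
    _ ≤ _ := by
        refine eLpNorm_finDiff_le (ξ := id) hN measurable_id (by fun_prop) ?_ hff' hp
          hW hb ?_
        · intro τ hτ
          refine map_le_of_lintegral_comp_le (by fun_prop) fun F hF => ?_
          have h1 := lintegral_comp_phi_le hΩ j (h := h) hτ.1 hτ.2 hF
          simp only [smul_smul, ← mul_assoc, id]
          exact h1
        · filter_upwards [ae_restrict_mem hSm] with ξ hξ
          rw [id, hseg]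
          have hξΩ : ξ ∈ Ω := hξ (left_mem_segment ℝ _ _)
          have hφ0 := phi_nonneg Ω e ξ
          refine ⟨hξΩ, hξ, ?_, fun hκ => ?_⟩
          · rw [norm_smul, he, mul_one, Real.norm_eq_abs, abs_mul, abs_of_nonneg hφ0, mul_comm]
            have := phi_le hR0.le hR he ξ
            exact mul_le_mul (this.trans hK₁) hht (abs_nonneg _) (by linarith)
          · obtain ⟨ψ, k, σ, hσ, H⟩ := hA ξ hξΩ hκ
            refine ⟨ψ, k, σ, hσ, H, ?_⟩
            have h1 := H.phi_mul_abs_fderiv_le hs hΓ hκ hξΩ hR0 hR he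
            rw [map_smul, smul_eq_mul, abs_mul, abs_mul, abs_of_nonneg hφ0, mul_assoc]
            have hK0 : 0 ≤ K := by linarith
            have hsq := Real.sqrt_nonneg (Metric.infDist ξ (frontier Ω))
            calc |h| * (phi Ω e ξ * |fderiv ℝ ψ ξ e|) ≤
                  t * (K * Real.sqrt (Metric.infDist ξ (frontier Ω))) := by
                  refine mul_le_mul hht (h1.trans ?_) (by positivity) ht.le
                  gcongr
              _ = K * t * Real.sqrt (Metric.infDist ξ (frontier Ω)) := by ring
              _ ≤ _ := by gcongr; linarith

end IvanovModuli

/-! ### Bound for the tangential part -/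

namespace IvanovModuli

namespace SpecialDomain

variable {d : ℕ} (G : SpecialDomain d) {Ω : Set (Euc (d + 1))} {f f' : Euc (d + 1) → ℝ}
  {ε M Λ κ K t : ℝ} {r N : ℕ}

lemma segment_toNormal_iff (z w : Euc (d + 1)) :
    segment ℝ z (z + w) ⊆ G.toNormal '' Ω ↔
      segment ℝ (G.ofNormal z) (G.ofNormal z + G.linPart.symm w) ⊆ Ω := by
  rw [segment_add_subset_iff, segment_add_subset_iff]
  refine forall₂_congr fun θ _ => ?_
  rw [← map_smul, ← ofNormal_add]
  constructor
  · rintro ⟨y, hy, hyz⟩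
    rwa [← hyz, ofNormal_toNormal]
  · exact fun h => ⟨_, h, G.toNormal_ofNormal _⟩

/-- The normal form is an isometric change of coordinates; all further estimates are made in the
original Ω. -/
lemma finDiffOn_toNormal (r : ℕ) (w z : Euc (d + 1)) (f : Euc (d + 1) → ℝ) :
    finDiffOn r w (f ∘ G.ofNormal) (G.toNormal '' Ω) z =
      finDiffOn r (G.linPart.symm w) f Ω (G.ofNormal z) := by
  have h1 := G.segment_toNormal_iff (Ω := Ω) z ((r : ℝ) • w)
  rw [map_smul] at h1
  by_cases h : segment ℝ (G.ofNormal z) (G.ofNormal z + (r : ℝ) • G.linPart.symm w) ⊆ Ω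
  · rw [finDiffOn_of_subset h, finDiffOn_of_subset (h1.mpr h)]
    refine Finset.sum_congr rfl fun j _ => ?_
    rw [Function.comp_apply, ofNormal_add, map_smul]
  · rw [finDiffOn_of_not_subset h, finDiffOn_of_not_subset (mt h1.mp h)]

lemma measurePreserving_ofNormal : MeasurePreserving G.ofNormal volume volume := by
  have h : G.ofNormal = G.linPart.symm ∘ fun z => z + G.shift := funext G.ofNormal_eq
  rw [h]
  exact G.linPart.symm.measurePreserving.comp (measurePreserving_add_right volume G.shift)

lemma continuous_horiz : Continuous (horiz : Euc (d + 1) → Euc d) :=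
  contDiff_horiz.continuous

lemma measurableSet_normalInner (A₀ t : ℝ) : MeasurableSet (G.normalInner A₀ t) := by
  have hg := G.g_contDiff.continuous
  have hh := continuous_horiz (d := d)
  have hi : Continuous fun z => Metric.infDist z (G.normalEssBdry 1) :=
    Metric.continuous_infDist_pt _
  have h₁ := ((isOpen_openCube (d := d) (1 * G.b)).preimage hh).measurableSet
  have h₂ : MeasurableSet {z : Euc (d + 1) | G.g (horiz z) - 1 * G.L * G.b < z (Fin.last d)} :=
    (isOpen_lt (by fun_prop) (by fun_prop)).measurableSet
  have h₃ : MeasurableSet {z : Euc (d + 1) | z (Fin.last d) ≤ G.g (horiz z)} :=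
    (isClosed_le (by fun_prop) (by fun_prop)).measurableSet
  have h₄ : MeasurableSet {z | A₀ * t ^ 2 ≤ Metric.infDist z (G.normalEssBdry 1)} :=
    (isClosed_le continuous_const hi).measurableSet
  exact (h₁.inter (h₂.inter h₃)).inter h₄

lemma measurableSet_baseBall_pair (l : ℝ) :
    MeasurableSet {x : Euc (d + 1) × Euc d | x.2 ∈ G.baseBall (horiz x.1) l} := by
  have hh := continuous_horiz (d := d)
  exact ((isOpen_openCube G.b).preimage continuous_snd).measurableSet.inter
    (isClosed_le (f := fun x : Euc (d + 1) × Euc d => ‖x.2 - horiz x.1‖) (by fun_prop)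
      continuous_const).measurableSet

lemma continuous_tangent (j : Fin d) : Continuous fun u => G.tangent j u := by
  have := G.g_contDiff.continuous_fderiv two_ne_zero
  unfold tangent
  fun_prop

lemma horiz_sub_smul_tangent (z : Euc (d + 1)) (τ : ℝ) (j : Fin d) (u : Euc d) :
    horiz (z - τ • G.tangent j u) = horiz z - τ • EuclideanSpace.single j 1 := by
  rw [← G.horiz_tangent j u]
  rfl

/-- For fixed u the node map is a translation of z. Its horizontal part τe_j does not depend on u,
so after the translation u still ranges over a ball of radius l, whose volume is the constant. -/
lemma lintegral_comp_tangent_le (hΩ : MeasurableSet Ω) {l : ℝ} (hl : 0 < l) (τ : ℝ) (j : Fin d)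
    {S : Set (Euc (d + 1) × Euc d)}
    (hball : ∀ x ∈ S, ‖x.2 - horiz x.1‖ ≤ l)
    (hS : ∀ x ∈ S, G.ofNormal (x.1 + τ • G.tangent j x.2) ∈ Ω)
    {F : Euc (d + 1) → ℝ≥0∞} (hF : Measurable F) :
    ∫⁻ x in S, F (G.ofNormal (x.1 + τ • G.tangent j x.2)) ∂(volume.prod volume) ≤
      ENNReal.ofReal (l ^ d) * volume (Metric.ball (0 : Euc d) 1) * ∫⁻ x in Ω, F x := by
  set H := Ω.indicator F with hH
  have hHm : Measurable H := hF.indicator hΩ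
  have hT := G.continuous_ofNormal.measurable
  have htan := (G.continuous_tangent j).measurable
  have hh := (continuous_horiz (d := d)).measurable
  set P : Set (Euc (d + 1) × Euc d) := {x | ‖x.2 - horiz x.1‖ ≤ l} with hP
  have hPm : MeasurableSet P := measurableSet_le (by fun_prop) measurable_const
  set Q : Set (Euc (d + 1) × Euc d) :=
    {x | ‖x.2 - (horiz x.1 - τ • EuclideanSpace.single j 1)‖ ≤ l} with hQ
  have hQm : MeasurableSet Q := measurableSet_le (by fun_prop) measurable_const
  have hm₁ : Measurable fun x : Euc (d + 1) × Euc d =>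
      P.indicator (fun x => H (G.ofNormal (x.1 + τ • G.tangent j x.2))) x :=
    Measurable.indicator (by fun_prop) hPm
  have hm₂ : Measurable fun x : Euc (d + 1) × Euc d =>
      Q.indicator (fun x => H (G.ofNormal x.1)) x :=
    Measurable.indicator (by fun_prop) hQm
  calc ∫⁻ x in S, F (G.ofNormal (x.1 + τ • G.tangent j x.2)) ∂(volume.prod volume)
      ≤ ∫⁻ x in S, P.indicator (fun x => H (G.ofNormal (x.1 + τ • G.tangent j x.2))) x
          ∂(volume.prod volume) := by
        refine setLIntegral_mono hm₁ fun x hx => ?_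
        rw [indicator_of_mem (show x ∈ P from hball x hx), hH, indicator_of_mem (hS x hx)]
    _ ≤ ∫⁻ x, P.indicator (fun x => H (G.ofNormal (x.1 + τ • G.tangent j x.2))) x
          ∂(volume.prod volume) := setLIntegral_le_lintegral _ _
    _ = ∫⁻ u, ∫⁻ z, P.indicator (fun x => H (G.ofNormal (x.1 + τ • G.tangent j x.2))) (z, u) :=
        lintegral_prod_symm' _ hm₁
    _ = ∫⁻ u, ∫⁻ z, Q.indicator (fun x => H (G.ofNormal x.1)) (z, u) := by
        refine lintegral_congr fun u => ?_
        rw [← lintegral_sub_right_eq_self _ (τ • G.tangent j u)]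
        refine lintegral_congr fun z => ?_
        have h1 : (z - τ • G.tangent j u, u) ∈ P ↔ (z, u) ∈ Q := by
          rw [hP, hQ, mem_ofPred_eq, mem_ofPred_eq, horiz_sub_smul_tangent]
        by_cases h : (z, u) ∈ Q
        · rw [indicator_of_mem h, indicator_of_mem (h1.mpr h), sub_add_cancel]
        · rw [indicator_of_notMem h, indicator_of_notMem (mt h1.mp h)]
    _ = ∫⁻ z, ∫⁻ u, Q.indicator (fun x => H (G.ofNormal x.1)) (z, u) := by
        rw [← lintegral_prod_symm' _ hm₂, lintegral_prod _ hm₂.aemeasurable]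
    _ = ∫⁻ z, ENNReal.ofReal (l ^ d) * volume (Metric.ball (0 : Euc d) 1) *
          H (G.ofNormal z) := by
        refine lintegral_congr fun z => ?_
        have h1 : (fun u => Q.indicator (fun x => H (G.ofNormal x.1)) (z, u)) =
            (Metric.closedBall (horiz z - τ • EuclideanSpace.single j 1) l).indicator
              fun _ => H (G.ofNormal z) := by
          ext u
          simp only [indicator, hQ, mem_ofPred_eq, mem_closedBall_iff_norm]
        rw [h1, lintegral_indicator_const Metric.isClosed_closedBall.measurableSet,
          Measure.addHaar_closedBall _ _ hl.le, finrank_euclideanSpace_fin, mul_comm]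
    _ = ENNReal.ofReal (l ^ d) * volume (Metric.ball (0 : Euc d) 1) *
          ∫⁻ z, H (G.ofNormal z) := lintegral_const_mul _ (by fun_prop)
    _ = _ := by
        rw [G.measurePreserving_ofNormal.lintegral_comp hHm, hH, lintegral_indicator hΩ]

lemma tanModulus_le (hΩ : IsCompact Ω) (hr : 1 ≤ r) (hN : 1 ≤ N) (ht : t ∈ Ioc (0 : ℝ) 1)
    (hK0 : 0 ≤ K) (hK : ∀ ξ ∈ G.carrier, ∀ t ∈ Ioc (0 : ℝ) 1,
      ∀ u ∈ G.baseBall (horiz (G.toNormal ξ)) (t * G.b), ∀ s ∈ Ioc 0 t, ∀ j : Fin d,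
      ‖G.linPart.symm (s • G.tangent j u)‖ ≤ K * t ∧
      |fderiv ℝ G.height ξ (G.linPart.symm (s • G.tangent j u))| ≤ K * t * t)
    (hchart : ∀ ξ ∈ G.carrier, Metric.infDist ξ (frontier Ω) ≤ κ → IsGraphChartAt Ω G.height
      (EuclideanSpace.single G.dir G.sgn) ε M Λ ξ)
    (hff' : f =ᵐ[volume.restrict Ω] f') {p q C : ℝ≥0∞} (hp : p ≠ 0)
    (hf' : p = ∞ ∨ Measurable f') {δ : ℝ}
    (hW : p = ∞ ∨ Measurable fun ξ => localModulus r Ω f' ξ δ q)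
    (hb : HasLocalBound Ω f' r N ε M Λ κ K t δ q C) (A₀ : ℝ) :
    G.tanModulus r Ω f t A₀ p ≤
      transferConst (volume (Metric.ball (0 : Euc d) 1)) C (r * N + 1) p * tau r Ω f' δ p q := by
  rw [tanModulus, min_eq_left ht.2]
  refine iSup₂_le fun s hs => iSup_le fun j => ?_
  simp only [finDiffOn_toNormal]
  have hb0 := G.b_pos
  have ht0 : 0 < t := ht.1
  have hl : 0 < t * G.b := mul_pos ht.1 hb0
  have hr0 : (0 : ℝ) < r := by exact_mod_cast hr
  -- The normalisation of the inner mean cancels the factor l^d, leaving a distortion constant free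
  -- of t.
  set c : ℝ≥0∞ := (ENNReal.ofReal ((G.b * t) ^ d))⁻¹ with hc
  have hc0 : c ≠ 0 := ENNReal.inv_ne_zero.mpr ENNReal.ofReal_ne_top
  have hcl : c * ENNReal.ofReal ((t * G.b) ^ d) = 1 := by
    rw [hc, mul_comm t]
    exact ENNReal.inv_mul_cancel (ENNReal.ofReal_pos.mpr (by positivity)).ne' ENNReal.ofReal_ne_top
  set ξ : Euc (d + 1) × Euc d → Euc (d + 1) := fun x => G.ofNormal x.1 with hξ
  set v : Euc (d + 1) × Euc d → Euc (d + 1) :=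
    fun x => G.linPart.symm (s • G.tangent j x.2) with hv
  have hξm : Measurable ξ := G.continuous_ofNormal.measurable.comp measurable_fst
  have hvm : Measurable v := by
    have h1 := (G.continuous_tangent j).measurable
    have h2 := G.linPart.symm.continuous.measurable
    exact h2.comp (by fun_prop)
  set S := G.normalInner A₀ t with hS
  have hSm : MeasurableSet S := G.measurableSet_normalInner A₀ t
  set D : Set (Euc (d + 1) × Euc d) :=
    {x | x.1 ∈ S ∧ x.2 ∈ G.baseBall (horiz x.1) (t * G.b)} with hD
  have hDm : MeasurableSet D :=
    (measurable_fst hSm).inter (G.measurableSet_baseBall_pair (t * G.b))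
  have hBm : ∀ z : Euc (d + 1), MeasurableSet (G.baseBall (horiz z) (t * G.b)) := fun z =>
    measurable_prodMk_left (x := z) (G.measurableSet_baseBall_pair (t * G.b))
  set E : Set (Euc (d + 1) × Euc d) :=
    {x | segment ℝ (ξ x) (ξ x + (r : ℝ) • v x) ⊆ Ω} with hE
  have hEm : MeasurableSet E := by
    have hm : Measurable fun x => (ξ x, ξ x + (r : ℝ) • v x) := by fun_prop
    exact hm (isClosed_segment_subset hΩ.isClosed).measurableSet
  set m : Measure (Euc (d + 1) × Euc d) := volume.prod volume with hm
  have hΦ : ∀ τ ∈ Icc (0 : ℝ) r, (c • m.restrict (E ∩ D)).map (fun x => ξ x + τ • v x) ≤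
      volume (Metric.ball (0 : Euc d) 1) • volume.restrict Ω := by
    intro τ hτ
    have e : ∀ x, ξ x + τ • v x = G.ofNormal (x.1 + (τ * s) • G.tangent j x.2) := fun x => by
      rw [ofNormal_add, mul_smul, map_smul]
    refine map_le_of_lintegral_comp_le (by fun_prop) fun F hF => ?_
    simp only [e]
    rw [lintegral_smul_measure, smul_eq_mul]
    calc _ ≤ c * (ENNReal.ofReal ((t * G.b) ^ d) * volume (Metric.ball (0 : Euc d) 1) *
          ∫⁻ x in Ω, F x) := by
          gcongr
          refine G.lintegral_comp_tangent_le hΩ.measurableSet hl (τ * s) j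
            (fun x hx => hx.2.2.2) (fun x hx => ?_) hF
          rw [← e]
          exact mem_of_segment_subset hr0 hx.1 hτ
      _ = _ := by rw [← mul_assoc, ← mul_assoc, hcl, one_mul]
  have hae : ∀ᵐ x ∂c • m.restrict (E ∩ D), ξ x ∈ Ω ∧
      segment ℝ (ξ x) (ξ x + (r : ℝ) • v x) ⊆ Ω ∧
      IsAdmissibleStep Ω ε M Λ κ K t (ξ x) (v x) := by
    rw [Measure.ae_ennreal_smul_measure_eq hc0]
    filter_upwards [ae_restrict_mem (hEm.inter hDm)] with x hx
    have hcar : ξ x ∈ G.carrier := ⟨x.1, hx.2.1.1, rfl⟩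
    have hx2 : x.2 ∈ G.baseBall (horiz (G.toNormal (ξ x))) (t * G.b) := by
      rw [hξ, toNormal_ofNormal]; exact hx.2.2
    have h1 := hK (ξ x) hcar t ht x.2 hx2 s hs j
    refine ⟨hx.1 (left_mem_segment ℝ _ _), hx.1, h1.1, fun hκ =>
      ⟨G.height, G.dir, G.sgn, G.abs_sgn, hchart _ hcar hκ, h1.2.trans ?_⟩⟩
    have := Real.sqrt_nonneg (Metric.infDist (ξ x) (frontier Ω))
    gcongr
    linarith
  -- On E the node maps control null sets; off E both truncated differences are 0, so the equality
  -- extends to all of D.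
  have hcongr : (fun x => finDiffOn r (v x) f Ω (ξ x)) =ᵐ[m.restrict D]
      fun x => finDiffOn r (v x) f' Ω (ξ x) := by
    have h1 := finDiff_congr_ae hξm hvm hΦ hff'
    rw [Filter.EventuallyEq, Measure.ae_ennreal_smul_measure_eq hc0,
      ae_restrict_iff' (hEm.inter hDm)] at h1
    rw [Filter.EventuallyEq, ae_restrict_iff' hDm]
    filter_upwards [h1] with x hx hxD
    by_cases hxE : x ∈ E
    · rw [finDiffOn_of_subset hxE, finDiffOn_of_subset hxE, hx ⟨hxE, hxD⟩]
    · rw [finDiffOn_of_not_subset hxE, finDiffOn_of_not_subset hxE]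
  have hsupp : (fun x => finDiffOn r (v x) f Ω (ξ x)).support ⊆ E := by
    intro x hx
    by_contra hn
    exact hx (finDiffOn_of_not_subset hn)
  calc _ ≤ eLpNorm (fun x => finDiffOn r (v x) f Ω (ξ x)) p (c • m.restrict D) :=
        eLpNorm_eLpNorm_le (g := fun x => finDiffOn r (v x) f Ω (ξ x)) hSm hBm hDm hc0 hp hcongr
          (hf'.imp_right fun h => measurable_finDiffOn r hΩ.isClosed h hvm hξm)
    _ = eLpNorm (fun x => finDiffOn r (v x) f Ω (ξ x)) p (c • m.restrict (E ∩ D)) := by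
        rw [← eLpNorm_restrict_eq_of_support_subset hsupp, Measure.restrict_smul,
          Measure.restrict_restrict hEm]
    _ = eLpNorm (fun x => finDiff r (v x) f (ξ x)) p (c • m.restrict (E ∩ D)) := by
        refine eLpNorm_congr_ae ?_
        filter_upwards [hae] with x hx using finDiffOn_of_subset hx.2.1
    _ ≤ _ := eLpNorm_finDiff_le hN hξm hvm hΦ hff' hp hW hb hae

end SpecialDomain

end IvanovModuli

/-! ### Representatives, constants and the theorem -/

namespace IvanovModuli

variable {d : ℕ} {Ω : Set (Euc (d + 1))}

lemma IsCompactC2Domain.isCompact (h : IsCompactC2Domain Ω) : IsCompact Ω := by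
  obtain ⟨⟨D, -, -, hD, rfl⟩, -⟩ := h
  exact Metric.isCompact_of_isClosed_isBounded isClosed_closure hD.closure

lemma IsCompactC2Domain.nonempty (h : IsCompactC2Domain Ω) : Ω.Nonempty := by
  obtain ⟨⟨D, -, hc, -, rfl⟩, -⟩ := h
  exact hc.nonempty.closure

lemma frontier_nonempty_of_isCompact (h : IsCompact Ω) (hne : Ω.Nonempty) :
    (frontier Ω).Nonempty := by
  rw [nonempty_iff_ne_empty, Ne, frontier_eq_empty_iff]
  rintro (h1 | h1)
  · exact hne.ne_empty h1
  · exact noncompact_univ (Euc (d + 1)) (h1 ▸ h)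

/-- A function of `L^p(Ω)` has a representative for which the local moduli are measurable, unless
`p = q = ∞`, when no change is needed. -/
lemma MemLpOn.exists_representative (hΩ : IsCompact Ω) {r : ℕ} (hr : 0 < r)
    {f : Euc (d + 1) → ℝ} {p q : ℝ≥0∞} (hqp : q ≤ p) (hf : MemLpOn f p Ω) :
    ∃ f' : Euc (d + 1) → ℝ, f =ᵐ[volume.restrict Ω] f' ∧ (q = ∞ ∨ Measurable f') ∧
      (p = ∞ ∨ Measurable f') ∧
      ∀ δ : ℝ, (p = ∞ ∨ Measurable fun ξ => localModulus r Ω f' ξ δ q) ∧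
        tau r Ω f' δ p q = tau r Ω f δ p q := by
  rcases eq_or_ne q ∞ with hq | hq
  · have hp : p = ∞ := top_le_iff.mp (hq ▸ hqp)
    exact ⟨f, Filter.EventuallyEq.rfl, Or.inl hq, Or.inl hp, fun δ => ⟨Or.inl hp, rfl⟩⟩
  · have hm : AEMeasurable f (volume.restrict Ω) := by
      unfold MemLpOn at hf
      split_ifs at hf
      · exact hf.aemeasurable hΩ.measurableSet
      · exact hf.aestronglyMeasurable.aemeasurable
    exact ⟨hm.mk f, hm.ae_eq_mk, Or.inr hm.measurable_mk, Or.inr hm.measurable_mk, fun δ =>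
      ⟨Or.inr (measurable_localModulus r hΩ.isClosed hm.measurable_mk δ hq),
        (tau_congr_ae hr hΩ.isClosed hm.ae_eq_mk δ p hq).symm⟩⟩

lemma exists_isSmallScale {ε M : ℝ} (hε : 0 < ε) (hε1 : ε ≤ 1) (hM : 1 ≤ M) :
    ∃ κ, IsSmallScale ε M M κ ∧ κ < ε := by
  have hM3 : 1 ≤ M ^ 3 := one_le_pow₀ hM
  have h0 : 0 < 100 * M ^ 3 := by positivity
  have hκ : 100 * M ^ 3 * (ε / (100 * M ^ 3)) = ε := mul_div_cancel₀ _ h0.ne'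
  have hκ0 : 0 < ε / (100 * M ^ 3) := by positivity
  set κ := ε / (100 * M ^ 3)
  have hlt : κ < ε := by nlinarith
  refine ⟨κ, ⟨hM, hM, hκ0, by linarith, ?_, ?_⟩, hlt⟩
  · have : M ≤ M ^ 3 := le_self_pow₀ hM (by norm_num)
    calc 100 * M * κ ≤ 100 * M ^ 3 * κ := by gcongr
      _ ≤ ε := hκ.le
  · calc 100 * M * M ^ 2 * κ = 100 * M ^ 3 * κ := by ring
      _ ≤ 1 := by rw [hκ]; exact hε1

end IvanovModuli

open IvanovModuli

theorem mainTheorem7 (d : ℕ) (hd : 1 ≤ d) (r : ℕ) (hr : 1 ≤ r)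
    (Ω : Set (IvanovModuli.Euc (d + 1))) (hΩ : IvanovModuli.IsCompactC2Domain Ω)
    (m : ℕ) (G : Fin m → IvanovModuli.SpecialDomain d) (hG : IvanovModuli.IsBoundaryCover G Ω)
    (A₀ : ℝ) (hA₀ : 1 < A₀) :
    ∃ c₀ : ℝ, 1 < c₀ ∧ ∀ p q : ℝ≥0∞, 0 < q → q ≤ p →
      ∃ C : ℝ, 0 < C ∧ ∀ f : IvanovModuli.Euc (d + 1) → ℝ, IvanovModuli.MemLpOn f p Ω →
        ∀ t : ℝ, 0 < t → t ≤ 1 →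
          IvanovModuli.omega G r Ω f t A₀ p ≤
            ENNReal.ofReal C * IvanovModuli.tau r Ω f (c₀ * t) p q := by
  have hc := hΩ.isCompact
  have hΓ := frontier_nonempty_of_isCompact hc hΩ.nonempty
  obtain ⟨ε, M, hε, hε1, hM, hch, hch'⟩ := exists_graphCharts hc hΓ hG
  obtain ⟨κ, hs, hκε⟩ := exists_isSmallScale hε hε1 hM
  have hA : HasGraphCharts Ω ε M M κ := fun ξ hξ hξκ => by
    obtain ⟨i, hi⟩ := hch ξ hξ (hξκ.trans_lt hκε)
    exact ⟨_, _, _, (G i).abs_sgn, hi⟩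
  obtain ⟨R₀, hR₀⟩ := hc.isBounded.subset_closedBall 0
  set R := max R₀ 1 with hRdef
  have hR0 : 0 < R := lt_max_of_lt_right one_pos
  have hR : Ω ⊆ Metric.closedBall 0 R :=
    hR₀.trans (Metric.closedBall_subset_closedBall (le_max_left _ _))
  choose K₂ hK₂0 hK₂ using fun i => (G i).exists_tangent_bounds
  have hκ0 := hs.pos
  set K₁ := 2 * R * (M / κ + M * κ) + Real.sqrt (2 * R) * (M + M) with hK₁
  have hK₁0 : 0 ≤ K₁ := by positivity
  have hsum : 0 ≤ ∑ i, K₂ i := Finset.sum_nonneg fun i _ => hK₂0 i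
  -- One admissibility constant for all steps: 2R bounds φ_Ω, K₁ its transversal part, and the sum
  -- the tangential steps of all domains.
  set K := 1 + 2 * R + K₁ + ∑ i, K₂ i with hK
  have hKi : ∀ i, K₂ i ≤ K := fun i => by
    have := Finset.single_le_sum (f := K₂) (fun i _ => hK₂0 i) (Finset.mem_univ i)
    linarith
  have hK0 : 0 ≤ K := by positivity
  obtain ⟨c₀, N, hc₀, hN, hmain⟩ := exists_enorm_finDiff_le_sum_localModulus hc hA hs hΓ hr
    (show 1 ≤ K by linarith) one_pos
  refine ⟨c₀, hc₀, fun p q hq hqp => ?_⟩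
  have hp : p ≠ 0 := (hq.trans_le hqp).ne'
  obtain ⟨C, hC, hbound⟩ := hmain q hq
  set C₁ := transferConst 3 C (r * N + 1) p
  set C₂ := transferConst (volume (Metric.ball (0 : Euc d) 1)) C (r * N + 1) p
  have hC₁ : C₁ ≠ ∞ := transferConst_ne_top (by simp) hC _ _
  have hC₂ : C₂ ≠ ∞ := transferConst_ne_top measure_ball_lt_top.ne hC _ _
  have hC₃ : C₁ + m * C₂ ≠ ∞ :=
    ENNReal.add_ne_top.mpr ⟨hC₁, ENNReal.mul_ne_top (ENNReal.natCast_ne_top m) hC₂⟩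
  -- The summand 1 only makes the real constant strictly positive.
  refine ⟨(C₁ + m * C₂).toReal + 1, by positivity, fun f hf t ht0 ht1 => ?_⟩
  have ht : t ∈ Ioc (0 : ℝ) 1 := ⟨ht0, ht1⟩
  obtain ⟨f', hff', hf'q, hf'p, hf'⟩ := hf.exists_representative hc hr hqp
  obtain ⟨hW, htau⟩ := hf' (c₀ * t)
  have hb : HasLocalBound Ω f' r N ε M M κ K t (c₀ * t) q C := fun ξ hξ v hseg hv =>
    hbound f' hf'q ξ hξ t ht v hv.1 hseg fun _ => hv.2
  rw [← htau]
  calc omega G r Ω f t A₀ p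
      ≤ C₁ * tau r Ω f' (c₀ * t) p q + ∑ _i : Fin m, C₂ * tau r Ω f' (c₀ * t) p q := by
        refine add_le_add (iSup_le fun j => ?_) (Finset.sum_le_sum fun i _ => ?_)
        · exact dtModulus_le hc hA hs hΓ hr hN hR0 hR (by linarith) (by linarith) ht0 hff' hp hW
            hb j
        · refine (G i).tanModulus_le hc hr hN ht hK0 (fun ξ hξ t ht u hu s hs j => ?_)
            (fun ξ hξ hξκ => hch' i ξ hξ (hξκ.trans_lt hκε)) hff' hp hf'p hW hb A₀
          have h1 := hK₂ i ξ hξ t ht u hu s hs j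
          have ht0 := ht.1
          refine ⟨h1.1.trans ?_, h1.2.trans ?_⟩
          · gcongr; exact hKi i
          · gcongr; exact hKi i
    _ = (C₁ + m * C₂) * tau r Ω f' (c₀ * t) p q := by
        rw [Finset.sum_const, Finset.card_univ, Fintype.card_fin, nsmul_eq_mul]
        ring
    _ ≤ _ := by
        gcongr
        rw [← ENNReal.ofReal_toReal hC₃]
        exact ENNReal.ofReal_le_ofReal (by
          rw [ENNReal.toReal_ofReal ENNReal.toReal_nonneg]; linarith)
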